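/- Let $S$ be a separated noetherian scheme and let $Sm_S$ be the category of smooth separated $S$-schemes of finite type. Let $Cor$ be a ringoid over $S$: a category enriched over abelian groups with the same objects as $Sm_S$, together with a functor $Sm_S\to Cor$ that is the identity on objects, and with an extension of the products $-\times_S U$ to $Cor$ (an action $(X,U)\mapsto X\times_S U$ of the monoidal category $Sm_S$ on $Cor$, additive on the groups $Cor(X,Y)$, natural in $U$, compatible with the unit and associativity isomorphisms, and given by the product of morphisms of schemes on $Sm_S$). Let $Pre$ be the abelian category of additive functors $Cor^{op}\to Ab$, let $\mathbb Z_{tr}(X)=Cor(-,X)$, and let $D^-=\mathbf D^-(Pre)$ be the bounded above derived category. The exact functor $F\mapsto F(-\times\mathbb A^1)$ induces an endofunctor $\mathcal Hom(\mathbb A^1,-)$ of $D^-$, with natural transformations $p\colon \mathrm{Id}\to\mathcal Hom(\mathbb A^1,-)$ (given by the projections $X\times\mathbb A^1\to X$) and $s_0,s_1\colon\mathcal Hom(\mathbb A^1,-)\to \mathrm{Id}$ (given by the sections $0,1$ of $\mathbb A^1$). An object $A$ of $D^-$ is $\mathbb A^1$-invariant if $p(A)$ is an isomorphism; it is $\mathbb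 A^1$-contractible if there is $h\colon A\to\mathcal Hom(\mathbb A^1,A)$ with $s_0\circ h=\mathrm{id}_A$ and $s_1\circ h=0$. A presheaf $F\in Pre$ is homotopy invariant if all maps $F(X)\to F(X\times\mathbb A^1)$ are isomorphisms, and is $\mathbb A^1$-contractible if there is such an $h\colon F\to F(-\times\mathbb A^1)$ in $Pre$. A thick subcategory is a full triangulated subcategory closed under retracts. Let $D^-_{inv}\subset D^-$ be the full subcategory of $\mathbb A^1$-invariant objects, and let $D^-_{contr}\subset D^-$ be the smallest thick subcategory that contains all $\mathbb A^1$-contractible objects and is closed under all (small) direct sums that exist in $D^-$. Then: 1. $D^-_{inv}$ is a thick subcategory of $D^-$, closed under all direct sums and all products that exist in $D^-$. It consists exactly of the complexes all of whose cohomology presheaves are homotopy invariant. It is generated by the homotopy invariant presheaves (placed in degree $0$): it is the smallest thick subcategory of $D^-$ that contains them and is closed under all products existing in $D^-$; moreover the smallest thick subcategory containing them (with no infinite sums or products) consists exactly of the objects of $D^-_{inv}$ with bounded cohomology. 2. $D^-_{contr}$ consists exactly of the complexes that are quasi-isomorphic to bounded above complexes whose terms are $\mathbb A^1$-contractible presheaves.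 It is the smallest thick subcategory of $D^-$, closed under all direct sums existing in $D^-$, that contains the presheaves $\mathbb Z_{tr}(X\times\mathbb A^1)/\mathbb Z_{tr}(X)$ for all $X\in Sm_S$, where $\mathbb Z_{tr}(X)$ is embedded by the zero section. 3. There is a semi-orthogonal decomposition $D^-=\langle D^-_{inv},D^-_{contr}\rangle$: both subcategories are thick, $Hom_{D^-}(B,A)=0$ for all $B\in D^-_{contr}$, $A\in D^-_{inv}$, and every $C\in D^-$ sits in a distinguished triangle $B\to C\to A\to B[1]$ with $B\in D^-_{contr}$ and $A\in D^-_{inv}$. The embedding $D^-_{inv}\to D^-$ has a left adjoint, and it is given by the Suslin complex: on bounded above complexes $K$ it is naturally isomorphic in the derived category to $C^*(K)=\mathcal Hom(\Delta^\bullet,K)$, the total complex of the bicomplex with terms $K^j(-\times\Delta^i)$ in total degree $j-i$, whose first differential is the alternating sum of the maps induced by the face maps of the cosimplicial scheme $\Delta^\bullet$, $\Delta^n=S\times \operatorname{Spec}\mathbb Z[x_0,\dots,x_n]/(x_0+\dots+x_n-1)$. -/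

import Mathlib

open CategoryTheory Limits MonoidalCategory CartesianMonoidalCategory Opposite AlgebraicGeometry
universe w v u

namespace A1Motives

noncomputable section

/-! ## Smooth schemes over `S`, the affine line and the algebraic simplices -/

/-- Smooth separated morphisms of finite type (local finite presentation is part of smoothness). -/
def smMor : MorphismProperty Scheme.{u} :=
  @Smooth ⊓ @IsSeparated ⊓ @QuasiCompact

instance : smMor.{u}.IsStableUnderComposition where
  comp_mem _ _ hf hg :=
    ⟨⟨MorphismProperty.comp_mem @Smooth _ _ hf.1.1 hg.1.1,
      MorphismProperty.comp_mem @IsSeparated _ _ hf.1.2 hg.1.2⟩,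
      MorphismProperty.comp_mem @QuasiCompact _ _ hf.2 hg.2⟩

instance : smMor.{u}.IsStableUnderBaseChange where
  of_isPullback sq hg :=
    ⟨⟨MorphismProperty.of_isPullback (P := @Smooth) sq hg.1.1,
      MorphismProperty.of_isPullback (P := @IsSeparated) sq hg.1.2⟩,
      MorphismProperty.of_isPullback (P := @QuasiCompact) sq hg.2⟩

instance : smMor.{u}.ContainsIdentities where
  id_mem X := ⟨⟨inferInstanceAs (Smooth (𝟙 X)), inferInstanceAs (IsSeparated (𝟙 X))⟩,
    inferInstanceAs (QuasiCompact (𝟙 X))⟩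

instance (S : Scheme.{u}) :
    (smMor.{u}.overObj (X := S)).IsClosedUnderLimitsOfShape (Discrete WalkingPair) where
  limitsOfShape_le := by
    rintro X ⟨h⟩
    let A := h.diag.obj ⟨.left⟩
    let B := h.diag.obj ⟨.right⟩
    let e : X ≅ A ⊗ B :=
      ((IsLimit.postcomposeHomEquiv (diagramIsoPair h.diag) _).symm
        h.isLimit).conePointUniqueUpToIso (tensorProductIsBinaryProduct A B)
    refine (smMor.overObj).prop_of_iso e.symm ?_
    change smMor (pullback.fst A.hom B.hom ≫ A.hom)
    exact smMor.comp_mem _ _ (smMor.pullback_fst _ _ (h.prop_diag_obj ⟨.right⟩))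
      (h.prop_diag_obj ⟨.left⟩)

/-- `Sm/S`: the category of smooth separated schemes of finite type over `S`. It is a cartesian
monoidal category, with `X ⊗ Y = X ×_S Y` and unit `S`. -/
abbrev Sm (S : Scheme.{u}) := (smMor.{u}.overObj (X := S)).FullSubcategory

theorem smMor_terminal_from (R : Type u) [CommRing R] [Algebra (ULift.{u} ℤ) R] [Algebra.Smooth (ULift.{u} ℤ) R] :
    smMor (terminal.from (Spec (.of R))) := by
  have h : terminal.from (Spec (.of R)) = Spec.map (CommRingCat.ofHom (algebraMap (ULift.{u} ℤ) R)) ≫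
      terminal.from _ := Subsingleton.elim _ _
  have : IsIso (terminal.from (Spec (CommRingCat.of (ULift.{u} ℤ)))) :=
    (specULiftZIsTerminal.uniqueUpToIso terminalIsTerminal).isIso_hom
  have h2 : Smooth (Spec.map (CommRingCat.ofHom (algebraMap (ULift.{u} ℤ) R))) := by
    rw [HasRingHomProperty.Spec_iff (P := @Smooth)]
    exact RingHom.smooth_algebraMap.mpr inferInstance
  refine ⟨⟨?_, inferInstanceAs (IsSeparated (terminal.from (Spec (.of R))))⟩,
      inferInstanceAs (QuasiCompact (terminal.from (Spec (.of R))))⟩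
  rw [h]
  exact MorphismProperty.comp_mem @Smooth _ _ h2 (inferInstance : Smooth _)

instance (σ : Type*) [Finite σ] :
    Algebra.Smooth (ULift.{u} ℤ) (MvPolynomial σ (ULift.{u} ℤ)) where

/-- The ring `ℤ[x₀, …, xₙ] / (x₀ + ⋯ + xₙ - 1)`, in the universe `u`. -/
def simplexRing (n : ℕ) : Type u :=
  MvPolynomial (Fin (n + 1)) (ULift.{u} ℤ) ⧸
    Ideal.span {(∑ i, MvPolynomial.X i - 1 : MvPolynomial (Fin (n + 1)) (ULift.{u} ℤ))}

instance (n : ℕ) : CommRing (simplexRing.{u} n) :=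
  inferInstanceAs (CommRing (_ ⧸ Ideal.span _))

instance (n : ℕ) : Algebra (ULift.{u} ℤ) (simplexRing.{u} n) :=
  inferInstanceAs (Algebra (ULift.{u} ℤ) (_ ⧸ Ideal.span _))

/-- The quotient map onto `simplexRing n`. -/
def simplexMk (n : ℕ) :
    MvPolynomial (Fin (n + 1)) (ULift.{u} ℤ) →ₐ[ULift.{u} ℤ] simplexRing.{u} n :=
  Ideal.Quotient.mkₐ _ _

/-- The barycentric coordinates. -/
def simplexCoord {n : ℕ} (i : Fin (n + 1)) : simplexRing.{u} n :=
  simplexMk n (MvPolynomial.X i)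

theorem sum_simplexCoord (n : ℕ) : ∑ i, simplexCoord.{u} (n := n) i = 1 := by
  have : simplexMk.{u} n (∑ i, MvPolynomial.X i - 1) = 0 :=
    Ideal.Quotient.eq_zero_iff_mem.mpr (Ideal.subset_span rfl)
  rw [map_sub, map_sum, map_one, sub_eq_zero] at this
  exact this

/-- Algebra maps out of `simplexRing n` are tuples with sum `1`. -/
def simplexLift {n : ℕ} {A : Type u} [CommRing A] [Algebra (ULift.{u} ℤ) A] (v : Fin (n + 1) → A)
    (hv : ∑ i, v i = 1) : simplexRing.{u} n →ₐ[ULift.{u} ℤ] A :=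
  Ideal.Quotient.liftₐ _ (MvPolynomial.aeval v) (by
    intro a ha
    have : Ideal.span {(∑ i, MvPolynomial.X i - 1 : MvPolynomial (Fin (n + 1)) (ULift.{u} ℤ))} ≤
      RingHom.ker (MvPolynomial.aeval v : _ →ₐ[ULift.{u} ℤ] A) := by
      rw [Ideal.span_le, Set.singleton_subset_iff]
      simp [RingHom.mem_ker, hv]
    exact this ha)

@[simp] theorem simplexLift_coord {n : ℕ} {A : Type u} [CommRing A] [Algebra (ULift.{u} ℤ) A]
    (v : Fin (n + 1) → A) (hv : ∑ i, v i = 1) (i : Fin (n + 1)) :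
    simplexLift v hv (simplexCoord i) = v i :=
  MvPolynomial.aeval_X v i

theorem simplexHom_ext {n : ℕ} {A : Type u} [CommRing A] [Algebra (ULift.{u} ℤ) A]
    {f g : simplexRing.{u} n →ₐ[ULift.{u} ℤ] A} (h : ∀ i, f (simplexCoord i) = g (simplexCoord i)) :
    f = g := by
  have : f.comp (simplexMk n) = g.comp (simplexMk n) := MvPolynomial.algHom_ext h
  ext x
  obtain ⟨y, rfl⟩ := Ideal.Quotient.mk_surjective x
  exact DFunLike.congr_fun this y

/-- The ring of the `n`-simplex is a polynomial ring in `n` variables. -/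
def simplexRingEquiv (n : ℕ) :
    MvPolynomial (Fin n) (ULift.{u} ℤ) ≃ₐ[ULift.{u} ℤ] simplexRing.{u} n :=
  AlgEquiv.ofAlgHom
    (MvPolynomial.aeval fun i => simplexCoord i.succ)
    (simplexLift (Fin.cons (1 - ∑ i, MvPolynomial.X i) MvPolynomial.X)
      (by simp [Fin.sum_univ_succ]))
    (simplexHom_ext fun i => by
      refine Fin.cases ?_ (fun j => ?_) i
      · have := sum_simplexCoord.{u} n
        rw [Fin.sum_univ_succ] at this
        simp [← this]
      · simp)
    (MvPolynomial.algHom_ext fun i => by simp)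

instance (n : ℕ) : Algebra.Smooth (ULift.{u} ℤ) (simplexRing.{u} n) :=
  .of_equiv (simplexRingEquiv n)

/-- The map of rings attached to `θ : [m] ⟶ [n]`; it sends `x_j` to the sum of the `x_i` with
`θ i = j`, so that `Δ^m ⟶ Δ^n` is the affine map sending the vertex `i` to the vertex `θ i`. -/
def simplexRingMap {m n : SimplexCategory} (θ : m ⟶ n) :
    simplexRing.{u} n.len →ₐ[ULift.{u} ℤ] simplexRing.{u} m.len :=
  simplexLift (fun j => ∑ i with θ.toOrderHom i = j, simplexCoord i) (by
    rw [Finset.sum_fiberwise]; exact sum_simplexCoord _)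

theorem simplexRingMap_id (n : SimplexCategory) :
    simplexRingMap.{u} (𝟙 n) = AlgHom.id _ _ :=
  simplexHom_ext fun i => by simp [simplexRingMap, Finset.sum_filter]

theorem simplexRingMap_comp {l m n : SimplexCategory} (θ : l ⟶ m) (η : m ⟶ n) :
    simplexRingMap.{u} (θ ≫ η) = (simplexRingMap θ).comp (simplexRingMap η) :=
  simplexHom_ext fun k => by
    simp only [simplexRingMap, simplexLift_coord, AlgHom.comp_apply, map_sum]
    rw [Finset.sum_fiberwise_eq_sum_filter]
    exact Finset.sum_congr (by ext; simp) fun _ _ => rfl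


/-- For a commutative ring `R` (viewed as an algebra over the universe lift of `ℤ`), the base change
`S ×_{Spec ℤ} Spec R`. -/
abbrev specProd (S : Scheme.{u}) (R : Type u) [CommRing R] : Scheme.{u} :=
  pullback (terminal.from S) (terminal.from (Spec (.of R)))

/-- The map `S × Spec R' ⟶ S × Spec R` induced by `φ : R ⟶ R'`. -/
def specProdMap (S : Scheme.{u}) {R R' : Type u} [CommRing R] [Algebra (ULift.{u} ℤ) R]
    [CommRing R'] [Algebra (ULift.{u} ℤ) R'] (φ : R →ₐ[ULift.{u} ℤ] R') :
    specProd S R' ⟶ specProd S R :=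
  pullback.map _ _ _ _ (𝟙 S) (Spec.map (CommRingCat.ofHom φ.toRingHom)) (𝟙 _)
    (Subsingleton.elim _ _) (Subsingleton.elim _ _)

@[simp]
theorem specProdMap_fst (S : Scheme.{u}) {R R' : Type u} [CommRing R] [Algebra (ULift.{u} ℤ) R]
    [CommRing R'] [Algebra (ULift.{u} ℤ) R'] (φ : R →ₐ[ULift.{u} ℤ] R') :
    specProdMap S φ ≫ pullback.fst _ _ = pullback.fst _ _ :=
  (pullback.lift_fst _ _ _).trans (Category.comp_id _)

@[simp]
theorem specProdMap_snd (S : Scheme.{u}) {R R' : Type u} [CommRing R] [Algebra (ULift.{u} ℤ) R]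
    [CommRing R'] [Algebra (ULift.{u} ℤ) R'] (φ : R →ₐ[ULift.{u} ℤ] R') :
    specProdMap S φ ≫ pullback.snd _ _ =
      pullback.snd _ _ ≫ Spec.map (CommRingCat.ofHom φ.toRingHom) :=
  pullback.lift_snd _ _ _

theorem specProdMap_id (S : Scheme.{u}) (R : Type u) [CommRing R] [Algebra (ULift.{u} ℤ) R] :
    specProdMap S (AlgHom.id (ULift.{u} ℤ) R) = 𝟙 _ := by
  refine pullback.hom_ext (by simp) ?_
  rw [specProdMap_snd, Category.id_comp]
  exact (congrArg _ (Spec.map_id _)).trans (Category.comp_id _)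

theorem specProdMap_comp (S : Scheme.{u}) {R R' R'' : Type u} [CommRing R]
    [Algebra (ULift.{u} ℤ) R] [CommRing R'] [Algebra (ULift.{u} ℤ) R'] [CommRing R'']
    [Algebra (ULift.{u} ℤ) R''] (φ : R →ₐ[ULift.{u} ℤ] R') (ψ : R' →ₐ[ULift.{u} ℤ] R'') :
    specProdMap S (ψ.comp φ) = specProdMap S ψ ≫ specProdMap S φ := by
  refine pullback.hom_ext (by simp) ?_
  rw [specProdMap_snd, Category.assoc, specProdMap_snd, ← Category.assoc, specProdMap_snd,
    Category.assoc, ← Spec.map_comp]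
  rfl

/-- `S × Spec R` as a smooth `S`-scheme, for a smooth `ℤ`-algebra `R`. -/
def specOver (S : Scheme.{u}) (R : Type u) [CommRing R] [Algebra (ULift.{u} ℤ) R]
    [Algebra.Smooth (ULift.{u} ℤ) R] : Sm S where
  obj := Over.mk (pullback.fst _ _ : specProd S R ⟶ S)
  property := smMor.pullback_fst _ _ (smMor_terminal_from R)

/-- The cosimplicial smooth `S`-scheme `Δ^•`, with
`Δ^n = S × Spec ℤ[x₀, …, xₙ] / (x₀ + ⋯ + xₙ - 1)`. -/
def simplex (S : Scheme.{u}) : SimplexCategory ⥤ Sm S where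
  obj n := specOver S (simplexRing.{u} n.len)
  map θ := ObjectProperty.homMk
    (Over.homMk (specProdMap S (simplexRingMap θ)) (specProdMap_fst _ _))
  map_id n := by
    ext : 2
    exact (congrArg _ (simplexRingMap_id n)).trans (specProdMap_id S _)
  map_comp θ η := by
    ext : 2
    exact (congrArg _ (simplexRingMap_comp θ η)).trans (specProdMap_comp S _ _)
/-- The affine line over `S`. -/
def affineLine (S : Scheme.{u}) : Sm S where
  obj := Over.mk (𝔸(PUnit.{u + 1}; S) ↘ S)
  property := smMor.pullback_fst _ _ (smMor_terminal_from _)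

/-- The section `S ⟶ 𝔸¹` with coordinate `a`. -/
def affineLinePoint (S : Scheme.{u}) (a : Γ(S, ⊤)) : 𝟙_ (Sm S) ⟶ affineLine S :=
  ObjectProperty.homMk (Over.homMk (AffineSpace.homOfVector (𝟙 S) (fun _ => a))
    (AffineSpace.homOfVector_over _ _))


/-! ## Ringoids of correspondences and presheaves with transfers -/

/-- A ringoid of correspondences over `S`: a category `Cor` enriched over abelian groups whose
objects are those of `Sm/S`, a functor `Sm/S ⥤ Cor` which is the identity on objects (on morphisms
it is `graph`; identities of `Cor` are the `graph (𝟙 X)`), and an extension `tensor a U = a × U` of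
the products `- × U` from `Sm/S` to `Cor`, i.e. an action of the monoidal category `Sm/S` on `Cor`,
additive in `a`, and given by the product of `S`-schemes on `Sm/S`. -/
structure Ringoid (S : Scheme.{u}) where
  /-- The groups of correspondences. -/
  Hom : Sm S → Sm S → Type u
  /-- The group structure. -/
  addCommGroup : ∀ X Y : Sm S, AddCommGroup (Hom X Y)
  /-- The composition of correspondences, in diagrammatic order. -/
  comp : ∀ {X Y Z : Sm S}, Hom X Y → Hom Y Z → Hom X Z
  comp_assoc : ∀ {W X Y Z : Sm S} (a : Hom W X) (b : Hom X Y) (c : Hom Y Z),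
    comp (comp a b) c = comp a (comp b c)
  add_comp : ∀ {X Y Z : Sm S} (a a' : Hom X Y) (b : Hom Y Z),
    comp (a + a') b = comp a b + comp a' b
  comp_add : ∀ {X Y Z : Sm S} (a : Hom X Y) (b b' : Hom Y Z),
    comp a (b + b') = comp a b + comp a b'
  /-- The correspondence attached to a morphism of schemes. -/
  graph : ∀ {X Y : Sm S}, (X ⟶ Y) → Hom X Y
  graph_id_comp : ∀ {X Y : Sm S} (a : Hom X Y), comp (graph (𝟙 X)) a = a
  comp_graph_id : ∀ {X Y : Sm S} (a : Hom X Y), comp a (graph (𝟙 Y)) = a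
  graph_comp : ∀ {X Y Z : Sm S} (f : X ⟶ Y) (g : Y ⟶ Z),
    graph (f ≫ g) = comp (graph f) (graph g)
  /-- The product of a correspondence with a smooth scheme. -/
  tensor : ∀ {X Y : Sm S} (_ : Hom X Y) (U : Sm S), Hom (X ⊗ U) (Y ⊗ U)
  tensor_add : ∀ {X Y : Sm S} (a b : Hom X Y) (U : Sm S),
    tensor (a + b) U = tensor a U + tensor b U
  tensor_comp : ∀ {X Y Z : Sm S} (a : Hom X Y) (b : Hom Y Z) (U : Sm S),
    tensor (comp a b) U = comp (tensor a U) (tensor b U)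
  tensor_graph : ∀ {X Y : Sm S} (f : X ⟶ Y) (U : Sm S), tensor (graph f) U = graph (f ▷ U)
  tensor_naturality : ∀ {X Y : Sm S} (a : Hom X Y) {U V : Sm S} (g : U ⟶ V),
    comp (tensor a U) (graph (Y ◁ g)) = comp (graph (X ◁ g)) (tensor a V)
  tensor_unit : ∀ {X Y : Sm S} (a : Hom X Y),
    comp (tensor a (𝟙_ (Sm S))) (graph (ρ_ Y).hom) = comp (graph (ρ_ X).hom) a
  tensor_assoc : ∀ {X Y : Sm S} (a : Hom X Y) (U V : Sm S),
    comp (tensor (tensor a U) V) (graph (α_ Y U V).hom) =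
      comp (graph (α_ X U V).hom) (tensor a (U ⊗ V))

attribute [instance] Ringoid.addCommGroup

variable {S : Scheme.{u}} (R : Ringoid S)

/-- The category `Cor` of correspondences: its objects are the smooth `S`-schemes. -/
structure Cor (R : Ringoid S) where
  /-- The underlying smooth scheme. -/
  toSm : Sm S

instance : Category.{u} (Cor R) where
  Hom X Y := R.Hom X.toSm Y.toSm
  id X := R.graph (𝟙 X.toSm)
  comp a b := R.comp a b
  id_comp := R.graph_id_comp
  comp_id := R.comp_graph_id
  assoc := R.comp_assoc

instance : Preadditive (Cor R) where
  homGroup X Y := R.addCommGroup X.toSm Y.toSm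
  add_comp _ _ _ := R.add_comp
  comp_add _ _ _ := R.comp_add

/-- The functor `Sm/S ⥤ Cor` which is the identity on objects. -/
def graphFunctor : Sm S ⥤ Cor R where
  obj X := ⟨X⟩
  map f := R.graph f
  map_id _ := rfl
  map_comp := R.graph_comp

/-- The additive endofunctor `- × U` of `Cor`. -/
def corTensor (U : Sm S) : Cor R ⥤ Cor R where
  obj X := ⟨X.toSm ⊗ U⟩
  map a := R.tensor a U
  map_id X := (R.tensor_graph (𝟙 X.toSm) U).trans (congrArg R.graph (id_whiskerRight _ _))
  map_comp a b := R.tensor_comp a b U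

instance (U : Sm S) : (corTensor R U).Additive where
  map_add {_ _ a b} := R.tensor_add a b U

/-- The functor `- × U` is natural in the smooth scheme `U`. -/
def corTensorMap {U V : Sm S} (g : U ⟶ V) : corTensor R U ⟶ corTensor R V where
  app X := (graphFunctor R).map (X.toSm ◁ g)
  naturality _ _ a := R.tensor_naturality a g

/-- `X × S = X`. -/
def corTensorUnit : corTensor R (𝟙_ (Sm S)) ≅ 𝟭 (Cor R) :=
  NatIso.ofComponents (fun X => (graphFunctor R).mapIso (ρ_ X.toSm)) (fun a => R.tensor_unit a)

/-- Additive functors from `Corᵒᵖ` to abelian groups. -/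
def isPre : ObjectProperty ((Cor R)ᵒᵖ ⥤ AddCommGrpCat.{u}) := fun F => F.Additive

instance (J : Type*) [Category J] [HasLimitsOfShape J AddCommGrpCat.{u}] :
    (isPre R).IsClosedUnderLimitsOfShape J where
  limitsOfShape_le := by
    rintro F ⟨h⟩
    refine ⟨fun {X Y f g} => (isLimitOfPreserves ((evaluation _ _).obj Y) h.isLimit).hom_ext
      fun j => ?_⟩
    have hj : (h.diag.obj j).Additive := h.prop_diag_obj j
    have hn {X Y : (Cor R)ᵒᵖ} (f : X ⟶ Y) : F.map f ≫ (h.π.app j).app Y =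
      (h.π.app j).app X ≫ (h.diag.obj j).map f := (h.π.app j).naturality f
    change F.map (f + g) ≫ (h.π.app j).app Y = (F.map f + F.map g) ≫ (h.π.app j).app Y
    rw [Preadditive.add_comp, hn, hn, hn, Functor.map_add, Preadditive.comp_add]

instance (J : Type*) [Category J] [HasColimitsOfShape J AddCommGrpCat.{u}] :
    (isPre R).IsClosedUnderColimitsOfShape J where
  colimitsOfShape_le := by
    rintro F ⟨h⟩
    refine ⟨fun {X Y f g} => (isColimitOfPreserves ((evaluation _ _).obj X) h.isColimit).hom_ext
      fun j => ?_⟩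
    have hj : (h.diag.obj j).Additive := h.prop_diag_obj j
    have hn {X Y : (Cor R)ᵒᵖ} (f : X ⟶ Y) : (h.ι.app j).app X ≫ F.map f =
      (h.diag.obj j).map f ≫ (h.ι.app j).app Y := ((h.ι.app j).naturality f).symm
    change (h.ι.app j).app X ≫ F.map (f + g) = (h.ι.app j).app X ≫ (F.map f + F.map g)
    rw [Preadditive.comp_add, hn, hn, hn, Functor.map_add, Preadditive.add_comp]

instance : (isPre R).IsClosedUnderFiniteProducts where
  isClosedUnderLimitsOfShape _ _ := inferInstance

instance : (isPre R).ContainsZero := inferInstance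
instance : (isPre R).IsClosedUnderKernels where
  kernels_le := by
    rintro _ ⟨f, k, hk, hf⟩
    refine (isPre R).prop_of_isLimit hk ?_
    rintro (_ | _)
    exacts [hf.1, hf.2]

instance : (isPre R).IsClosedUnderCokernels where
  cokernels_le := by
    rintro _ ⟨f, k, hk, hf⟩
    refine (isPre R).prop_of_isColimit hk ?_
    rintro (_ | _)
    exacts [hf.1, hf.2]

/-- The abelian category `Pre(Cor)` of presheaves with transfers. -/
abbrev Pre := (isPre R).FullSubcategory

instance : PreservesFiniteLimits (isPre R).ι where
  preservesFiniteLimits J _ _ := by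
    have : CreatesLimitsOfShape J (isPre R).ι :=
      createsLimitsOfShapeFullSubcategoryInclusion J _
    infer_instance

instance : PreservesFiniteColimits (isPre R).ι where
  preservesFiniteColimits J _ _ := by
    have : CreatesColimitsOfShape J (isPre R).ι :=
      createsColimitsOfShapeFullSubcategoryInclusion J _
    infer_instance

/-- The exact endofunctor `F ↦ F(- × U)` of `Pre(Cor)`. -/
def ihom (U : Sm S) : Pre R ⥤ Pre R :=
  (isPre R).lift ((isPre R).ι ⋙ (Functor.whiskeringLeft _ _ _).obj (corTensor R U).op)
    (fun F => by
      have : F.obj.Additive := F.property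
      exact inferInstanceAs ((corTensor R U).op ⋙ F.obj).Additive)

instance (U : Sm S) : (ihom R U).Additive where
instance (U : Sm S) : PreservesFiniteLimits (ihom R U) where
  preservesFiniteLimits J _ _ := by
    have : PreservesLimitsOfShape J (ihom R U ⋙ (isPre R).ι) := 
      inferInstanceAs (PreservesLimitsOfShape J ((isPre R).ι ⋙ (Functor.whiskeringLeft _ _ _).obj (corTensor R U).op))
    exact preservesLimitsOfShape_of_reflects_of_preserves _ (isPre R).ι

instance (U : Sm S) : PreservesFiniteColimits (ihom R U) where
  preservesFiniteColimits J _ _ := by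
    have : PreservesColimitsOfShape J (ihom R U ⋙ (isPre R).ι) := 
      inferInstanceAs (PreservesColimitsOfShape J ((isPre R).ι ⋙ (Functor.whiskeringLeft _ _ _).obj (corTensor R U).op))
    exact preservesColimitsOfShape_of_reflects_of_preserves _ (isPre R).ι



theorem corTensorMap_id (U : Sm S) : corTensorMap R (𝟙 U) = 𝟙 _ := by
  ext X
  exact (congrArg (graphFunctor R).map (whiskerLeft_id _ _)).trans ((graphFunctor R).map_id _)

theorem corTensorMap_comp {U V W : Sm S} (f : U ⟶ V) (g : V ⟶ W) :
    corTensorMap R (f ≫ g) = corTensorMap R f ≫ corTensorMap R g := by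
  ext X
  exact (congrArg (graphFunctor R).map (whiskerLeft_comp _ _ _)).trans
    ((graphFunctor R).map_comp _ _)

/-- The natural morphism of functors on `Cor` given by the projections `X × U ⟶ X`. -/
def corProj (U : Sm S) : corTensor R U ⟶ 𝟭 (Cor R) :=
  corTensorMap R (toUnit U) ≫ (corTensorUnit R).hom

theorem corProj_app (U : Sm S) (X : Cor R) :
    (corProj R U).app X = (graphFunctor R).map (fst X.toSm U) := by
  change (graphFunctor R).map (X.toSm ◁ toUnit U) ≫ (graphFunctor R).map (ρ_ X.toSm).hom = _
  rw [← Functor.map_comp, rightUnitor_hom, whiskerLeft_fst]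

/-- The natural morphism `X ⟶ X × U` given by a section `x` of `U` over `S`. -/
def corSection {U : Sm S} (x : 𝟙_ (Sm S) ⟶ U) : 𝟭 (Cor R) ⟶ corTensor R U :=
  (corTensorUnit R).inv ≫ corTensorMap R x

theorem corSection_app {U : Sm S} (x : 𝟙_ (Sm S) ⟶ U) (X : Cor R) :
    (corSection R x).app X = (graphFunctor R).map (lift (𝟙 X.toSm) (toUnit X.toSm ≫ x)) := by
  change (graphFunctor R).map (ρ_ X.toSm).inv ≫ (graphFunctor R).map (X.toSm ◁ x) = _
  rw [← Functor.map_comp]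
  congr 1
  ext1 <;> simp

/-- `F ↦ F(- × U)` is contravariant in `U`. -/
def ihomMap {U V : Sm S} (g : U ⟶ V) : ihom R V ⟶ ihom R U where
  app F := ObjectProperty.homMk (Functor.whiskerRight (NatTrans.op (corTensorMap R g)) F.obj)
  naturality F G φ := by
    ext : 1
    exact Functor.whiskerLeft_comp_whiskerRight (NatTrans.op (corTensorMap R g)) φ.hom

theorem ihomMap_id (U : Sm S) : ihomMap R (𝟙 U) = 𝟙 _ := by
  ext F : 3
  change Functor.whiskerRight (NatTrans.op (corTensorMap R (𝟙 U))) F.obj = 𝟙 _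
  rw [corTensorMap_id, NatTrans.op_id]
  exact Functor.whiskerRight_id' _

theorem ihomMap_comp {U V W : Sm S} (f : U ⟶ V) (g : V ⟶ W) :
    ihomMap R (f ≫ g) = ihomMap R g ≫ ihomMap R f := by
  ext F : 3
  change Functor.whiskerRight (NatTrans.op (corTensorMap R (f ≫ g))) F.obj = _
  rw [corTensorMap_comp, NatTrans.op_comp]
  exact Functor.whiskerRight_comp _ _ _

/-- The natural transformation `F ⟶ F(- × U)` induced by the projections. -/
def ihomProj (U : Sm S) : 𝟭 (Pre R) ⟶ ihom R U where
  app F := ObjectProperty.homMk (Functor.whiskerRight (NatTrans.op (corProj R U)) F.obj)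
  naturality F G φ := by
    ext : 1
    exact Functor.whiskerLeft_comp_whiskerRight (NatTrans.op (corProj R U)) φ.hom

/-- The natural transformation `F(- × U) ⟶ F` induced by a section of `U` over `S`. -/
def ihomSection {U : Sm S} (x : 𝟙_ (Sm S) ⟶ U) : ihom R U ⟶ 𝟭 (Pre R) where
  app F := ObjectProperty.homMk (Functor.whiskerRight (NatTrans.op (corSection R x)) F.obj)
  naturality F G φ := by
    ext : 1
    exact Functor.whiskerLeft_comp_whiskerRight (NatTrans.op (corSection R x)) φ.hom

/-- The representable presheaves `ℤ_tr(X) = Cor(-, X)`. -/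
def Ztr : Cor R ⥤ Pre R :=
  (isPre R).lift preadditiveYoneda (fun X => inferInstanceAs (preadditiveYoneda.obj X).Additive)

/-- The presheaf `ℤ_tr(𝔸¹ × X) / ℤ_tr(X)`, where `X` is embedded by the zero section. -/
def contrGen (X : Sm S) : Pre R :=
  cokernel ((Ztr R).map ((corSection R (affineLinePoint S 0)).app ⟨X⟩))

/-- Homotopy invariant presheaves: the projections induce isomorphisms `F(X) ≅ F(X × 𝔸¹)`. -/
def IsHomotopyInvariant : ObjectProperty (Pre R) := fun F =>
  ∀ X : Sm S, IsIso (F.obj.map ((graphFunctor R).map (fst X (affineLine S))).op)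

/-- `𝔸¹`-contractible presheaves: there is `h : F ⟶ F(- × 𝔸¹)` with `s₀ ∘ h = 𝟙` and
`s₁ ∘ h = 0`. -/
def IsContractiblePresheaf : ObjectProperty (Pre R) := fun F =>
  ∃ h : F ⟶ (ihom R (affineLine S)).obj F,
    h ≫ (ihomSection R (affineLinePoint S 0)).app F = 𝟙 F ∧
      h ≫ (ihomSection R (affineLinePoint S 1)).app F = 0

/-! ## The Suslin complex -/

/-- The simplicial complex `n ↦ K(Δ^n × -)` attached to a complex `K` of presheaves. -/
def singObj (K : CochainComplex (Pre R) ℤ) : SimplicialObject (CochainComplex (Pre R) ℤ) where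
  obj n := ((ihom R ((simplex S).obj n.unop)).mapHomologicalComplex _).obj K
  map θ := (NatTrans.mapHomologicalComplex (ihomMap R ((simplex S).map θ.unop)) _).app K
  map_id n := by
    rw [unop_id, CategoryTheory.Functor.map_id, ihomMap_id, NatTrans.mapHomologicalComplex_id]
    rfl
  map_comp θ η := by
    rw [unop_comp, Functor.map_comp, ihomMap_comp, NatTrans.mapHomologicalComplex_comp]
    rfl

/-- The functor `K ↦ (n ↦ K(Δ^n × -))`. -/
def sing : CochainComplex (Pre R) ℤ ⥤ SimplicialObject (CochainComplex (Pre R) ℤ) where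
  obj K := singObj R K
  map φ :=
    { app n := ((ihom R ((simplex S).obj n.unop)).mapHomologicalComplex _).map φ
      naturality _ _ θ :=
        ((NatTrans.mapHomologicalComplex
          (ihomMap R ((simplex S).map θ.unop)) _).naturality φ).symm }

/-- The bicomplex with terms `K^j(Δ^i × -)` in bidegree `(-i, j)`; its first differential is the
alternating sum of the face maps. -/
def suslinBicomplex : CochainComplex (Pre R) ℤ ⥤
    HomologicalComplex₂ (Pre R) (ComplexShape.up ℤ) (ComplexShape.up ℤ) :=
  sing R ⋙ AlgebraicTopology.alternatingFaceMapComplex _ ⋙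
    ComplexShape.embeddingDownNat.extendFunctor _

/-- The Suslin complex `C^*(K) = Hom(Δ^•, K)`: the total complex of the bicomplex
`K^j(Δ^i × -)`. -/
def suslin : CochainComplex (Pre R) ℤ ⥤ CochainComplex (Pre R) ℤ :=
  suslinBicomplex R ⋙ HomologicalComplex₂.totalFunctor (Pre R)
    (ComplexShape.up ℤ) (ComplexShape.up ℤ) (ComplexShape.up ℤ)

end

/-! ## Subcategories of triangulated categories -/

section

variable {T : Type*} [Category T] [HasZeroObject T] [HasShift T ℤ] [Preadditive T]
  [∀ n : ℤ, (shiftFunctor T n).Additive] [Pretriangulated T]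

/-- Thick subcategories: full triangulated subcategories closed under retracts. -/
structure IsThick (P : ObjectProperty T) : Prop where
  isTriangulated : P.IsTriangulated
  isStableUnderRetracts : P.IsStableUnderRetracts

/-- Thick subcategories closed under all direct sums (indexed by `v`-small sets) which exist in
the ambient category. -/
structure IsThickWithSums (P : ObjectProperty T) : Prop extends IsThick P where
  sums : ∀ J : Type v, P.IsClosedUnderColimitsOfShape (Discrete J)

/-- Thick subcategories closed under all products (indexed by `v`-small sets) which exist in
the ambient category. -/
structure IsThickWithProducts (P : ObjectProperty T) : Prop extends IsThick P where
  products : ∀ J : Type v, P.IsClosedUnderLimitsOfShape (Discrete J)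

/-- The smallest thick subcategory closed under direct sums which contains `P`. -/
def thickSumClosure (P : ObjectProperty T) : ObjectProperty T := fun X =>
  ∀ Q : ObjectProperty T, IsThickWithSums.{v} Q → P ≤ Q → Q X

/-- The smallest thick subcategory closed under products which contains `P`. -/
def thickProductClosure (P : ObjectProperty T) : ObjectProperty T := fun X =>
  ∀ Q : ObjectProperty T, IsThickWithProducts.{v} Q → P ≤ Q → Q X

/-- The semi-orthogonal decomposition `T = ⟨A, B⟩`: `A` and `B` are thick subcategories, there are
no nonzero morphisms from `B` to `A`, and each object `X` of `T` sits in a distinguished triangle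
`b ⟶ X ⟶ a ⟶ b⟦1⟧` with `b` in `B` and `a` in `A`. -/
structure IsSemiorthogonalDecomposition (A B : ObjectProperty T) : Prop where
  thick_left : IsThick A
  thick_right : IsThick B
  hom_eq_zero : ∀ {b a : T} (f : b ⟶ a), B b → A a → f = 0
  exists_triangle : ∀ X : T, ∃ (b a : T) (f : b ⟶ X) (g : X ⟶ a) (h : a ⟶ b⟦(1 : ℤ)⟧),
    B b ∧ A a ∧ Pretriangulated.Triangle.mk f g h ∈ distTriang T

end

/-! ## `𝔸¹`-invariant and `𝔸¹`-contractible objects of `D⁻(Pre(Cor))` -/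

noncomputable section

variable {S : Scheme.{u}} (R : Ringoid S) [HasDerivedCategory.{w} (Pre R)]

/-- The endofunctor `Hom(𝔸¹, -)` of the derived category, induced by the exact functor
`F ↦ F(- × 𝔸¹)`. -/
abbrev derivedIhom : DerivedCategory (Pre R) ⥤ DerivedCategory (Pre R) :=
  (ihom R (affineLine S)).mapDerivedCategory

/-- The transformation `p : Id ⟶ Hom(𝔸¹, -)` on the derived category. -/
def derivedProj : 𝟭 (DerivedCategory (Pre R)) ⟶ derivedIhom R :=
  Localization.liftNatTrans DerivedCategory.Q
    (HomologicalComplex.quasiIso (Pre R) (ComplexShape.up ℤ))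
    DerivedCategory.Q ((ihom R (affineLine S)).mapHomologicalComplex _ ⋙ DerivedCategory.Q) _ _
    (Functor.whiskerRight ((Functor.mapHomologicalComplexIdIso _ _).inv ≫
      NatTrans.mapHomologicalComplex (ihomProj R (affineLine S)) (ComplexShape.up ℤ))
      DerivedCategory.Q)

/-- The transformation `s_a : Hom(𝔸¹, -) ⟶ Id` on the derived category, for a point `a` of
`𝔸¹`. -/
def derivedSection (a : Γ(S, ⊤)) : derivedIhom R ⟶ 𝟭 (DerivedCategory (Pre R)) :=
  Localization.liftNatTrans DerivedCategory.Q
    (HomologicalComplex.quasiIso (Pre R) (ComplexShape.up ℤ))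
    ((ihom R (affineLine S)).mapHomologicalComplex _ ⋙ DerivedCategory.Q) DerivedCategory.Q _ _
    (Functor.whiskerRight
      (NatTrans.mapHomologicalComplex (ihomSection R (affineLinePoint S a)) (ComplexShape.up ℤ) ≫
        (Functor.mapHomologicalComplexIdIso _ _).hom)
      DerivedCategory.Q)

/-- `D⁻_{𝔸¹-inv}`: the `𝔸¹`-invariant objects of `D⁻(Pre(Cor))`. -/
def a1Inv : ObjectProperty (DerivedCategory.Minus (Pre R)) := fun A =>
  IsIso ((derivedProj R).app A.obj)

/-- The `𝔸¹`-contractible objects of `D⁻(Pre(Cor))`. -/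
def IsContractibleObject : ObjectProperty (DerivedCategory.Minus (Pre R)) := fun A =>
  ∃ h : A.obj ⟶ (derivedIhom R).obj A.obj,
    h ≫ (derivedSection R 0).app A.obj = 𝟙 A.obj ∧ h ≫ (derivedSection R 1).app A.obj = 0

/-- `D⁻_{𝔸¹-contr}`: the thick subcategory (with direct sums) of `D⁻(Pre(Cor))` generated by the
`𝔸¹`-contractible objects. -/
def a1Contr : ObjectProperty (DerivedCategory.Minus (Pre R)) :=
  thickSumClosure.{u} (IsContractibleObject R)

/-- The objects of `D⁻(Pre(Cor))` isomorphic to a presheaf with property `P` in degree zero. -/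
def presheavesIn (P : ObjectProperty (Pre R)) :
    ObjectProperty (DerivedCategory.Minus (Pre R)) := fun A =>
  ∃ F : Pre R, P F ∧ Nonempty (A.obj ≅ (DerivedCategory.singleFunctor (Pre R) 0).obj F)

/-- Bounded above complexes of presheaves. -/
def boundedAbove : ObjectProperty (CochainComplex (Pre R) ℤ) := fun K =>
  ∃ n : ℤ, K.IsStrictlyLE n

/-- The functor from bounded above complexes of presheaves to `D⁻(Pre(Cor))`. -/
def Qminus : (boundedAbove R).FullSubcategory ⥤ DerivedCategory.Minus (Pre R) :=
  ObjectProperty.lift _ ((boundedAbove R).ι ⋙ DerivedCategory.Q) (fun K => by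
    obtain ⟨n, hn⟩ := K.property
    exact ⟨n, (inferInstance : (DerivedCategory.Q.obj K.obj).IsLE n)⟩)

end

end A1Motives

/-! Invariance. A presheaf `F` is homotopy invariant as soon as the restrictions `s₀, s₁ : F(- × 𝔸¹)
⟶ F` agree: pull this equality back along the multiplication of `𝔸¹`
(`isHomotopyInvariant_of_section_eq`). Equality of two natural maps passes to subobjects, quotients,
sums and products, and the five lemma handles extensions, so homotopy invariant presheaves form a
Serre class. As `F ↦ F(- × 𝔸¹)` is exact, an object of `D⁻` is invariant exactly when its cohomology
presheaves are (`a1Inv_iff`). Sums and products in `D⁻` are computed termwise, since they are exact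
in `Pre` and a family with a sum or product in `D⁻` is uniformly bounded above; the closure
properties of the invariant part follow.

Orthogonality. On an invariant object `s₀` and `s₁` are both inverse to `p`, hence equal. If `h`
contracts `B` and `f : B ⟶ A` has invariant target, naturality gives `f = s₀ ∘ Hom(𝔸¹, f) ∘ h = s₁ ∘
Hom(𝔸¹, f) ∘ h = 0`. The left orthogonal of the invariant part is thick and closed under sums, so it
contains all of `a1Contr`.

Decomposition. The prism decomposition of `𝔸¹ × Δⁿ` makes `s₀` and `s₁` homotopic on the Suslin
complex, whose cohomology is therefore homotopy invariant (`isHomotopyInvariant_homology_suslin`). A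
complex `K` is quasi-isomorphic to the total complex of the constant simplicial object on `K`, which
embeds in the Suslin complex by the projections. The linear contraction of each simplex to a vertex
fixes this constant part and hence contracts every term of the quotient
(`isContractiblePresheaf_suslinQuotient`). A bounded above complex with contractible terms is built
from its terms by extensions and a telescope, so it lies in `a1Contr`
(`a1Contr_of_contractible_terms`). The resulting triangle (`exists_suslin_triangle`) gives the
decomposition, the left adjoint and, because the Suslin complex of an object of `a1Contr` vanishes,
the description of `a1Contr` by complexes with contractible terms.

Generation. Both generation statements peel off the top cohomology repeatedly and recover the object
by a telescope (the two `of_filtration` theorems). On the invariant side one removes the top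
cohomology presheaf by truncation and the object is a homotopy limit. On the contractible side the
top cohomology has no nonzero homotopy invariant quotient, so `s₀ - s₁` is surjective on it and it
is covered by presheaves `contrGen R X`; these are projective, so the cover lifts to the derived
category, and the object is a homotopy colimit. The sum used here must be small, which is why
isomorphism classes of smooth schemes are shown to form a small set. -/

namespace CochainComplex

/-! ### Termwise sums and products of complexes -/

noncomputable section

variable {C : Type*} [Category* C] [Abelian C] {J : Type*} (K L : J → CochainComplex C ℤ)

/-- A family of complexes, as a complex of families. -/
@[simps]
def family : CochainComplex (Discrete J ⥤ C) ℤ where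
  X n := Discrete.functor fun j => (K j).X n
  d m n := Discrete.natTrans fun j => (K j.as).d m n
  shape _ _ h := by ext j; exact (K j.as).shape _ _ h
  d_comp_d' _ _ _ _ _ := by ext j; exact (K j.as).d_comp_d _ _ _

variable {K L} in
/-- A family of morphisms of complexes, as a morphism of complexes of families. -/
@[simps]
def familyMap (φ : ∀ j, K j ⟶ L j) : family K ⟶ family L where
  f n := Discrete.natTrans fun j => (φ j.as).f n
  comm' _ _ _ := by ext j; exact (φ j.as).comm _ _

theorem quasiIso_familyMap (φ : ∀ j, K j ⟶ L j) [∀ j, QuasiIso (φ j)] : QuasiIso (familyMap φ) := by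
  rw [HomologicalComplex.quasiIso_iff_evaluation]
  rintro ⟨j⟩
  exact inferInstanceAs (QuasiIso (φ j))

section coproduct

variable [HasColimitsOfShape (Discrete J) C]

/-- The termwise coproduct of a family of complexes. -/
@[simps]
def sum : CochainComplex C ℤ where
  X n := ∐ fun j => (K j).X n
  d m n := Limits.Sigma.map fun j => (K j).d m n
  shape m n h := Sigma.hom_ext _ _ fun j => by simp [(K j).shape _ _ h]
  d_comp_d' m n p _ _ := Sigma.hom_ext _ _ fun j => by simp

/-- The inclusion in the termwise coproduct. -/
@[simps]
def sumι (j : J) : K j ⟶ sum K where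
  f n := Sigma.ι (fun j => (K j).X n) j
  comm' m n _ := Sigma.ι_map (fun j => (K j).d m n) j

variable {K} in
/-- The morphism from the termwise coproduct induced by a family of morphisms. -/
@[simps]
def sumDesc {M : CochainComplex C ℤ} (φ : ∀ j, K j ⟶ M) : sum K ⟶ M where
  f n := Limits.Sigma.desc fun j => (φ j).f n
  comm' m n _ :=
    show Limits.Sigma.desc (fun j => (φ j).f m) ≫ M.d m n =
      (Limits.Sigma.map fun j => (K j).d m n) ≫ Limits.Sigma.desc fun j => (φ j).f n from
    Sigma.hom_ext _ _ fun j => by simp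

variable {K} in
@[simp]
theorem sumι_desc {M : CochainComplex C ℤ} (φ : ∀ j, K j ⟶ M) (j : J) :
    sumι K j ≫ sumDesc φ = φ j := by
  ext n
  exact Sigma.ι_desc (fun j => (φ j).f n) j

variable {K} in
@[simp]
theorem sumι_desc_assoc {M N : CochainComplex C ℤ} (φ : ∀ j, K j ⟶ M) (j : J) (f : M ⟶ N) :
    sumι K j ≫ sumDesc φ ≫ f = φ j ≫ f := by
  rw [← Category.assoc, sumι_desc]

variable {K} in
theorem sum_hom_ext {M : CochainComplex C ℤ} {f g : sum K ⟶ M}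
    (h : ∀ j, sumι K j ≫ f = sumι K j ≫ g) : f = g := by
  ext n
  exact Sigma.hom_ext _ _ fun j => HomologicalComplex.congr_hom (h j) n

theorem sum_isStrictlyLE (n : ℤ) [∀ j, (K j).IsStrictlyLE n] : (sum K).IsStrictlyLE n := by
  rw [isStrictlyLE_iff]
  intro i hi
  rw [IsZero.iff_id_eq_zero]
  exact Sigma.hom_ext _ _ fun j => ((K j).isZero_of_isStrictlyLE n i hi).eq_of_src _ _

/-- A homotopy on a termwise coproduct is given by a family of homotopies. -/
theorem homotopy_sum_zero {M : CochainComplex C ℤ} {f : sum K ⟶ M}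
    (h : ∀ j, Nonempty (Homotopy (sumι K j ≫ f) 0)) : Nonempty (Homotopy f 0) := by
  have h' (j) : Homotopy (sumι K j ≫ f) 0 := (h j).some
  refine ⟨{ hom m n := Limits.Sigma.desc fun j => (h' j).hom m n, zero m n hmn := ?_,
            comm n := ?_ }⟩
  · exact Sigma.hom_ext _ _ fun j =>
      ((Sigma.ι_desc (fun j => (h' j).hom m n) j).trans ((h' j).zero m n hmn)).trans comp_zero.symm
  · have hd := dNext_eq (C := sum K) (D := M)
      (fun m n => Limits.Sigma.desc fun j => (h' j).hom m n) (i := n) (i' := n + 1) rfl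
    have hp := prevD_eq (C := sum K) (D := M)
      (fun m n => Limits.Sigma.desc fun j => (h' j).hom m n) (j := n) (j' := n - 1) (by simp)
    rw [hd, hp]
    refine Sigma.hom_ext _ _ fun j => ?_
    have := (h' j).comm n
    rw [dNext_eq _ (i := n) (i' := n + 1) rfl, prevD_eq _ (j := n) (j' := n - 1) (by simp)] at this
    refine this.trans ((add_zero _).trans (Eq.trans ?_ (congrArg _ (add_zero _).symm)))
    exact ((Preadditive.comp_add _ _ _ _ _ _).trans (congrArg₂ (· + ·)
      ((Sigma.ι_map_assoc (fun j => (K j).d n (n + 1)) j _).trans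
        (_ ≫= Sigma.ι_desc (fun j => (h' j).hom (n + 1) n) j))
      (Sigma.ι_desc_assoc (fun j => (h' j).hom n (n - 1)) j _))).symm

/-- The termwise coproduct, as the image of a complex of families by the colimit functor. -/
def sumIso : sum K ≅ ((colim (J := Discrete J) (C := C)).mapHomologicalComplex _).obj (family K) :=
  HomologicalComplex.Hom.isoOfComponents (fun n => Iso.refl (∐ fun j => (K j).X n)) fun m n _ => by
    refine (Category.id_comp _).trans (Eq.trans ?_ (Category.comp_id _).symm)
    exact Sigma.hom_ext _ _ fun j => (ι_colimMap ((family K).d m n) ⟨j⟩).trans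
      (ι_colimMap _ _).symm

-- Exactness of coproducts makes `colim` an exact functor on families, so it preserves the termwise
-- quasi-isomorphism of complexes of families.
variable {K L} in
theorem quasiIso_sumDesc [HasExactColimitsOfShape (Discrete J) C] (φ : ∀ j, K j ⟶ L j)
    [∀ j, QuasiIso (φ j)] : QuasiIso (sumDesc fun j => φ j ≫ sumι L j) := by
  have h : (sumDesc fun j => φ j ≫ sumι L j) = (sumIso K).hom ≫
      ((colim (J := Discrete J) (C := C)).mapHomologicalComplex _).map (familyMap φ) ≫
        (sumIso L).inv :=
    sum_hom_ext fun j => by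
      rw [sumι_desc]
      ext n
      refine Eq.symm (Eq.trans ?_ (ι_colimMap ((familyMap φ).f n) ⟨j⟩))
      exact _ ≫= ((Category.id_comp _).trans (Category.comp_id _))
  have := quasiIso_familyMap K L φ
  rw [h]
  infer_instance

/-- The homology of a coproduct of complexes is generated by the homology of the summands. -/
theorem homology_sum_hom_ext [HasExactColimitsOfShape (Discrete J) C] (n : ℤ) {M : C}
    {f g : (sum K).homology n ⟶ M}
    (h : ∀ j, HomologicalComplex.homologyMap (sumι K j) n ≫ f =
      HomologicalComplex.homologyMap (sumι K j) n ≫ g) : f = g := by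
  let Φ := colim (J := Discrete J) (C := C)
  let e := (HomologicalComplex.homologyMapIso (sumIso K) n)
  let e' : HomologicalComplex.homology ((Φ.mapHomologicalComplex _).obj (family K)) n ≅
    Φ.obj ((family K).homology n) := ((family K).sc n).mapHomologyIso Φ
  rw [← cancel_epi e.inv, ← cancel_epi e'.inv]
  refine colimit.hom_ext fun ⟨j⟩ => ?_
  -- The inclusion of a summand is a natural transformation between exact functors on families;
  -- naturality of the homology comparison identifies its effect on homology with the inclusion into
  -- the coproduct of homologies.
  let τ : (evaluation (Discrete J) C).obj ⟨j⟩ ⟶ Φ :=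
    { app X := colimit.ι X ⟨j⟩
      naturality _ _ f := (ι_colimMap f ⟨j⟩).symm }
  have h1 := NatTrans.app_homology τ ((family K).sc n)
  let ej : ((family K).homology n).obj ⟨j⟩ ≅ (K j).homology n :=
    (((family K).sc n).mapHomologyIso ((evaluation (Discrete J) C).obj ⟨j⟩)).symm
  let ι' : K j ⟶ (Φ.mapHomologicalComplex _).obj (family K) :=
    (NatTrans.mapHomologicalComplex τ (.up ℤ)).app (family K)
  have h0 : ι' ≫ (sumIso K).inv = sumι K j := by
    ext n
    exact Category.comp_id _
  have h2 : colimit.ι ((family K).homology n) ⟨j⟩ ≫ e'.inv =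
      ej.hom ≫ HomologicalComplex.homologyMap ι' n := by
    rw [Iso.comp_inv_eq, Category.assoc]
    exact h1
  have h3 : HomologicalComplex.homologyMap ι' n ≫ e.inv =
      HomologicalComplex.homologyMap (sumι K j) n := by
    rw [← h0, HomologicalComplex.homologyMap_comp]
    rfl
  rw [reassoc_of% h2, reassoc_of% h2, reassoc_of% h3, reassoc_of% h3, h j]

end coproduct

section product

variable [HasLimitsOfShape (Discrete J) C]

/-- The termwise product of a family of complexes. -/
@[simps]
def prod : CochainComplex C ℤ where
  X n := ∏ᶜ fun j => (K j).X n
  d m n := Limits.Pi.map fun j => (K j).d m n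
  shape m n h := Pi.hom_ext _ _ fun j => by simp [(K j).shape _ _ h]
  d_comp_d' m n p _ _ := Pi.hom_ext _ _ fun j => by simp

/-- The projection from the termwise product. -/
@[simps]
def prodπ (j : J) : prod K ⟶ K j where
  f n := Pi.π (fun j => (K j).X n) j
  comm' m n _ := (Pi.map_π (fun j => (K j).d m n) j).symm

variable {K} in
/-- The morphism to the termwise product induced by a family of morphisms. -/
@[simps]
def prodLift {M : CochainComplex C ℤ} (φ : ∀ j, M ⟶ K j) : M ⟶ prod K where
  f n := Pi.lift fun j => (φ j).f n
  comm' m n _ :=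
    show Pi.lift (fun j => (φ j).f m) ≫ (Limits.Pi.map fun j => (K j).d m n) =
      M.d m n ≫ Pi.lift fun j => (φ j).f n from
    Pi.hom_ext _ _ fun j => by simp

variable {K} in
@[simp]
theorem prodLift_π {M : CochainComplex C ℤ} (φ : ∀ j, M ⟶ K j) (j : J) :
    prodLift φ ≫ prodπ K j = φ j := by
  ext n
  exact Pi.lift_π (fun j => (φ j).f n) j

variable {K} in
theorem prod_hom_ext {M : CochainComplex C ℤ} {f g : M ⟶ prod K}
    (h : ∀ j, f ≫ prodπ K j = g ≫ prodπ K j) : f = g := by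
  ext n
  exact Pi.hom_ext _ _ fun j => HomologicalComplex.congr_hom (h j) n

theorem prod_isStrictlyLE (n : ℤ) [∀ j, (K j).IsStrictlyLE n] : (prod K).IsStrictlyLE n := by
  rw [isStrictlyLE_iff]
  intro i hi
  rw [IsZero.iff_id_eq_zero]
  exact Pi.hom_ext _ _ fun j => ((K j).isZero_of_isStrictlyLE n i hi).eq_of_tgt _ _

/-- A homotopy to a termwise product is given by a family of homotopies. -/
theorem homotopy_prod_zero {M : CochainComplex C ℤ} {f : M ⟶ prod K}
    (h : ∀ j, Nonempty (Homotopy (f ≫ prodπ K j) 0)) : Nonempty (Homotopy f 0) := by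
  have h' (j) : Homotopy (f ≫ prodπ K j) 0 := (h j).some
  refine ⟨{ hom m n := Pi.lift fun j => (h' j).hom m n, zero m n hmn := ?_, comm n := ?_ }⟩
  · exact Pi.hom_ext _ _ fun j =>
      ((Pi.lift_π (fun j => (h' j).hom m n) j).trans ((h' j).zero m n hmn)).trans zero_comp.symm
  · have hd := dNext_eq (C := M) (D := prod K)
      (fun m n => Pi.lift fun j => (h' j).hom m n) (i := n) (i' := n + 1) rfl
    have hp := prevD_eq (C := M) (D := prod K)
      (fun m n => Pi.lift fun j => (h' j).hom m n) (j := n) (j' := n - 1) (by simp)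
    rw [hd, hp]
    refine Pi.hom_ext _ _ fun j => ?_
    have := (h' j).comm n
    rw [dNext_eq _ (i := n) (i' := n + 1) rfl, prevD_eq _ (j := n) (j' := n - 1) (by simp)] at this
    refine this.trans ((add_zero _).trans (Eq.trans ?_ ((add_zero _).symm =≫ _)))
    exact ((Preadditive.add_comp _ _ _ _ _ _).trans (congrArg₂ (· + ·)
      ((Category.assoc _ _ _).trans (_ ≫= Pi.lift_π (fun j => (h' j).hom (n + 1) n) j))
      ((Category.assoc _ _ _).trans ((_ ≫= Pi.map_π (fun j => (K j).d (n - 1) n) j).trans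
        (Pi.lift_π_assoc (fun j => (h' j).hom n (n - 1)) j _))))).symm

/-- The termwise product, as the image of a complex of families by the limit functor. -/
def prodIso : prod K ≅ ((lim (J := Discrete J) (C := C)).mapHomologicalComplex _).obj (family K) :=
  HomologicalComplex.Hom.isoOfComponents (fun n => Iso.refl (∏ᶜ fun j => (K j).X n)) fun m n _ => by
    refine (Category.id_comp _).trans (Eq.trans ?_ (Category.comp_id _).symm)
    exact Pi.hom_ext _ _ fun j => (limMap_π ((family K).d m n) ⟨j⟩).trans
      (limMap_π _ _).symm

-- Dual argument: exactness of products makes `lim` exact on families.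
variable {K L} in
theorem quasiIso_prodLift [HasExactLimitsOfShape (Discrete J) C] (φ : ∀ j, K j ⟶ L j)
    [∀ j, QuasiIso (φ j)] : QuasiIso (prodLift fun j => prodπ K j ≫ φ j) := by
  have h : (prodLift fun j => prodπ K j ≫ φ j) = (prodIso K).hom ≫
      ((lim (J := Discrete J) (C := C)).mapHomologicalComplex _).map (familyMap φ) ≫
        (prodIso L).inv :=
    prod_hom_ext fun j => by
      rw [prodLift_π]
      ext n
      refine Eq.symm (Eq.trans ?_ (limMap_π ((familyMap φ).f n) ⟨j⟩))
      exact ((Category.id_comp _).trans (Category.comp_id _)) =≫ _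
  have := quasiIso_familyMap K L φ
  have : (lim (J := Discrete J) (C := C)).Additive := Functor.additive_of_preserves_binary_products _
  rw [h]
  infer_instance

/-- The homology of a product of complexes is the product of the homologies. -/
def homologyProdIsLimit [HasExactLimitsOfShape (Discrete J) C] (n : ℤ) :
    IsLimit (Fan.mk _ fun j => HomologicalComplex.homologyMap (prodπ K j) n) := by
  let Φ := lim (J := Discrete J) (C := C)
  let e := (HomologicalComplex.homologyMapIso (prodIso K) n)
  let e' : HomologicalComplex.homology ((Φ.mapHomologicalComplex _).obj (family K)) n ≅
    Φ.obj ((family K).homology n) := ((family K).sc n).mapHomologyIso Φ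
  let ej (j : J) : (K j).homology n ≅ ((family K).homology n).obj ⟨j⟩ :=
    ((family K).sc n).mapHomologyIso ((evaluation (Discrete J) C).obj ⟨j⟩)
  have h2 (j : J) : e.hom ≫ e'.hom ≫ limit.π ((family K).homology n) ⟨j⟩ =
        HomologicalComplex.homologyMap (prodπ K j) n ≫ (ej j).hom := by
    let τ : Φ ⟶ (evaluation (Discrete J) C).obj ⟨j⟩ :=
      { app X := limit.π X ⟨j⟩
        naturality _ _ f := limMap_π f ⟨j⟩ }
    let π' : (Φ.mapHomologicalComplex _).obj (family K) ⟶ K j :=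
      (NatTrans.mapHomologicalComplex τ (.up ℤ)).app (family K)
    have h0 : (prodIso K).hom ≫ π' = prodπ K j := by
      ext n
      exact Category.id_comp _
    have h1 : e'.hom ≫ limit.π ((family K).homology n) ⟨j⟩ =
        HomologicalComplex.homologyMap π' n ≫ (ej j).hom := by
      rw [← Iso.eq_inv_comp]
      exact NatTrans.app_homology τ ((family K).sc n)
    rw [h1, ← h0, HomologicalComplex.homologyMap_comp, Category.assoc]
    rfl
  refine Fan.IsLimit.mk _
    (fun s => limit.lift _ ⟨s.pt, Discrete.natTrans fun j => s.proj j.as ≫ (ej j.as).hom⟩ ≫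
      e'.inv ≫ e.inv)
    (fun s j => ?_) (fun s m hm => ?_)
  · rw [← cancel_mono (ej j).hom]
    change (_ ≫ HomologicalComplex.homologyMap (prodπ K j) n) ≫ _ = _
    rw [Category.assoc, ← h2, Category.assoc, Category.assoc, e.inv_hom_id_assoc,
      e'.inv_hom_id_assoc]
    exact limit.lift_π _ _
  · rw [← Category.assoc, Iso.eq_comp_inv, Iso.eq_comp_inv]
    refine limit.hom_ext fun ⟨j⟩ => ?_
    rw [Category.assoc, Category.assoc, h2, limit.lift_π, ← Category.assoc]
    exact hm j =≫ _

end product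

end

end CochainComplex

/-! ### Sums and products in the derived category -/

namespace DerivedCategory

noncomputable section

variable {C : Type*} [Category* C] [Abelian C] [HasDerivedCategory.{w} C]

/-- The homology of `Q.obj K` is that of `K`. -/
def homologyQ (K : CochainComplex C ℤ) (n : ℤ) :
    (homologyFunctor C n).obj (Q.obj K) ≅ K.homology n :=
  (homologyFunctorFactors C n).app K

theorem homologyQ_inv_naturality {K L : CochainComplex C ℤ} (f : K ⟶ L) (n : ℤ) :
    HomologicalComplex.homologyMap f n ≫ (homologyQ L n).inv =
      (homologyQ K n).inv ≫ (homologyFunctor C n).map (Q.map f) :=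
  (homologyFunctorFactors C n).inv.naturality f

theorem homologyQ_hom_naturality {K L : CochainComplex C ℤ} (f : K ⟶ L) (n : ℤ) :
    (homologyFunctor C n).map (Q.map f) ≫ (homologyQ L n).hom =
      (homologyQ K n).hom ≫ HomologicalComplex.homologyMap f n :=
  (homologyFunctorFactors C n).hom.naturality f

/-- A morphism of complexes which vanishes in the derived category becomes null-homotopic after
composition with a quasi-isomorphism. -/
theorem exists_quasiIso_homotopy_comp_zero {K L : CochainComplex C ℤ} (f : K ⟶ L)
    (hf : Q.map f = 0) :
    ∃ (K' : CochainComplex C ℤ) (s : K' ⟶ K), QuasiIso s ∧ Nonempty (Homotopy (s ≫ f) 0) := by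
  have h : Qh.map ((HomotopyCategory.quotient _ _).map f) = Qh.map 0 := by
    rw [Functor.map_zero]
    exact (NatIso.naturality_1 (quotientCompQhIso C) f).symm.trans (by simp [hf]; rfl)
  obtain ⟨X, s, hs, eq⟩ :=
    (MorphismProperty.map_eq_iff_precomp Qh (HomotopyCategory.quasiIso C (.up ℤ)) _ _).1 h
  obtain ⟨K', rfl⟩ := HomotopyCategory.quotient_obj_surjective X
  obtain ⟨s, rfl⟩ := (HomotopyCategory.quotient _ _).map_surjective s
  refine ⟨K', s, (HomotopyCategory.quotient_map_mem_quasiIso_iff s).1 hs,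
    ⟨HomotopyCategory.homotopyOfEq _ _ ?_⟩⟩
  rw [Functor.map_comp, eq, comp_zero, Functor.map_zero]

theorem exists_quasiIso_homotopy_zero_comp {K L : CochainComplex C ℤ} (f : K ⟶ L)
    (hf : Q.map f = 0) :
    ∃ (L' : CochainComplex C ℤ) (s : L ⟶ L'), QuasiIso s ∧ Nonempty (Homotopy (f ≫ s) 0) := by
  have h : Qh.map ((HomotopyCategory.quotient _ _).map f) = Qh.map 0 := by
    rw [Functor.map_zero]
    exact (NatIso.naturality_1 (quotientCompQhIso C) f).symm.trans (by simp [hf]; rfl)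
  obtain ⟨X, s, hs, eq⟩ :=
    (MorphismProperty.map_eq_iff_postcomp Qh (HomotopyCategory.quasiIso C (.up ℤ)) _ _).1 h
  obtain ⟨K', rfl⟩ := HomotopyCategory.quotient_obj_surjective X
  obtain ⟨s, rfl⟩ := (HomotopyCategory.quotient _ _).map_surjective s
  refine ⟨K', s, (HomotopyCategory.quotient_map_mem_quasiIso_iff s).1 hs,
    ⟨HomotopyCategory.homotopyOfEq _ _ ?_⟩⟩
  rw [Functor.map_comp, eq, zero_comp, Functor.map_zero]

variable {J : Type*} (K : J → CochainComplex C ℤ)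

open CochainComplex

section coproduct

variable [HasColimitsOfShape (Discrete J) C] [HasExactColimitsOfShape (Discrete J) C]

/-- The termwise coproduct is the coproduct in the derived category. -/
def sumIsColimit : IsColimit (Cofan.mk (Q.obj (sum K)) fun j => Q.map (sumι K j)) := by
  have hsurj {Y : DerivedCategory C} (f : ∀ j, Q.obj (K j) ⟶ Y) :
      ∃ g : Q.obj (sum K) ⟶ Y, ∀ j, Q.map (sumι K j) ≫ g = f j := by
    let e := Q.objObjPreimageIso Y
    -- Each morphism is a fraction whose denominator is a quasi-isomorphism `K' j ⟶ K j`; the sum of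
    -- the denominators is again a quasi-isomorphism, so the fractions can be summed.
    choose K' s hs g hg using fun j => right_fac (f j ≫ e.inv)
    have (j : J) : QuasiIso (s j) := (isIso_Q_map_iff_quasiIso _ _).1 (hs j)
    have := quasiIso_sumDesc s
    have : IsIso (Q.map (sumDesc fun j => s j ≫ sumι K j)) := inferInstance
    refine ⟨inv (Q.map (sumDesc fun j => s j ≫ sumι K j)) ≫ Q.map (sumDesc g) ≫ e.hom, fun j => ?_⟩
    have h1 : Q.map (sumι K j) = inv (Q.map (s j)) ≫ Q.map (sumι K' j) ≫
        Q.map (sumDesc fun j => s j ≫ sumι K j) := by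
      rw [← Functor.map_comp, sumι_desc, Functor.map_comp, IsIso.inv_hom_id_assoc]
    rw [h1]
    simp only [Category.assoc, IsIso.hom_inv_id_assoc]
    rw [← Functor.map_comp_assoc, sumι_desc, reassoc_of% (hg j).symm]
    simp
  have hinj {Y : DerivedCategory C} (f : Q.obj (sum K) ⟶ Y)
      (hf : ∀ j, Q.map (sumι K j) ≫ f = 0) : f = 0 := by
    let e := Q.objObjPreimageIso Y
    obtain ⟨Y', g, s, hs, hg⟩ := left_fac (f ≫ e.inv)
    have h1 (j : J) : Q.map (sumι K j ≫ g) = 0 := by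
      rw [Functor.map_comp, ← cancel_mono (inv (Q.map s)), Category.assoc, ← hg, reassoc_of% hf j]
      simp
    -- A morphism that vanishes on every summand is null-homotopic on each after a refinement by a
    -- quasi-isomorphism; the refinements and the homotopies are then assembled on the termwise sum.
    choose K' t ht h using fun j => exists_quasiIso_homotopy_comp_zero _ (h1 j)
    have := quasiIso_sumDesc t
    have h2 : Q.map ((sumDesc fun j => t j ≫ sumι K j) ≫ g) = 0 := by
      obtain ⟨H⟩ := homotopy_sum_zero K' (f := (sumDesc fun j => t j ≫ sumι K j) ≫ g)
        (fun j => by rw [sumι_desc_assoc, Category.assoc]; exact h j)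
      rw [Q_map_eq_of_homotopy _ H, Functor.map_zero]
    have : IsIso (Q.map (sumDesc fun j => t j ≫ sumι K j)) := inferInstance
    rw [Functor.map_comp, Preadditive.IsIso.comp_left_eq_zero] at h2
    rw [← cancel_mono e.inv, hg, h2]
    simp
  refine Cofan.IsColimit.mk _ (fun s => (hsurj s.inj).choose) (fun s => (hsurj s.inj).choose_spec)
    (fun s m hm => ?_)
  rw [← sub_eq_zero]
  refine hinj _ fun j => ?_
  rw [Preadditive.comp_sub, (hsurj s.inj).choose_spec j, sub_eq_zero]
  exact hm j

end coproduct

section product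

variable [HasLimitsOfShape (Discrete J) C] [HasExactLimitsOfShape (Discrete J) C]

/-- The termwise product is the product in the derived category. -/
def prodIsLimit : IsLimit (Fan.mk (Q.obj (prod K)) fun j => Q.map (prodπ K j)) := by
  have hsurj {Y : DerivedCategory C} (f : ∀ j, Y ⟶ Q.obj (K j)) :
      ∃ g : Y ⟶ Q.obj (prod K), ∀ j, g ≫ Q.map (prodπ K j) = f j := by
    let e := Q.objObjPreimageIso Y
    choose K' g s hs hg using fun j => left_fac (e.hom ≫ f j)
    have (j : J) : QuasiIso (s j) := (isIso_Q_map_iff_quasiIso _ _).1 (hs j)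
    have := quasiIso_prodLift s
    have : IsIso (Q.map (prodLift fun j => prodπ K j ≫ s j)) := inferInstance
    refine ⟨e.inv ≫ Q.map (prodLift g) ≫ inv (Q.map (prodLift fun j => prodπ K j ≫ s j)),
      fun j => ?_⟩
    have h1 : Q.map (prodπ K j) = Q.map (prodLift fun j => prodπ K j ≫ s j) ≫
        Q.map (prodπ K' j) ≫ inv (Q.map (s j)) := by
      rw [← Functor.map_comp_assoc, prodLift_π, Functor.map_comp, Category.assoc,
        IsIso.hom_inv_id, Category.comp_id]
    rw [h1]
    simp only [Category.assoc, IsIso.inv_hom_id_assoc]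
    rw [← Functor.map_comp_assoc, prodLift_π, ← hg]
    simp
  have hinj {Y : DerivedCategory C} (f : Y ⟶ Q.obj (prod K))
      (hf : ∀ j, f ≫ Q.map (prodπ K j) = 0) : f = 0 := by
    let e := Q.objObjPreimageIso Y
    obtain ⟨Y', s, hs, g, hg⟩ := right_fac (e.hom ≫ f)
    have h1 (j : J) : Q.map (g ≫ prodπ K j) = 0 := by
      rw [Functor.map_comp, ← cancel_epi (inv (Q.map s)), ← Category.assoc, ← hg, Category.assoc,
        hf j]
      simp
    choose K' t ht h using fun j => exists_quasiIso_homotopy_zero_comp _ (h1 j)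
    have := quasiIso_prodLift t
    have h2 : Q.map (g ≫ prodLift fun j => prodπ K j ≫ t j) = 0 := by
      obtain ⟨H⟩ := homotopy_prod_zero K' (f := g ≫ prodLift fun j => prodπ K j ≫ t j)
        (fun j => by rw [Category.assoc, prodLift_π, ← Category.assoc]; exact h j)
      rw [Q_map_eq_of_homotopy _ H, Functor.map_zero]
    have : IsIso (Q.map (prodLift fun j => prodπ K j ≫ t j)) := inferInstance
    rw [Functor.map_comp, Preadditive.IsIso.comp_right_eq_zero] at h2
    rw [← cancel_epi e.hom, hg, h2]
    simp
  refine Fan.IsLimit.mk _ (fun s => (hsurj s.proj).choose) (fun s => (hsurj s.proj).choose_spec)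
    (fun s m hm => ?_)
  rw [← sub_eq_zero]
  refine hinj _ fun j => ?_
  rw [Preadditive.sub_comp, (hsurj s.proj).choose_spec j, sub_eq_zero]
  exact hm j

end product

end

end DerivedCategory

namespace A1Motives

noncomputable section

variable {S : Scheme.{u}}

/-! ### Global functions on smooth schemes and maps to the affine line -/

/-- The ring of global functions. -/
abbrev glob (X : Sm S) : CommRingCat.{u} := Γ(X.obj.left, ⊤)

/-- The pullback of global functions. -/
def globMap {X Y : Sm S} (f : X ⟶ Y) : glob Y →+* glob X :=
  f.hom.left.appTop.hom

@[simp]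
theorem globMap_id (X : Sm S) : globMap (𝟙 X) = RingHom.id _ :=
  congrArg CommRingCat.Hom.hom (Scheme.Hom.id_appTop (X := X.obj.left))

theorem globMap_comp {X Y Z : Sm S} (f : X ⟶ Y) (g : Y ⟶ Z) (a : glob Z) :
    globMap (f ≫ g) a = globMap f (globMap g a) :=
  congrArg (fun φ => CommRingCat.Hom.hom φ a) (Scheme.Hom.comp_appTop f.hom.left g.hom.left)

/-- The morphism to the affine line given by a function. -/
def toLine {X : Sm S} (a : glob X) : X ⟶ affineLine S :=
  ObjectProperty.homMk (Over.homMk (AffineSpace.homOfVector X.obj.hom fun _ => a)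
    (AffineSpace.homOfVector_over _ _))

/-- The coordinate of the affine line. -/
def lineCoord (S : Scheme.{u}) : glob (affineLine S) := AffineSpace.coord S PUnit.unit

@[simp]
theorem globMap_toLine {X : Sm S} (a : glob X) : globMap (toLine a) (lineCoord S) = a :=
  AffineSpace.homOfVector_appTop_coord X.obj.hom _ _

theorem toLine_ext {X : Sm S} {f g : X ⟶ affineLine S}
    (h : globMap f (lineCoord S) = globMap g (lineCoord S)) : f = g := by
  ext : 2
  exact AffineSpace.hom_ext ((Over.w f.hom).trans (Over.w g.hom).symm) fun _ => h

/-- The function on `X` defined by a function on the base. -/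
theorem globMap_point (a : Γ(S, ⊤)) :
    globMap (affineLinePoint S a) (lineCoord S) = (show Γ(S, ⊤) from a) :=
  AffineSpace.homOfVector_appTop_coord (𝟙 S) _ _

@[simp]
theorem globMap_point_zero : globMap (affineLinePoint S 0) (lineCoord S) = 0 :=
  globMap_point 0

@[simp]
theorem globMap_point_one : globMap (affineLinePoint S 1) (lineCoord S) = 1 :=
  globMap_point 1

/-- The multiplication of the affine line. -/
def lineMul (S : Scheme.{u}) : affineLine S ⊗ affineLine S ⟶ affineLine S :=
  toLine (globMap (fst _ _) (lineCoord S) * globMap (snd _ _) (lineCoord S))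

/-- The morphism `(t, s) ↦ t (1 - s)`. -/
def lineContract (S : Scheme.{u}) : affineLine S ⊗ affineLine S ⟶ affineLine S :=
  toLine (globMap (fst _ _) (lineCoord S) * (1 - globMap (snd _ _) (lineCoord S)))

theorem globMap_lineMul {X : Sm S} (f : X ⟶ affineLine S ⊗ affineLine S) :
    globMap (f ≫ lineMul S) (lineCoord S) =
      globMap (f ≫ fst _ _) (lineCoord S) * globMap (f ≫ snd _ _) (lineCoord S) := by
  rw [globMap_comp, globMap_comp, globMap_comp, lineMul, globMap_toLine, map_mul]

theorem globMap_lineContract {X : Sm S} (f : X ⟶ affineLine S ⊗ affineLine S) :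
    globMap (f ≫ lineContract S) (lineCoord S) =
      globMap (f ≫ fst _ _) (lineCoord S) * (1 - globMap (f ≫ snd _ _) (lineCoord S)) := by
  rw [globMap_comp, globMap_comp, globMap_comp, lineContract, globMap_toLine, map_mul, map_sub,
    map_one]

@[simp]
theorem globMap_comp_point_zero {X : Sm S} (f : X ⟶ 𝟙_ (Sm S)) :
    globMap (f ≫ affineLinePoint S 0) (lineCoord S) = 0 := by
  rw [globMap_comp, globMap_point_zero, map_zero]

@[simp]
theorem globMap_comp_point_one {X : Sm S} (f : X ⟶ 𝟙_ (Sm S)) :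
    globMap (f ≫ affineLinePoint S 1) (lineCoord S) = 1 := by
  rw [globMap_comp, globMap_point_one, map_one]

/-! ### Maps to the algebraic simplices -/

/-- The projection of the algebraic simplex to `Spec ℤ[x₀, …, xₙ] / (x₀ + ⋯ + xₙ - 1)`. -/
def simplexToSpec (S : Scheme.{u}) (n : SimplexCategory) :
    ((simplex S).obj n).obj.left ⟶ Spec (.of (simplexRing.{u} n.len)) :=
  pullback.snd (terminal.from S) (terminal.from (Spec (.of (simplexRing.{u} n.len))))

/-- The functions on the algebraic simplex defined over `ℤ`. -/
def simplexFun (S : Scheme.{u}) (n : SimplexCategory) :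
    simplexRing.{u} n.len →+* glob ((simplex S).obj n) :=
  (simplexToSpec S n).appTop.hom.comp (Scheme.ΓSpecIso (.of (simplexRing.{u} n.len))).inv.hom

theorem globMap_simplexFun {X : Sm S} {n : SimplexCategory} (f : X ⟶ (simplex S).obj n)
    (φ : CommRingCat.of (simplexRing.{u} n.len) ⟶ glob X)
    (h : f.hom.left ≫ simplexToSpec S n = X.obj.left.toSpecΓ ≫ Spec.map φ) (a : simplexRing n.len) :
    globMap f (simplexFun S n a) = φ.hom a := by
  have h2 := congrArg Scheme.Hom.appTop h
  rw [Scheme.Hom.comp_appTop, Scheme.Hom.comp_appTop, Scheme.toSpecΓ_appTop] at h2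
  have h3 : (Scheme.ΓSpecIso (.of (simplexRing.{u} n.len))).inv ≫ (Spec.map φ).appTop ≫
      (Scheme.ΓSpecIso _).hom = φ := by
    rw [Scheme.ΓSpecIso_naturality, Iso.inv_hom_id_assoc]
  exact congrArg (fun ψ => CommRingCat.Hom.hom ψ a) ((_ ≫= h2).trans h3)

/-- The barycentric coordinates on the algebraic simplex. -/
def vertexCoord {n : SimplexCategory} (i : Fin (n.len + 1)) : glob ((simplex S).obj n) :=
  simplexFun S n (simplexCoord i)

theorem sum_vertexCoord (n : SimplexCategory) : ∑ i, vertexCoord (S := S) (n := n) i = 1 := by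
  simp only [vertexCoord]
  rw [← map_sum, sum_simplexCoord, map_one]

/-- Rings are algebras over the universe lift of `ℤ`. -/
abbrev uliftIntAlgebra (A : Type u) [CommRing A] : Algebra (ULift.{u} ℤ) A :=
  ((Int.castRingHom A).comp ULift.ringEquiv.toRingHom).toAlgebra

/-- The morphism to the simplex with given barycentric coordinates. -/
def toSimplex {X : Sm S} {n : SimplexCategory} (v : Fin (n.len + 1) → glob X)
    (hv : ∑ i, v i = 1) : X ⟶ (simplex S).obj n :=
  letI := uliftIntAlgebra (glob X)
  ObjectProperty.homMk (Over.homMk (pullback.lift X.obj.hom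
    (X.obj.left.toSpecΓ ≫ Spec.map (CommRingCat.ofHom (simplexLift v hv).toRingHom))
    (Subsingleton.elim _ _)) (pullback.lift_fst _ _ _))

@[simp]
theorem globMap_toSimplex {X : Sm S} {n : SimplexCategory} (v : Fin (n.len + 1) → glob X)
    (hv : ∑ i, v i = 1) (i : Fin (n.len + 1)) : globMap (toSimplex v hv) (vertexCoord i) = v i := by
  let := uliftIntAlgebra (glob X)
  exact (globMap_simplexFun (toSimplex v hv) (CommRingCat.ofHom (simplexLift v hv).toRingHom)
    (pullback.lift_snd _ _ _) _).trans (simplexLift_coord v hv i)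

theorem uliftInt_hom_ext {A : Type u} [CommRing A] {n : ℕ} {f g : simplexRing.{u} n →+* A}
    (h : ∀ i, f (simplexCoord i) = g (simplexCoord i)) : f = g := by
  let := uliftIntAlgebra A
  -- Linearity over the lifted integers is automatic, since ring maps out of `ℤ` are unique.
  have hA (f : simplexRing.{u} n →+* A) (r : ULift.{u} ℤ) :
      f (algebraMap _ _ r) = algebraMap _ _ r := by
    have : (f.comp (algebraMap _ _)).comp (ULift.ringEquiv.symm : ℤ ≃+* ULift.{u} ℤ).toRingHom =
      (algebraMap _ A).comp (ULift.ringEquiv.symm : ℤ ≃+* ULift.{u} ℤ).toRingHom :=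
      RingHom.ext_int _ _
    exact RingHom.congr_fun this r.down
  have := simplexHom_ext (f := { f with commutes' := hA f }) (g := { g with commutes' := hA g }) h
  exact RingHom.ext fun x => AlgHom.congr_fun this x

theorem toSimplex_ext {X : Sm S} {n : SimplexCategory} {f g : X ⟶ (simplex S).obj n}
    (h : ∀ i, globMap f (vertexCoord i) = globMap g (vertexCoord i)) : f = g := by
  ext : 2
  refine pullback.hom_ext ((Over.w f.hom).trans (Over.w g.hom).symm) ?_
  change f.hom.left ≫ simplexToSpec S n = g.hom.left ≫ simplexToSpec S n
  refine ext_of_isAffine ?_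
  rw [← cancel_epi (Scheme.ΓSpecIso (.of (simplexRing.{u} n.len))).inv]
  ext1
  refine uliftInt_hom_ext fun i => ?_
  rw [Scheme.Hom.comp_appTop, Scheme.Hom.comp_appTop]
  exact h i

@[simp]
theorem globMap_simplex_map {m n : SimplexCategory} (θ : m ⟶ n) (j : Fin (n.len + 1)) :
    globMap ((simplex S).map θ) (vertexCoord j) =
      ∑ i with θ.toOrderHom i = j, vertexCoord i := by
  let φ : CommRingCat.of (simplexRing.{u} n.len) ⟶ .of (simplexRing.{u} m.len) :=
    CommRingCat.ofHom (simplexRingMap.{u} θ).toRingHom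
  have h : ((simplex S).map θ).hom.left ≫ simplexToSpec S n = simplexToSpec S m ≫ Spec.map φ :=
    specProdMap_snd S (simplexRingMap.{u} θ)
  have h2 := congrArg Scheme.Hom.appTop h
  rw [Scheme.Hom.comp_appTop, Scheme.Hom.comp_appTop] at h2
  have h4 := congrArg (fun ψ => CommRingCat.Hom.hom ψ (simplexCoord j)) ((_ ≫= h2).trans
    ((Scheme.ΓSpecIso_inv_naturality_assoc φ (simplexToSpec S m).appTop).symm))
  refine Eq.trans h4 ?_
  change simplexFun S m (simplexRingMap.{u} θ (simplexCoord j)) = _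
  rw [simplexRingMap, simplexLift_coord, map_sum]
  rfl

end

end A1Motives

namespace A1Motives

noncomputable section

variable {S : Scheme.{u}} (R : Ringoid S)

/-! ### Sections of presheaves -/

/-- The group of sections over `X`. -/
abbrev ev (X : Sm S) : Pre R ⥤ AddCommGrpCat.{u} :=
  (isPre R).ι ⋙ (evaluation _ _).obj (op ⟨X⟩)

instance (X : Sm S) : (ev R X).Additive where
  map_add := rfl

section

variable (J : Type*) [Category* J]

instance [HasLimitsOfShape J AddCommGrpCat.{u}] : PreservesLimitsOfShape J (isPre R).ι := by
  have : CreatesLimitsOfShape J (isPre R).ι :=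
    createsLimitsOfShapeFullSubcategoryInclusion J _
  infer_instance

instance [HasColimitsOfShape J AddCommGrpCat.{u}] : PreservesColimitsOfShape J (isPre R).ι := by
  have : CreatesColimitsOfShape J (isPre R).ι :=
    createsColimitsOfShapeFullSubcategoryInclusion J _
  infer_instance

instance [HasColimitsOfShape J AddCommGrpCat.{u}] (U : Sm S) :
    PreservesColimitsOfShape J (ihom R U) := by
  have : PreservesColimitsOfShape J (ihom R U ⋙ (isPre R).ι) :=
    inferInstanceAs (PreservesColimitsOfShape J
      ((isPre R).ι ⋙ (Functor.whiskeringLeft _ _ _).obj (corTensor R U).op))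
  exact preservesColimitsOfShape_of_reflects_of_preserves _ (isPre R).ι

end

instance (J : Type u) : HasExactColimitsOfShape (Discrete J) (Pre R) :=
  HasExactColimitsOfShape.domain_of_functor (Discrete J) (isPre R).ι

instance (J : Type u) : HasExactLimitsOfShape (Discrete J) (Pre R) :=
  HasExactLimitsOfShape.domain_of_functor (Discrete J) (isPre R).ι

variable {R} {F G : Pre R}

theorem isIso_of_sections (f : F ⟶ G) (h : ∀ X, IsIso ((ev R X).map f)) : IsIso f := by
  have (X : (Cor R)ᵒᵖ) : IsIso (f.hom.app X) := h X.unop.toSm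
  have : IsIso ((isPre R).ι.map f) := NatIso.isIso_of_isIso_app f.hom
  exact isIso_of_fully_faithful (isPre R).ι f

theorem epi_of_sections (f : F ⟶ G) (h : ∀ X, Function.Surjective ((ev R X).map f)) : Epi f := by
  have (X : (Cor R)ᵒᵖ) : Epi (f.hom.app X) := (AddCommGrpCat.epi_iff_surjective _).2 (h X.unop.toSm)
  have : Epi f.hom := NatTrans.epi_of_epi_app f.hom
  exact (isPre R).ι.epi_of_epi_map this

theorem sections_surjective (f : F ⟶ G) [Epi f] (X : Sm S) :
    Function.Surjective ((ev R X).map f) :=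
  (AddCommGrpCat.epi_iff_surjective _).1 inferInstance

theorem pre_hom_ext {f g : F ⟶ G} (h : ∀ X, (ev R X).map f = (ev R X).map g) : f = g := by
  ext X : 3
  exact h X.unop.toSm

/-! ### The action of morphisms of schemes -/

/-- The restriction of sections along a morphism of schemes. -/
def res (F : Pre R) {X Y : Sm S} (f : X ⟶ Y) : (ev R Y).obj F ⟶ (ev R X).obj F :=
  F.obj.map ((graphFunctor R).map (X := X) (Y := Y) f).op

@[simp]
theorem res_id (F : Pre R) (X : Sm S) : res F (𝟙 X) = 𝟙 _ :=
  F.obj.map_id (op ⟨X⟩)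

theorem res_comp (F : Pre R) {X Y Z : Sm S} (f : X ⟶ Y) (g : Y ⟶ Z) :
    res F (f ≫ g) = res F g ≫ res F f :=
  (congrArg (fun a => F.obj.map (Quiver.Hom.op a)) ((graphFunctor R).map_comp f g)).trans
    (F.obj.map_comp _ _)

theorem ev_map_ihomMap {U V : Sm S} (g : U ⟶ V) (F : Pre R) (X : Sm S) :
    (ev R X).map ((ihomMap R g).app F) = res F (X ◁ g) := rfl

theorem ev_map_ihomProj (U : Sm S) (F : Pre R) (X : Sm S) :
    (ev R X).map ((ihomProj R U).app F) = res F (fst X U) :=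
  congrArg (fun a => F.obj.map (Quiver.Hom.op a)) (corProj_app R U ⟨X⟩)

theorem ev_map_ihomSection {U : Sm S} (x : 𝟙_ (Sm S) ⟶ U) (F : Pre R) (X : Sm S) :
    (ev R X).map ((ihomSection R x).app F) = res F (lift (𝟙 X) (toUnit X ≫ x)) :=
  congrArg (fun a => F.obj.map (Quiver.Hom.op a)) (corSection_app R x ⟨X⟩)

theorem res_ihom (U : Sm S) (F : Pre R) {X Y : Sm S} (f : X ⟶ Y) :
    res ((ihom R U).obj F) f = res F (f ▷ U) :=
  congrArg (fun a => F.obj.map (Quiver.Hom.op a)) (R.tensor_graph f U)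

@[simp]
theorem ihomProj_section {U : Sm S} (x : 𝟙_ (Sm S) ⟶ U) (F : Pre R) :
    (ihomProj R U).app F ≫ (ihomSection R x).app F = 𝟙 F :=
  pre_hom_ext fun X => by
    rw [Functor.map_comp, ev_map_ihomProj, ev_map_ihomSection]
    refine (res_comp F _ _).symm.trans ?_
    rw [lift_fst]
    exact (res_id F X).trans ((ev R X).map_id F).symm

/-- The natural transformation of functors on `Cor` given by the associativity. -/
def corAssoc (U V : Sm S) : corTensor R U ⋙ corTensor R V ⟶ corTensor R (U ⊗ V) where
  app X := (graphFunctor R).map (α_ X.toSm U V).hom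
  naturality _ _ a := R.tensor_assoc a U V

variable (R) in
/-- The morphism `F(- × W) ⟶ F(- × U × V)` given by a morphism `U × V ⟶ W`. -/
def ihomAct {U V W : Sm S} (H : U ⊗ V ⟶ W) : ihom R W ⟶ ihom R V ⋙ ihom R U where
  app F := ObjectProperty.homMk
    (Functor.whiskerRight (NatTrans.op (corAssoc U V ≫ corTensorMap R H)) F.obj)
  naturality F G φ := by
    ext : 1
    exact Functor.whiskerLeft_comp_whiskerRight
      (NatTrans.op (corAssoc U V ≫ corTensorMap R H)) φ.hom

theorem ev_map_ihomAct {U V W : Sm S} (H : U ⊗ V ⟶ W) (F : Pre R) (X : Sm S) :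
    (ev R X).map ((ihomAct R H).app F) = res F ((α_ X U V).hom ≫ X ◁ H) :=
  congrArg (fun a => F.obj.map (Quiver.Hom.op a)) ((graphFunctor R).map_comp _ _).symm

/-- This is what lets a geometric homotopy `H` act on presheaves: evaluating at the point `x` of the
parameter space leaves the restriction along `H(x, -)`. -/
theorem ihomAct_section {U V W : Sm S} (H : U ⊗ V ⟶ W) (x : 𝟙_ (Sm S) ⟶ U) (F : Pre R) :
    (ihomAct R H).app F ≫ (ihomSection R x).app ((ihom R V).obj F) =
      (ihomMap R (lift (toUnit V ≫ x) (𝟙 V) ≫ H)).app F :=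
  pre_hom_ext fun X => by
    rw [Functor.map_comp, ev_map_ihomSection, ev_map_ihomMap, ev_map_ihomAct, res_ihom]
    refine (res_comp F _ _).symm.trans (congrArg (res F) ?_)
    have h : lift (𝟙 X) (toUnit X ≫ x) ▷ V ≫ (α_ X U V).hom ≫ snd X (U ⊗ V) =
        snd X V ≫ lift (toUnit V ≫ x) (𝟙 V) := by
      ext1 <;> simp
    ext1
    · simp
    · simp only [Category.assoc, whiskerLeft_snd]
      rw [reassoc_of% h]

/-! ### Homotopy invariant presheaves -/

theorem isHomotopyInvariant_iff : IsHomotopyInvariant R F ↔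
    IsIso ((ihomProj R (affineLine S)).app F) := by
  refine ⟨fun h => isIso_of_sections _ fun X => ?_, fun h X => ?_⟩
  · rw [ev_map_ihomProj]; exact h X
  · have : IsIso ((ev R X).map ((ihomProj R (affineLine S)).app F)) := inferInstance
    rw [ev_map_ihomProj] at this
    exact this

/-- A presheaf is homotopy invariant as soon as the restrictions along the sections `0` and `1`
coincide. -/
theorem isHomotopyInvariant_of_section_eq
    (h : (ihomSection R (affineLinePoint S 0)).app F = (ihomSection R (affineLinePoint S 1)).app F) :
    IsHomotopyInvariant R F := by
  rw [isHomotopyInvariant_iff]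
  refine ⟨(ihomSection R (affineLinePoint S 0)).app F, ihomProj_section _ _, ?_⟩
  refine pre_hom_ext fun X => ?_
  have h' := congrArg (ev R (X ⊗ affineLine S)).map h
  rw [ev_map_ihomSection, ev_map_ihomSection] at h'
  -- The hypothesis over `X × 𝔸¹`, pulled back along `(x, s, t) ↦ (x, s t)`. At `t = 0` this is the
  -- projection to `X` followed by the zero section, at `t = 1` the identity.
  have h2 := res F ((α_ X (affineLine S) (affineLine S)).hom ≫ X ◁ lineMul S) ≫= h'
  rw [← res_comp, ← res_comp] at h2
  rw [Functor.map_comp, ev_map_ihomProj, ev_map_ihomSection]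
  have hm (x : X ⊗ affineLine S ⟶ affineLine S) :
      lift (𝟙 _) x ≫ (α_ X (affineLine S) (affineLine S)).hom ≫ X ◁ lineMul S =
        lift (fst _ _) (lift (snd _ _) x ≫ lineMul S) := by
    have h : lift (𝟙 _) x ≫ (α_ X (affineLine S) (affineLine S)).hom ≫ snd _ _ =
        lift (snd _ _) x := by ext1 <;> simp
    ext1
    · simp
    · simp only [Category.assoc, whiskerLeft_snd, lift_snd]
      rw [reassoc_of% h]
  rw [hm, hm] at h2
  refine (res_comp F _ _).symm.trans (Eq.trans (congrArg (res F) ?_)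
    ((h2.trans (congrArg (res F) ?_)).trans (res_id F (X ⊗ affineLine S))))
  · ext1
    · simp
    · refine toLine_ext ?_
      rw [lift_snd, globMap_lineMul]
      simp
  · ext1
    · simp
    · refine toLine_ext ?_
      rw [lift_snd, globMap_lineMul]
      simp

theorem IsHomotopyInvariant.section_eq (h : IsHomotopyInvariant R F) (x y : 𝟙_ (Sm S) ⟶ affineLine S) :
    (ihomSection R x).app F = (ihomSection R y).app F := by
  have := isHomotopyInvariant_iff.1 h
  rw [← cancel_epi ((ihomProj R (affineLine S)).app F), ihomProj_section, ihomProj_section]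

/-- `F ↦ F(- × 𝔸¹)` preserves epimorphisms, so the equality `s₀ = s₁` can be tested after
precomposition with the image of `f`. -/
theorem IsHomotopyInvariant.of_epi (h : IsHomotopyInvariant R F) (f : F ⟶ G) [hf : Epi f] :
    IsHomotopyInvariant R G := by
  refine isHomotopyInvariant_of_section_eq ?_
  have : Epi ((ihom R (affineLine S)).map f) := inferInstance
  rw [← cancel_epi ((ihom R (affineLine S)).map f), NatTrans.naturality, NatTrans.naturality,
    h.section_eq]

/-- The quotient of a presheaf by the differences of the restrictions along `0` and `1` is
homotopy invariant. -/
theorem isHomotopyInvariant_cokernel (F : Pre R) :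
    IsHomotopyInvariant R (cokernel ((ihomSection R (affineLinePoint S 0)).app F -
      (ihomSection R (affineLinePoint S 1)).app F)) := by
  refine isHomotopyInvariant_of_section_eq ?_
  let f := (ihomSection R (affineLinePoint S 0)).app F - (ihomSection R (affineLinePoint S 1)).app F
  have : Epi ((ihom R (affineLine S)).map (cokernel.π f)) := inferInstance
  rw [← cancel_epi ((ihom R (affineLine S)).map (cokernel.π f)), NatTrans.naturality,
    NatTrans.naturality]
  have := cokernel.condition f
  rw [Preadditive.sub_comp, sub_eq_zero] at this
  exact this

instance : (IsHomotopyInvariant R).IsClosedUnderIsomorphisms where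
  of_iso e h := h.of_epi e.hom

end

end A1Motives

/-! ### The Serre class of homotopy invariant presheaves -/

namespace A1Motives

noncomputable section

variable {S : Scheme.{u}} {R : Ringoid S}

theorem ihom_map_section {U : Sm S} (x : 𝟙_ (Sm S) ⟶ U) {F G : Pre R} (f : F ⟶ G) :
    (ihom R U).map f ≫ (ihomSection R x).app G = (ihomSection R x).app F ≫ f :=
  (ihomSection R x).naturality f

/-- Subobjects and quotients inherit `s₀ = s₁`. That equality does not pass to extensions formally,
so for them the five lemma is applied to `p` instead. -/
instance : (IsHomotopyInvariant R).IsSerreClass where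
  exists_zero := ⟨_, isZero_zero _, isHomotopyInvariant_of_section_eq
    ((isZero_zero _).eq_of_tgt _ _)⟩
  prop_of_mono f _ h := isHomotopyInvariant_of_section_eq (by
    rw [← cancel_mono f, ← ihom_map_section, ← ihom_map_section, h.section_eq])
  prop_of_epi f _ h := h.of_epi f
  prop_X₂_of_shortExact {T} hT h₁ h₃ := by
    rw [isHomotopyInvariant_iff] at *
    exact ShortComplex.isIso₂_of_shortExact_of_isIso₁₃'
      (T.mapNatTrans (ihomProj R (affineLine S))) hT
      (hT.map_of_exact (ihom R (affineLine S))) h₁ h₃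

/-! ### Homotopy invariant complexes -/

variable (R) in
/-- The functor `K ↦ K(- × U)` on complexes. -/
abbrev ihomC (U : Sm S) : CochainComplex (Pre R) ℤ ⥤ CochainComplex (Pre R) ℤ :=
  (ihom R U).mapHomologicalComplex (.up ℤ)

/-- The morphism `K ⟶ K(- × U)` given by the projections. -/
@[simps]
def projC (U : Sm S) (K : CochainComplex (Pre R) ℤ) : K ⟶ (ihomC R U).obj K where
  f n := (ihomProj R U).app (K.X n)
  comm' m n _ := ((ihomProj R U).naturality (K.d m n)).symm

/-- The morphism `K(- × U) ⟶ K` given by a section of `U`. -/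
@[simps]
def sectionC {U : Sm S} (x : 𝟙_ (Sm S) ⟶ U) (K : CochainComplex (Pre R) ℤ) :
    (ihomC R U).obj K ⟶ K where
  f n := (ihomSection R x).app (K.X n)
  comm' m n _ := ((ihomSection R x).naturality (K.d m n)).symm

@[simp]
theorem projC_sectionC {U : Sm S} (x : 𝟙_ (Sm S) ⟶ U) (K : CochainComplex (Pre R) ℤ) :
    projC U K ≫ sectionC x K = 𝟙 K := by
  ext n : 1
  exact ihomProj_section x (K.X n)

theorem sectionC_naturality {U : Sm S} (x : 𝟙_ (Sm S) ⟶ U) {K L : CochainComplex (Pre R) ℤ}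
    (f : K ⟶ L) : (ihomC R U).map f ≫ sectionC x L = sectionC x K ≫ f := by
  ext n : 1
  exact ihom_map_section x (f.f n)

/-- The homology of `K(- × U)`. -/
def homologyIhomC (U : Sm S) (K : CochainComplex (Pre R) ℤ) (n : ℤ) :
    ((ihomC R U).obj K).homology n ≅ (ihom R U).obj (K.homology n) :=
  (K.sc n).mapHomologyIso (ihom R U)

/-- The homology of a complex, as the homology of its image by the identity functor. -/
def homologyIdC (K : CochainComplex (Pre R) ℤ) (n : ℤ) : K.homology n ≅ K.homology n :=
  (K.sc n).mapHomologyIso (𝟭 (Pre R))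

/-- Naturality of the comparison between homology and exact functors. The identity functor
contributes its own comparison `homologyIdC`; only its invertibility matters later. -/
theorem ihomProj_app_homology (U : Sm S) (K : CochainComplex (Pre R) ℤ) (n : ℤ) :
    (ihomProj R U).app (K.homology n) = (homologyIdC K n).inv ≫
      HomologicalComplex.homologyMap (projC U K) n ≫ (homologyIhomC U K n).hom :=
  NatTrans.app_homology (ihomProj R U) (K.sc n)

theorem ihomSection_app_homology {U : Sm S} (x : 𝟙_ (Sm S) ⟶ U) (K : CochainComplex (Pre R) ℤ)
    (n : ℤ) : (ihomSection R x).app (K.homology n) = (homologyIhomC U K n).inv ≫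
      HomologicalComplex.homologyMap (sectionC x K) n ≫ (homologyIdC K n).hom :=
  NatTrans.app_homology (ihomSection R x) (K.sc n)

theorem isHomotopyInvariant_homology_iff (K : CochainComplex (Pre R) ℤ) (n : ℤ) :
    IsHomotopyInvariant R (K.homology n) ↔
      IsIso (HomologicalComplex.homologyMap (projC (affineLine S) K) n) := by
  rw [isHomotopyInvariant_iff, ihomProj_app_homology, isIso_comp_left_iff, isIso_comp_right_iff]

theorem isHomotopyInvariant_homology_of_section_eq (K : CochainComplex (Pre R) ℤ) (n : ℤ)
    (h : HomologicalComplex.homologyMap (sectionC (affineLinePoint S 0) K) n =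
      HomologicalComplex.homologyMap (sectionC (affineLinePoint S 1) K) n) :
    IsHomotopyInvariant R (K.homology n) :=
  isHomotopyInvariant_of_section_eq (by
    rw [ihomSection_app_homology, ihomSection_app_homology, h])

variable (R) [HasDerivedCategory.{w} (Pre R)]

open DerivedCategory

/-- `Hom(𝔸¹, -)` on the derived category, in terms of complexes. -/
def derivedIhomQ (K : CochainComplex (Pre R) ℤ) :
    (derivedIhom R).obj (Q.obj K) ≅ Q.obj ((ihomC R (affineLine S)).obj K) :=
  (ihom R (affineLine S)).mapDerivedCategoryFactors.app K

theorem derivedProj_app_Q (K : CochainComplex (Pre R) ℤ) :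
    (derivedProj R).app (Q.obj K) =
      show Q.obj K ⟶ (derivedIhom R).obj (Q.obj K) from
        Q.map (projC (affineLine S) K) ≫ (derivedIhomQ R K).inv := by
  refine (Localization.liftNatTrans_app Q (HomologicalComplex.quasiIso (Pre R) (.up ℤ))
    Q (ihomC R (affineLine S) ⋙ Q) (𝟭 _) (derivedIhom R) _ K).trans ((Category.id_comp _).trans ?_)
  refine congrArg (· ≫ (derivedIhomQ R K).inv) (congrArg Q.map ?_)
  ext n : 1
  exact Category.id_comp _

theorem derivedSection_app_Q (a : Γ(S, ⊤)) (K : CochainComplex (Pre R) ℤ) :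
    (derivedSection R a).app (Q.obj K) =
      show (derivedIhom R).obj (Q.obj K) ⟶ Q.obj K from
      (derivedIhomQ R K).hom ≫ Q.map (sectionC (affineLinePoint S a) K) := by
  refine (Localization.liftNatTrans_app Q (HomologicalComplex.quasiIso (Pre R) (.up ℤ))
    (ihomC R (affineLine S) ⋙ Q) Q (derivedIhom R) (𝟭 _) _ K).trans
    (congrArg ((derivedIhomQ R K).hom ≫ ·) ((Category.comp_id _).trans (congrArg Q.map ?_)))
  ext n : 1
  exact Category.comp_id _

theorem derivedProj_section (a : Γ(S, ⊤)) (A : DerivedCategory (Pre R)) :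
    (derivedProj R).app A ≫ (derivedSection R a).app A = 𝟙 A := by
  suffices h : derivedProj R ≫ derivedSection R a = 𝟙 _ from NatTrans.congr_app h A
  refine Localization.natTrans_ext Q (HomologicalComplex.quasiIso (Pre R) (.up ℤ)) fun K => ?_
  refine (congrArg₂ (· ≫ ·) (derivedProj_app_Q R K) (derivedSection_app_Q R a K)).trans ?_
  change (Q.map (projC (affineLine S) K) ≫ (derivedIhomQ R K).inv) ≫
    (derivedIhomQ R K).hom ≫ Q.map (sectionC (affineLinePoint S a) K) = 𝟙 (Q.obj K)
  rw [Category.assoc, Iso.inv_hom_id_assoc, ← Functor.map_comp, projC_sectionC,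
    CategoryTheory.Functor.map_id]

/-- Up to the comparison isomorphism `p` is the image of `projC`, which is inverted exactly when it
is a quasi-isomorphism, and on homology it is the projection map of the homology presheaves. -/
theorem isIso_derivedProj_Q_iff (K : CochainComplex (Pre R) ℤ) :
    IsIso ((derivedProj R).app (Q.obj K)) ↔ ∀ n, IsHomotopyInvariant R (K.homology n) := by
  have h : IsIso ((derivedProj R).app (Q.obj K)) ↔ IsIso (Q.map (projC (affineLine S) K)) := by
    rw [derivedProj_app_Q]
    exact isIso_comp_right_iff (Q.map (projC (affineLine S) K)) (derivedIhomQ R K).inv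
  rw [h, isIso_Q_map_iff_quasiIso]
  simp_rw [isHomotopyInvariant_homology_iff, quasiIso_iff, quasiIsoAt_iff_isIso_homologyMap]

theorem isIso_derivedProj_iff (A : DerivedCategory (Pre R)) :
    IsIso ((derivedProj R).app A) ↔ ∀ n, IsHomotopyInvariant R ((homologyFunctor _ n).obj A) := by
  let e := Q.objObjPreimageIso A
  rw [← NatTrans.isIso_app_iff_of_iso _ e, isIso_derivedProj_Q_iff]
  exact forall_congr' fun n => ObjectProperty.prop_iff_of_iso _
    ((homologyQ _ n).symm ≪≫ (homologyFunctor _ n).mapIso e)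

theorem a1Inv_iff (A : Minus (Pre R)) :
    a1Inv R A ↔ ∀ n, IsHomotopyInvariant R ((homologyFunctor _ n).obj A.obj) :=
  isIso_derivedProj_iff R A.obj

/-- Invariance is a condition on cohomology with values in a Serre class, so extensions follow from
the long exact sequence. A retraction is a split epimorphism on cohomology, whence closure under
retracts. -/
theorem isThick_a1Inv : IsThick (a1Inv R) where
  isTriangulated :=
    { exists_zero := ⟨_, isZero_zero _, (a1Inv_iff R _).2 fun n =>
        (IsHomotopyInvariant R).prop_of_isZero
          ((homologyFunctor _ n).map_isZero (Minus.ι.map_isZero (isZero_zero _)))⟩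
      isStableUnderShiftBy m := ⟨fun A hA => (a1Inv_iff R _).2 fun n =>
        ObjectProperty.prop_of_iso _ ((((homologyFunctor (Pre R) 0).shiftIso m n (m + n) rfl).symm.app
          A.obj) ≪≫ (homologyFunctor _ n).mapIso ((Minus.ι.commShiftIso m).symm.app A))
            ((a1Inv_iff R _).1 hA (m + n))⟩
      ext₂' T hT h₁ h₃ := ObjectProperty.le_isoClosure _ _ ((a1Inv_iff R _).2 fun n =>
        ObjectProperty.prop_X₂_of_exact _ (HomologySequence.exact₂ _ (Minus.ι.map_distinguished T hT) n)
          ((a1Inv_iff R _).1 h₁ n) ((a1Inv_iff R _).1 h₃ n)) }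
  isStableUnderRetracts := ⟨fun r h => (a1Inv_iff R _).2 fun n =>
    ((a1Inv_iff R _).1 h n).of_epi ((r.map Minus.ι).map (homologyFunctor _ n)).r⟩

end

end A1Motives

/-! ### Sums and products in `D⁻` -/

namespace DerivedCategory

noncomputable section

open CochainComplex

variable {C : Type*} [Category* C] [Abelian C] [HasDerivedCategory.{w} C] {J : Type*}

/-- The image in `D⁻` of a strictly bounded above complex. -/
abbrev Minus.mk (K : CochainComplex C ℤ) (n : ℤ) [K.IsLE n] : Minus C :=
  ⟨Q.obj K, n, (inferInstance : (Q.obj K).IsLE n)⟩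

theorem exists_isLE (X : Minus C) : ∃ n : ℤ, X.obj.IsLE n := by
  obtain ⟨n, hn⟩ := X.property
  exact ⟨n, hn⟩

theorem isLE_of_retract {X Y : DerivedCategory C} (r : Retract X Y) (n : ℤ) [Y.IsLE n] :
    X.IsLE n := by
  rw [isLE_iff]
  intro i hi
  rw [IsZero.iff_id_eq_zero, ← CategoryTheory.Functor.map_id, ← r.retract, Functor.map_comp,
    (isZero_of_isLE Y n i hi).eq_of_tgt ((homologyFunctor C i).map r.i) 0, zero_comp]

theorem exists_iso_mk (X : Minus C) (n : ℤ) (h : X.obj.IsLE n) :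
    ∃ (K : CochainComplex C ℤ) (_ : K.IsStrictlyLE n), Nonempty (X ≅ Minus.mk K n) := by
  obtain ⟨K, hK, ⟨e⟩⟩ := exists_iso_Q_obj_of_isLE X.obj n
  exact ⟨K, hK, ⟨ObjectProperty.isoMk _ e⟩⟩

/-- Coproducts in `D⁻` are uniformly bounded above. -/
theorem exists_isLE_of_isColimit {Y : J → Minus C} {X : Minus C} {ι : ∀ j, Y j ⟶ X}
    (h : IsColimit (Cofan.mk X ι)) : ∃ n : ℤ, ∀ j, (Y j).obj.IsLE n := by
  classical
  obtain ⟨n, hn⟩ := exists_isLE X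
  refine ⟨n, fun j => ?_⟩
  -- The projection to the `j`-th summand exhibits `Y j` as a retract of `X`, so a bound for `X`
  -- bounds all summands.
  let p : X ⟶ Y j := Cofan.IsColimit.desc h fun k => if e : k = j then eqToHom (by rw [e]) else 0
  have hp : ι j ≫ p = 𝟙 _ := (Cofan.IsColimit.fac h _ j).trans (by simp)
  have : X.obj.IsLE n := hn
  exact isLE_of_retract (Y := X.obj) (Retract.map ⟨ι j, p, hp⟩ Minus.ι) n

/-- Products in `D⁻` are uniformly bounded above. -/
theorem exists_isLE_of_isLimit {Y : J → Minus C} {X : Minus C} {π : ∀ j, X ⟶ Y j}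
    (h : IsLimit (Fan.mk X π)) : ∃ n : ℤ, ∀ j, (Y j).obj.IsLE n := by
  classical
  obtain ⟨n, hn⟩ := exists_isLE X
  refine ⟨n, fun j => ?_⟩
  let p : Y j ⟶ X := Fan.IsLimit.lift h fun k => if e : k = j then eqToHom (by rw [e]) else 0
  have hp : p ≫ π j = 𝟙 _ := (Fan.IsLimit.fac h _ j).trans (by simp)
  have : X.obj.IsLE n := hn
  exact isLE_of_retract (Y := X.obj) (Retract.map ⟨p, π j, hp⟩ Minus.ι) n

section coproduct

variable [HasColimitsOfShape (Discrete J) C] [HasExactColimitsOfShape (Discrete J) C]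

/-- The termwise coproduct is the coproduct in `D⁻`. -/
def sumIsColimitMinus (K : J → CochainComplex C ℤ) (n : ℤ) [∀ j, (K j).IsLE n] [(sum K).IsLE n] :
    IsColimit (Cofan.mk (Minus.mk (sum K) n) fun j =>
      (ObjectProperty.homMk (Q.map (sumι K j)) : Minus.mk (K j) n ⟶ Minus.mk (sum K) n)) :=
  Cofan.IsColimit.mk _
    (fun s => ObjectProperty.homMk
      (Cofan.IsColimit.desc (sumIsColimit K) fun j => (s.inj j).hom))
    (fun s j => by
      ext
      exact Cofan.IsColimit.fac (sumIsColimit K) _ j)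
    (fun s m hm => by
      ext
      refine Cofan.IsColimit.hom_ext (sumIsColimit K) _ _ fun j => ?_
      exact (congrArg (·.hom) (hm j)).trans (Cofan.IsColimit.fac (sumIsColimit K) (fun j => (s.inj j).hom) j).symm)

/-- With a common bound all members are represented by complexes vanishing above `n`, and the
termwise sum stays in `D⁻`. The last clause says that the cohomology of the sum is generated by that
of the members, which is all that is used about it. -/
theorem exists_coproduct (Y : J → Minus C) (n : ℤ) (hY : ∀ j, (Y j).obj.IsLE n) :
    ∃ (X : Minus C) (ι : ∀ j, Y j ⟶ X), Nonempty (IsColimit (Cofan.mk X ι)) ∧ X.obj.IsLE n ∧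
      ∀ (m : ℤ) (F : C) (f g : (homologyFunctor C m).obj X.obj ⟶ F),
        (∀ j, (homologyFunctor C m).map (ι j).hom ≫ f =
          (homologyFunctor C m).map (ι j).hom ≫ g) → f = g := by
  choose K hK e using fun j => exists_iso_mk (Y j) n (hY j)
  have := sum_isStrictlyLE K n
  refine ⟨Minus.mk (sum K) n, fun j => (e j).some.hom ≫ ObjectProperty.homMk (Q.map (sumι K j)),
    ⟨?_⟩, (inferInstance : (Q.obj (sum K)).IsLE n), fun m F f g h => ?_⟩
  · exact (IsColimit.precomposeHomEquiv (Discrete.natIso fun j => (e j.as).some) _).symm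
      (sumIsColimitMinus K n) |>.ofIsoColimit (Cocone.ext (Iso.refl _))
  · rw [← cancel_epi (homologyQ (sum K) m).inv]
    refine homology_sum_hom_ext K m fun j => ?_
    have h2 := h j
    have : IsIso (e j).some.hom.hom := inferInstanceAs (IsIso (Minus.ι.map (e j).some.hom))
    rw [ObjectProperty.FullSubcategory.comp_hom, Functor.map_comp, Category.assoc, Category.assoc,
      cancel_epi] at h2
    rw [← Category.assoc, ← Category.assoc, homologyQ_inv_naturality, Category.assoc,
      Category.assoc]
    exact congrArg _ h2

end coproduct

section product

variable [HasLimitsOfShape (Discrete J) C] [HasExactLimitsOfShape (Discrete J) C]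

/-- The termwise product is the product in `D⁻`. -/
def prodIsLimitMinus (K : J → CochainComplex C ℤ) (n : ℤ) [∀ j, (K j).IsLE n] [(CochainComplex.prod K).IsLE n] :
    IsLimit (Fan.mk (Minus.mk (CochainComplex.prod K) n) fun j =>
      (ObjectProperty.homMk (Q.map (prodπ K j)) : Minus.mk (CochainComplex.prod K) n ⟶ Minus.mk (K j) n)) :=
  Fan.IsLimit.mk _
    (fun s => ObjectProperty.homMk
      (Fan.IsLimit.lift (prodIsLimit K) fun j => (s.proj j).hom))
    (fun s j => by
      ext
      exact Fan.IsLimit.fac (prodIsLimit K) _ j)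
    (fun s m hm => by
      ext
      refine Fan.IsLimit.hom_ext (prodIsLimit K) _ _ fun j => ?_
      exact (congrArg (·.hom) (hm j)).trans (Fan.IsLimit.fac (prodIsLimit K) (fun j => (s.proj j).hom) j).symm)

/-- The termwise product of uniformly bounded representatives. Here the full statement that
cohomology commutes with the product is recorded, because elements of it have to be constructed from
their components. -/
theorem exists_product (Y : J → Minus C) (n : ℤ) (hY : ∀ j, (Y j).obj.IsLE n) :
    ∃ (X : Minus C) (π : ∀ j, X ⟶ Y j), Nonempty (IsLimit (Fan.mk X π)) ∧ X.obj.IsLE n ∧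
      ∀ m : ℤ, Nonempty (IsLimit (Fan.mk ((homologyFunctor C m).obj X.obj)
        fun j => (homologyFunctor C m).map (π j).hom)) := by
  choose K hK e using fun j => exists_iso_mk (Y j) n (hY j)
  have := prod_isStrictlyLE K n
  refine ⟨Minus.mk (CochainComplex.prod K) n, fun j => ObjectProperty.homMk (Q.map (prodπ K j)) ≫ (e j).some.inv,
    ⟨?_⟩, (inferInstance : (Q.obj (CochainComplex.prod K)).IsLE n), fun m => ⟨?_⟩⟩
  · exact (IsLimit.postcomposeHomEquiv (Discrete.natIso fun j => (e j.as).some.symm) _).symm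
      (prodIsLimitMinus K n) |>.ofIsoLimit (Cone.ext (Iso.refl _))
  · let i (j : J) : (K j).homology m ≅ (homologyFunctor C m).obj (Y j).obj :=
      (homologyQ (K j) m).symm ≪≫ (homologyFunctor C m).mapIso (Minus.ι.mapIso (e j).some.symm)
    refine (IsLimit.postcomposeHomEquiv (Discrete.natIso fun j => i j.as) _).symm
      (homologyProdIsLimit K m) |>.ofIsoLimit
        (Cone.ext (homologyQ (CochainComplex.prod K) m).symm fun ⟨j⟩ => ?_)
    exact (Category.assoc _ _ _).symm.trans ((homologyQ_inv_naturality (prodπ K j) m =≫ _).trans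
      ((Category.assoc _ _ _).trans (_ ≫= (Functor.map_comp _ _ _).symm)))

end product

end

end DerivedCategory

/-! ### Thick subcategories, closure of the invariant part, and orthogonality -/

namespace A1Motives

section

variable {T : Type*} [Category T] [HasZeroObject T] [HasShift T ℤ] [Preadditive T]
  [∀ n : ℤ, (shiftFunctor T n).Additive] [Pretriangulated T]

open Pretriangulated

theorem IsThick.isClosedUnderIsomorphisms {Q : ObjectProperty T} (hQ : IsThick Q) :
    Q.IsClosedUnderIsomorphisms :=
  have := hQ.isStableUnderRetracts
  inferInstance

theorem IsThick.ext₂ {Q : ObjectProperty T} (hQ : IsThick Q) {t : Triangle T}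
    (ht : t ∈ distTriang T) (h₁ : Q t.obj₁) (h₃ : Q t.obj₃) : Q t.obj₂ :=
  have := hQ.isTriangulated
  have := hQ.isClosedUnderIsomorphisms
  Q.ext_of_isTriangulatedClosed₂ t ht h₁ h₃

theorem IsThick.ext₃ {Q : ObjectProperty T} (hQ : IsThick Q) {t : Triangle T}
    (ht : t ∈ distTriang T) (h₁ : Q t.obj₁) (h₂ : Q t.obj₂) : Q t.obj₃ :=
  have := hQ.isTriangulated
  have := hQ.isClosedUnderIsomorphisms
  Q.ext_of_isTriangulatedClosed₃ t ht h₁ h₂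

theorem IsThick.ext₁ {Q : ObjectProperty T} (hQ : IsThick Q) {t : Triangle T}
    (ht : t ∈ distTriang T) (h₂ : Q t.obj₂) (h₃ : Q t.obj₃) : Q t.obj₁ :=
  have := hQ.isTriangulated
  have := hQ.isClosedUnderIsomorphisms
  Q.ext_of_isTriangulatedClosed₁ t ht h₂ h₃

theorem IsThick.shift {Q : ObjectProperty T} (hQ : IsThick Q) {X : T} (hX : Q X) (n : ℤ) :
    Q (X⟦n⟧) :=
  have := hQ.isTriangulated
  Q.le_shift n _ hX

theorem IsThick.of_iso {Q : ObjectProperty T} (hQ : IsThick Q) {X Y : T} (e : X ≅ Y)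
    (hX : Q X) : Q Y :=
  have := hQ.isClosedUnderIsomorphisms
  Q.prop_of_iso e hX

theorem IsThick.of_shift {Q : ObjectProperty T} (hQ : IsThick Q) {X : T} (n : ℤ)
    (hX : Q (X⟦n⟧)) : Q X :=
  hQ.of_iso ((shiftEquiv T n).unitIso.app X).symm (hQ.shift hX (-n))

/-- An intersection of thick subcategories is thick. -/
theorem IsThick.forall_imp {𝒬 : ObjectProperty T → Prop} (h : ∀ Q, 𝒬 Q → IsThick Q) :
    IsThick (fun X => ∀ Q, 𝒬 Q → Q X : ObjectProperty T) where
  isTriangulated :=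
    { exists_zero := ⟨_, isZero_zero T, fun Q hQ => by
        have := (h Q hQ).isTriangulated
        have := (h Q hQ).isClosedUnderIsomorphisms
        exact Q.prop_of_isZero (isZero_zero T)⟩
      isStableUnderShiftBy n := ⟨fun X hX Q hQ => (h Q hQ).shift (hX Q hQ) n⟩
      ext₂' t ht h₁ h₃ := ObjectProperty.le_isoClosure _ _ fun Q hQ =>
        (h Q hQ).ext₂ ht (h₁ Q hQ) (h₃ Q hQ) }
  isStableUnderRetracts := ⟨fun r hY Q hQ =>
    have := (h Q hQ).isStableUnderRetracts
    Q.prop_of_retract r (hY Q hQ)⟩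

theorem isThickWithSums_thickSumClosure (P : ObjectProperty T) :
    IsThickWithSums.{v} (thickSumClosure.{v} P) := by
  have e : thickSumClosure.{v} P = fun X => ∀ Q, (IsThickWithSums.{v} Q ∧ P ≤ Q) → Q X := by
    ext X
    exact ⟨fun h Q hQ => h Q hQ.1 hQ.2, fun h Q h₁ h₂ => h Q ⟨h₁, h₂⟩⟩
  refine { toIsThick := by rw [e]; exact IsThick.forall_imp fun Q hQ => hQ.1.toIsThick,
           sums := fun J => ⟨?_⟩ }
  rintro X ⟨h⟩ Q hQ hP
  have := hQ.sums J
  exact ObjectProperty.colimitsOfShape_le (P := Q) (J := Discrete J) _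
    ⟨{ toColimitPresentation := h.toColimitPresentation
       prop_diag_obj := fun j => h.prop_diag_obj j Q hQ hP }⟩

theorem le_thickSumClosure (P : ObjectProperty T) : P ≤ thickSumClosure.{v} P :=
  fun _ hX _ _ hP => hP _ hX

theorem thickSumClosure_le {P Q : ObjectProperty T} (hQ : IsThickWithSums.{v} Q) (h : P ≤ Q) :
    thickSumClosure.{v} P ≤ Q := fun _ hX => hX Q hQ h

end

noncomputable section

variable {S : Scheme.{u}} {R : Ringoid S}

/-- `F ↦ F(- × 𝔸¹)` preserves coproducts, so `s₀ = s₁` can be checked on the summands. -/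
theorem IsHomotopyInvariant.sigma {J : Type u} {F : J → Pre R}
    (h : ∀ j, IsHomotopyInvariant R (F j)) : IsHomotopyInvariant R (∐ F) := by
  refine isHomotopyInvariant_of_section_eq ?_
  refine Cofan.IsColimit.hom_ext (isColimitCofanMkObjOfIsColimit (ihom R (affineLine S)) _ _
    (coproductIsCoproduct F)) _ _ fun j => ?_
  change (ihom R (affineLine S)).map (Sigma.ι F j) ≫ _ = (ihom R (affineLine S)).map (Sigma.ι F j) ≫ _
  rw [ihom_map_section, ihom_map_section, (h j).section_eq]

theorem IsHomotopyInvariant.of_isLimit {J : Type u} {F : J → Pre R} {G : Pre R}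
    {π : ∀ j, G ⟶ F j} (hG : IsLimit (Fan.mk G π)) (h : ∀ j, IsHomotopyInvariant R (F j)) :
    IsHomotopyInvariant R G := by
  refine isHomotopyInvariant_of_section_eq (Fan.IsLimit.hom_ext hG _ _ fun j => ?_)
  change _ ≫ π j = _ ≫ π j
  exact (ihom_map_section _ _).symm.trans ((_ ≫= (h j).section_eq _ _).trans (ihom_map_section _ _))

variable (R) [HasDerivedCategory.{w} (Pre R)]

open DerivedCategory

instance : (a1Inv R).IsClosedUnderIsomorphisms where
  of_iso e h := (a1Inv_iff R _).2 fun n => ObjectProperty.prop_of_iso _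
    ((homologyFunctor _ n).mapIso (Minus.ι.mapIso e)) ((a1Inv_iff R _).1 h n)

theorem isThickWithSums_a1Inv : IsThickWithSums.{u} (a1Inv R) where
  toIsThick := isThick_a1Inv R
  sums J := ⟨by
    rintro X ⟨h⟩
    let Y (j : J) := h.diag.obj ⟨j⟩
    have hX : IsColimit (Cofan.mk (f := Y) X fun j => h.ι.app ⟨j⟩) :=
      ((IsColimit.precomposeHomEquiv (Discrete.natIsoFunctor (F := h.diag)).symm _).symm
        h.isColimit).ofIsoColimit (Cocone.ext (Iso.refl _))
    obtain ⟨n, hn⟩ := exists_isLE_of_isColimit hX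
    obtain ⟨X', ι, ⟨hX'⟩, -, hext⟩ := exists_coproduct Y n hn
    refine ObjectProperty.prop_of_iso _ (hX'.coconePointUniqueUpToIso hX)
      ((a1Inv_iff R _).2 fun m => ?_)
    -- A quotient of the sum of the cohomology presheaves is enough, as homotopy invariance passes
    -- to quotients.
    have : Epi (Limits.Sigma.desc fun j => (homologyFunctor _ m).map (ι j).hom) :=
      ⟨fun f g hfg => hext m _ f g fun j => by
        rw [← Limits.Sigma.ι_desc (fun j => (homologyFunctor _ m).map (ι j).hom) j, Category.assoc,
          hfg, Category.assoc]⟩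
    exact (IsHomotopyInvariant.sigma fun j => (a1Inv_iff R _).1 (h.prop_diag_obj ⟨j⟩) m).of_epi
      (hf := this) _⟩

theorem isThickWithProducts_a1Inv : IsThickWithProducts.{u} (a1Inv R) where
  toIsThick := isThick_a1Inv R
  products J := ⟨by
    rintro X ⟨h⟩
    let Y (j : J) := h.diag.obj ⟨j⟩
    have hX : IsLimit (Fan.mk (f := Y) X fun j => h.π.app ⟨j⟩) :=
      ((IsLimit.postcomposeHomEquiv (Discrete.natIsoFunctor (F := h.diag)) _).symm
        h.isLimit).ofIsoLimit (Cone.ext (Iso.refl _))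
    obtain ⟨n, hn⟩ := exists_isLE_of_isLimit hX
    obtain ⟨X', π, ⟨hX'⟩, -, hl⟩ := exists_product Y n hn
    refine ObjectProperty.prop_of_iso _ (hX'.conePointUniqueUpToIso hX)
      ((a1Inv_iff R _).2 fun m => ?_)
    exact IsHomotopyInvariant.of_isLimit (hl m).some
      fun j => (a1Inv_iff R _).1 (h.prop_diag_obj ⟨j⟩) m⟩

/-! ### Orthogonality -/

/-- Every section retracts `p`; once `p` is invertible they all equal its inverse. -/
theorem derivedSection_eq {A : Minus (Pre R)} (hA : a1Inv R A) (a b : Γ(S, ⊤)) :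
    (derivedSection R a).app A.obj = (derivedSection R b).app A.obj := by
  have : IsIso ((derivedProj R).app A.obj) := hA
  rw [← cancel_epi ((derivedProj R).app A.obj)]
  exact (derivedProj_section R a A.obj).trans (derivedProj_section R b A.obj).symm

/-- By naturality of the sections, `f` is obtained from `h ≫ Hom(𝔸¹, f)` by evaluating at `0`, while
evaluating at `1` gives zero; on an invariant target the two evaluations coincide. -/
theorem isContractibleObject_le_leftOrthogonal :
    IsContractibleObject R ≤ (a1Inv R).leftOrthogonal := by
  rintro B ⟨h, h0, h1⟩ A f hA
  ext
  have hs (a : Γ(S, ⊤)) := (derivedSection R a).naturality f.hom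
  have e0 : f.hom = h ≫ (derivedIhom R).map f.hom ≫ (derivedSection R 0).app A.obj := by
    refine Eq.trans ?_ (h ≫= (hs 0).symm)
    exact (Category.id_comp f.hom).symm.trans ((h0.symm =≫ f.hom).trans (Category.assoc _ _ _))
  have e1 : h ≫ (derivedIhom R).map f.hom ≫ (derivedSection R 1).app A.obj = 0 := by
    refine (h ≫= (hs 1)).trans ?_
    exact (Category.assoc _ _ _).symm.trans ((h1 =≫ f.hom).trans zero_comp)
  rw [derivedSection_eq R hA 0 1] at e0
  exact e0.trans e1

theorem isThickWithSums_leftOrthogonal : IsThickWithSums.{u} (a1Inv R).leftOrthogonal where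
  isTriangulated := by
    have : (a1Inv R).IsTriangulated := (isThick_a1Inv R).isTriangulated
    infer_instance
  isStableUnderRetracts := ⟨fun r h A f hA => by
    rw [← Category.id_comp f, ← r.retract, Category.assoc, h (r.r ≫ f) hA, comp_zero]⟩
  sums J := ⟨by
    rintro X ⟨h⟩ A f hA
    refine h.isColimit.hom_ext fun j => ?_
    rw [h.prop_diag_obj j (h.ι.app j ≫ f) hA, comp_zero]⟩

theorem isThickWithSums_a1Contr : IsThickWithSums.{u} (a1Contr R) :=
  isThickWithSums_thickSumClosure _

theorem a1Contr_le_leftOrthogonal : a1Contr R ≤ (a1Inv R).leftOrthogonal :=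
  thickSumClosure_le (isThickWithSums_leftOrthogonal R) (isContractibleObject_le_leftOrthogonal R)

end

end A1Motives

/-! ### Elementwise telescope arguments -/

namespace A1Motives

section telescope

variable {T : Type*} [Category T] [Preadditive T] (H : T ⥤ AddCommGrpCat.{u}) [H.Additive]

/-- The difference between the identity and the shift is injective on the value at a coproduct
of a functor for which this value is generated by the summands. -/
theorem telescope_sum_injective {F : ℕ → T} {Z : T} {f : ∀ k, F k ⟶ F (k + 1)} {ι : ∀ k, F k ⟶ Z}
    (hdesc : ∀ {Y : T} (g : ∀ k, F k ⟶ Y), ∃ h : Z ⟶ Y, ∀ k, ι k ≫ h = g k)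
    (hext : ∀ {Y : T} (g h : Z ⟶ Y), (∀ k, ι k ≫ g = ι k ≫ h) → g = h)
    {φ : Z ⟶ Z} (hφ : ∀ k, ι k ≫ φ = ι k - f k ≫ ι (k + 1))
    (hgen : ∀ x : H.obj Z, x ∈ ⨆ k, (H.map (ι k)).hom.range) :
    Function.Injective (H.map φ) := by
  -- Projections to the summands. Every element of the value at `Z` is the finite sum of its
  -- components, so it vanishes when all its components do.
  choose π hπ using fun j => hdesc (fun k => if e : k = j then eqToHom (by rw [e]) else 0)
  have hsum (x : H.obj Z) : ∃ N, ∀ M ≥ N, x =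
      ∑ k ∈ Finset.range M, H.map (ι k) (H.map (π k) x) := by
    refine AddSubgroup.iSup_induction _ (C := fun x => ∃ N, ∀ M ≥ N, x =
      ∑ k ∈ Finset.range M, H.map (ι k) (H.map (π k) x)) (hgen x) ?_ ⟨0, by simp⟩ ?_
    · rintro j _ ⟨y, rfl⟩
      refine ⟨j + 1, fun M hM => ?_⟩
      rw [Finset.sum_eq_single_of_mem j (by simp; lia)]
      · change H.map (ι j) y = H.map (ι j) (H.map (π j) (H.map (ι j) y))
        rw [← ConcreteCategory.comp_apply (H.map (ι j)) (H.map (π j)), ← Functor.map_comp, hπ]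
        simp
      · intro k _ hk
        change H.map (ι k) (H.map (π k) (H.map (ι j) y)) = 0
        rw [← ConcreteCategory.comp_apply (H.map (ι j)), ← Functor.map_comp, hπ, dif_neg hk.symm]
        simp
    · rintro x y ⟨N, hN⟩ ⟨N', hN'⟩
      refine ⟨max N N', fun M hM => ?_⟩
      conv_lhs => rw [hN M (by lia), hN' M (by lia), ← Finset.sum_add_distrib]
      simp
  have h0 : φ ≫ π 0 = π 0 := hext _ _ fun k => by
    rw [← Category.assoc, hφ, Preadditive.sub_comp, Category.assoc, hπ 0 (k + 1)]
    simp
  have hs (j : ℕ) : φ ≫ π (j + 1) = π (j + 1) - π j ≫ f j := hext _ _ fun k => by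
    rw [← Category.assoc, hφ, Preadditive.sub_comp, Category.assoc, hπ (j + 1) (k + 1),
      Preadditive.comp_sub]
    congr 1
    rw [← Category.assoc, hπ]
    by_cases e : k = j
    · subst e; simp
    · simp [e]
  rw [injective_iff_map_eq_zero]
  intro x hx
  -- If `x` is killed by `1 - shift`, its components satisfy `x₀ = 0` and `x_{j+1} = f_j(x_j)`.
  have hπx (j : ℕ) : H.map (π j) x = 0 := by
    induction j with
    | zero => rw [← h0, Functor.map_comp, ConcreteCategory.comp_apply, hx, map_zero]
    | succ j hj =>
      have : π (j + 1) = φ ≫ π (j + 1) + π j ≫ f j := by rw [hs]; abel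
      rw [this, Functor.map_add, Functor.map_comp, Functor.map_comp]
      change H.map (π (j + 1)) (H.map φ x) + H.map (f j) (H.map (π j) x) = 0
      rw [hx, hj, map_zero, map_zero, add_zero]
  obtain ⟨N, hN⟩ := hsum x
  rw [hN N le_rfl]
  exact Finset.sum_eq_zero fun k _ => by rw [hπx, map_zero]

/-- For a functor which is eventually constant on a sequence, the value at the end of the sequence
is the cokernel of the difference between the identity and the shift. -/
theorem telescope_sum_exact {F : ℕ → T} {Z B : T} {f : ∀ k, F k ⟶ F (k + 1)} {ι : ∀ k, F k ⟶ Z}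
    {b : ∀ k, F k ⟶ B}
    {φ : Z ⟶ Z} (hφ : ∀ k, ι k ≫ φ = ι k - f k ≫ ι (k + 1))
    {β : Z ⟶ B} (hβ : ∀ k, ι k ≫ β = b k) (hφβ : φ ≫ β = 0)
    (hgen : ∀ x : H.obj Z, x ∈ ⨆ k, (H.map (ι k)).hom.range)
    (K : ℕ) (hK : ∀ k ≥ K, Function.Bijective (H.map (b k))) :
    Function.Surjective (H.map β) ∧
      ∀ x, H.map β x = 0 → ∃ y, H.map φ y = x := by
  refine ⟨fun x => ?_, fun x hx => ?_⟩
  · obtain ⟨y, rfl⟩ := (hK K le_rfl).2 x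
    refine ⟨H.map (ι K) y, ?_⟩
    rw [← ConcreteCategory.comp_apply, ← Functor.map_comp, hβ]
  · have h1 (k : ℕ) (y : H.obj (F k)) (N : ℕ) (hN : N ≥ k) :
        ∃ (z : H.obj Z) (y' : H.obj (F N)), H.map (ι k) y = H.map φ z + H.map (ι N) y' := by
      induction N, hN using Nat.le_induction with
      | base => exact ⟨0, y, by simp⟩
      | succ N _ h =>
        obtain ⟨z, y', h⟩ := h
        refine ⟨z + H.map (ι N) y', H.map (f N) y', ?_⟩
        rw [h, map_add, ← ConcreteCategory.comp_apply (H.map (ι N)), ← Functor.map_comp, hφ,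
          ← ConcreteCategory.comp_apply (H.map (f N)), ← Functor.map_comp, Functor.map_sub]
        change _ = H.map φ z + (H.map (ι N) y' - H.map (f N ≫ ι (N + 1)) y') +
          H.map (f N ≫ ι (N + 1)) y'
        abel
    have h2 (x : H.obj Z) : ∃ N ≥ K, ∀ M ≥ N, ∃ (z : H.obj Z) (y' : H.obj (F M)),
        x = H.map φ z + H.map (ι M) y' := by
      refine AddSubgroup.iSup_induction _ (C := fun x => ∃ N ≥ K, ∀ M ≥ N, ∃ (z : H.obj Z)
        (y' : H.obj (F M)), x = H.map φ z + H.map (ι M) y') (hgen x) ?_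
        ⟨K, le_rfl, fun M _ => ⟨0, 0, by simp⟩⟩ ?_
      · rintro k _ ⟨y, rfl⟩
        exact ⟨max K k, by lia, fun M hM => h1 k y M (by lia)⟩
      · rintro x y ⟨N, hN, h⟩ ⟨N', hN', h'⟩
        refine ⟨max N N', by lia, fun M hM => ?_⟩
        obtain ⟨z, v, e⟩ := h M (by lia)
        obtain ⟨z', v', e'⟩ := h' M (by lia)
        refine ⟨z + z', v + v', ?_⟩
        rw [e, e', map_add, map_add]
        abel
    obtain ⟨N, hN, h⟩ := h2 x
    obtain ⟨z, y, rfl⟩ := h N le_rfl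
    rw [map_add, ← ConcreteCategory.comp_apply, ← Functor.map_comp, hφβ,
      ← ConcreteCategory.comp_apply, ← Functor.map_comp, hβ] at hx
    have hy : H.map (b N) y = 0 := by simpa using hx
    rw [(hK N hN).1 (hy.trans (map_zero _).symm)]
    exact ⟨z, by simp⟩

/-- The difference between the identity and the shift is surjective on the value at a product
of a functor which commutes with this product and is eventually constant. -/
theorem telescope_prod_surjective {G : ℕ → T} {Z B : T} {g : ∀ k, G (k + 1) ⟶ G k}
    {π : ∀ k, Z ⟶ G k} {a : ∀ k, B ⟶ G k} (ha : ∀ k, a (k + 1) ≫ g k = a k)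
    {φ : Z ⟶ Z} (hφ : ∀ k, φ ≫ π k = π k - π (k + 1) ≫ g k)
    (hinj : ∀ x y : H.obj Z, (∀ k, H.map (π k) x = H.map (π k) y) → x = y)
    (hsurj : ∀ v : ∀ k, H.obj (G k), ∃ x : H.obj Z, ∀ k, H.map (π k) x = v k)
    (K : ℕ) (hK : ∀ k ≥ K, Function.Bijective (H.map (a k))) :
    Function.Surjective (H.map φ) := by
  intro y
  -- The equations `x_k - g_k(x_{k+1}) = y_k` are first solved for `k ≥ K`, where the sequence is
  -- constant, and then for smaller `k`, one index at a time downwards.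
  have key (d : ℕ) : ∃ x : ∀ k, H.obj (G k), ∀ k, k + d ≥ K →
      x k - H.map (g k) (x (k + 1)) = H.map (π k) y := by
    induction d with
    | zero =>
      have hb (k : ℕ) : ∃ c : H.obj B, k ≥ K → H.map (a k) c = H.map (π k) y := by
        by_cases hk : k ≥ K
        · obtain ⟨c, hc⟩ := (hK k hk).2 (H.map (π k) y)
          exact ⟨c, fun _ => hc⟩
        · exact ⟨0, fun h => (hk h).elim⟩
      choose c hc using hb
      -- In a constant system the equation reads `x_k - x_{k+1} = c_k`, solved by negative partial
      -- sums.
      refine ⟨fun k => - H.map (a k) (∑ j ∈ Finset.range k, c j), fun k hk => ?_⟩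
      have e : H.map (g k) (-H.map (a (k + 1)) (∑ j ∈ Finset.range (k + 1), c j)) =
          -H.map (a k) (∑ j ∈ Finset.range (k + 1), c j) := by
        rw [map_neg, ← ConcreteCategory.comp_apply, ← Functor.map_comp, ha]
      rw [e, Finset.sum_range_succ, map_add, hc k hk]
      exact (neg_sub_neg _ _).trans (add_sub_cancel_left _ _)
    | succ d hd =>
      obtain ⟨x, hx⟩ := hd
      by_cases hdK : d < K
      · obtain ⟨l, rfl⟩ : ∃ l, K = l + d + 1 := ⟨K - d - 1, by lia⟩
        refine ⟨Function.update x l (H.map (g l) (x (l + 1)) + H.map (π l) y), fun k hk => ?_⟩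
        by_cases e : k = l
        · subst e
          rw [Function.update_self, Function.update_of_ne (by lia)]
          abel
        · rw [Function.update_of_ne e, Function.update_of_ne (by lia)]
          exact hx k (by lia)
      · exact ⟨x, fun k _ => hx k (by lia)⟩
  obtain ⟨v, hv⟩ := key K
  obtain ⟨x, hx⟩ := hsurj v
  refine ⟨x, hinj _ _ fun k => ?_⟩
  rw [← hv k (by lia), ← hx k, ← hx (k + 1), ← ConcreteCategory.comp_apply (H.map φ),
    ← Functor.map_comp, hφ, Functor.map_sub, Functor.map_comp]
  rfl

/-- For a functor which is eventually constant on a sequence, the value at the end of the sequence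
is the kernel of the difference between the identity and the shift. -/
theorem telescope_prod_exact {G : ℕ → T} {Z B : T} {g : ∀ k, G (k + 1) ⟶ G k}
    {π : ∀ k, Z ⟶ G k} {a : ∀ k, B ⟶ G k} (ha : ∀ k, a (k + 1) ≫ g k = a k)
    {φ : Z ⟶ Z} (hφ : ∀ k, φ ≫ π k = π k - π (k + 1) ≫ g k)
    {α : B ⟶ Z} (hα : ∀ k, α ≫ π k = a k)
    (hinj : ∀ x y : H.obj Z, (∀ k, H.map (π k) x = H.map (π k) y) → x = y)
    (K : ℕ) (hK : ∀ k ≥ K, Function.Bijective (H.map (a k))) :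
    Function.Injective (H.map α) ∧ ∀ x, H.map φ x = 0 → ∃ y, H.map α y = x := by
  refine ⟨fun x y hxy => ?_, fun x hx => ?_⟩
  · refine (hK K le_rfl).1 ?_
    rw [← hα, Functor.map_comp, ConcreteCategory.comp_apply, ConcreteCategory.comp_apply, hxy]
  · have hx' (k : ℕ) : H.map (g k) (H.map (π (k + 1)) x) = H.map (π k) x := by
      have : H.map (φ ≫ π k) x = 0 := by
        rw [Functor.map_comp, ConcreteCategory.comp_apply, hx, map_zero]
      rw [hφ, Functor.map_sub, Functor.map_comp] at this
      exact (sub_eq_zero.1 this).symm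
    have hg (k : ℕ) (y : H.obj B) : H.map (g k) (H.map (a (k + 1)) y) = H.map (a k) y := by
      rw [← ConcreteCategory.comp_apply, ← Functor.map_comp, ha]
    obtain ⟨y, hy⟩ := (hK K le_rfl).2 (H.map (π K) x)
    have h1 (k : ℕ) (hk : k ≥ K) : H.map (a k) y = H.map (π k) x := by
      induction k, hk using Nat.le_induction with
      | base => exact hy
      | succ k hk h =>
        obtain ⟨y', hy'⟩ := (hK (k + 1) (by lia)).2 (H.map (π (k + 1)) x)
        rw [← hy', (hK k hk).1 (h.trans ((hx' k).symm.trans ((congrArg _ hy'.symm).trans (hg k y'))))]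
    -- A compatible family is determined at small indices by its values at large ones, via the
    -- transition maps.
    have h2 (d : ℕ) : ∀ k, k + d ≥ K → H.map (a k) y = H.map (π k) x := by
      induction d with
      | zero => exact h1
      | succ d hd =>
        intro k hk
        rw [← hg, hd (k + 1) (by lia), hx']
    refine ⟨y, hinj _ _ fun k => ?_⟩
    rw [← h2 K k (by lia), ← ConcreteCategory.comp_apply, ← Functor.map_comp, hα]

end telescope

end A1Motives

/-! ### Sections of cohomology presheaves -/

namespace A1Motives

noncomputable section

variable {S : Scheme.{u}} {R : Ringoid S}

theorem sections_exact {T : ShortComplex (Pre R)} (hT : T.Exact) (X : Sm S) (x : (ev R X).obj T.X₂)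
    (hx : (ev R X).map T.g x = 0) : ∃ y, (ev R X).map T.f y = x :=
  (ShortComplex.ab_exact_iff _).1 (hT.map (ev R X)) x hx

theorem sections_zero (T : ShortComplex (Pre R)) (X : Sm S) (x : (ev R X).obj T.X₁) :
    (ev R X).map T.g ((ev R X).map T.f x) = 0 := by
  rw [← ConcreteCategory.comp_apply, ← Functor.map_comp, T.zero]
  simp

/-- The sections of a coproduct are generated by the sections of the summands. -/
theorem mem_iSup_sections_sigma {J : Type u} (F : J → Pre R) (X : Sm S) (x : (ev R X).obj (∐ F)) :
    x ∈ ⨆ j, ((ev R X).map (Sigma.ι F j)).hom.range := by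
  let N := ⨆ j, ((ev R X).map (Sigma.ι F j)).hom.range
  let q : (ev R X).obj (∐ F) ⟶ .of ((ev R X).obj (∐ F) ⧸ N) :=
    AddCommGrpCat.ofHom (QuotientAddGroup.mk' N)
  have hq : q = 0 := Cofan.IsColimit.hom_ext (isColimitCofanMkObjOfIsColimit (ev R X) _ _
    (coproductIsCoproduct F)) _ _ fun j => by
    ext y
    refine (QuotientAddGroup.eq_zero_iff _).2 ?_
    exact AddSubgroup.mem_iSup_of_mem (S := fun j => ((ev R X).map (Sigma.ι F j)).hom.range) j
      ⟨y, rfl⟩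
  have : q x = 0 := by rw [hq]; rfl
  exact (QuotientAddGroup.eq_zero_iff _).1 this

/-- Joint epimorphy makes `∐ F ⟶ G` an epimorphism of presheaves, hence surjective on sections, and
sections of `∐ F` come from the summands. -/
theorem mem_iSup_sections {J : Type u} {F : J → Pre R} {G : Pre R} (i : ∀ j, F j ⟶ G)
    (hext : ∀ (M : Pre R) (f g : G ⟶ M), (∀ j, i j ≫ f = i j ≫ g) → f = g) (X : Sm S)
    (x : (ev R X).obj G) : x ∈ ⨆ j, ((ev R X).map (i j)).hom.range := by
  have : Epi (Limits.Sigma.desc i) := ⟨fun f g hfg => hext _ f g fun j => by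
    rw [← Limits.Sigma.ι_desc i j, Category.assoc, hfg, Category.assoc]⟩
  obtain ⟨y, rfl⟩ := sections_surjective (Limits.Sigma.desc i) X x
  have h2 : ((ev R X).map (Limits.Sigma.desc i)).hom y ∈
      (⨆ j, ((ev R X).map (Sigma.ι F j)).hom.range).map ((ev R X).map (Limits.Sigma.desc i)).hom :=
    ⟨y, mem_iSup_sections_sigma F X y, rfl⟩
  rw [AddSubgroup.map_iSup] at h2
  have h3 (j : J) : ((ev R X).map (Sigma.ι F j)).hom.range.map
      ((ev R X).map (Limits.Sigma.desc i)).hom ≤ ((ev R X).map (i j)).hom.range := ?_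
  · exact iSup_mono h3 h2
  rintro _ ⟨_, ⟨y, rfl⟩, rfl⟩
  refine ⟨y, ?_⟩
  change (ev R X).map (i j) y = (ev R X).map (Limits.Sigma.desc i) ((ev R X).map (Sigma.ι F j) y)
  rw [← ConcreteCategory.comp_apply, ← Functor.map_comp, Limits.Sigma.ι_desc]

variable (R) [HasDerivedCategory.{w} (Pre R)]

open DerivedCategory Pretriangulated

/-- The sections of the cohomology presheaves. -/
abbrev cohSections (m : ℤ) (X : Sm S) : Minus (Pre R) ⥤ AddCommGrpCat.{u} :=
  Minus.ι ⋙ homologyFunctor (Pre R) m ⋙ ev R X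

variable {R}

theorem isIso_of_cohSections {A B : Minus (Pre R)} (f : A ⟶ B)
    (h : ∀ m X, Function.Bijective ((cohSections R m X).map f)) : IsIso f := by
  have : IsIso (Minus.ι.map f) := (isIso_iff _ _).2 fun m => isIso_of_sections _ fun X =>
    (ConcreteCategory.isIso_iff_bijective _).2 (h m X)
  exact isIso_of_fully_faithful Minus.ι f

theorem bijective_cohSections {A B : Minus (Pre R)} (f : A ⟶ B) (m : ℤ)
    (h : IsIso ((homologyFunctor (Pre R) m).map f.hom)) (X : Sm S) :
    Function.Bijective ((cohSections R m X).map f) :=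
  (ConcreteCategory.isIso_iff_bijective ((ev R X).map ((homologyFunctor (Pre R) m).map f.hom))).1
    inferInstance

variable {t : Triangle (Minus (Pre R))} (ht : t ∈ distTriang _)

include ht

/-- If `H^{m+1}(t.mor₁)` is injective then `H^m(t.mor₂)` is surjective. -/
theorem coh_surjective (m : ℤ) (X : Sm S)
    (h : Function.Injective ((cohSections R (m + 1) X).map t.mor₁)) :
    Function.Surjective ((cohSections R m X).map t.mor₂) := by
  intro x
  have ht' := Minus.ι.map_distinguished t ht
  refine sections_exact (HomologySequence.exact₃ _ ht' m (m + 1) rfl) X x (h ?_)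
  refine Eq.trans ?_ (map_zero _).symm
  exact sections_zero (.mk _ _ (HomologySequence.δ_comp _ ht' m (m + 1) rfl)) X x

/-- If `H^m(t.mor₂)` is surjective then `H^{m+1}(t.mor₁)` is injective. -/
theorem coh_injective (m : ℤ) (X : Sm S)
    (h : Function.Surjective ((cohSections R m X).map t.mor₂)) :
    Function.Injective ((cohSections R (m + 1) X).map t.mor₁) := by
  rw [injective_iff_map_eq_zero]
  intro x hx
  have ht' := Minus.ι.map_distinguished t ht
  obtain ⟨y, rfl⟩ := sections_exact (HomologySequence.exact₁ _ ht' m (m + 1) rfl) X x hx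
  obtain ⟨z, rfl⟩ := h y
  exact sections_zero (.mk _ _ (HomologySequence.comp_δ _ ht' m (m + 1) rfl)) X z

end

end A1Motives

/-! ### Telescopes and filtrations in `D⁻` -/

namespace A1Motives

noncomputable section

variable {S : Scheme.{u}} {R : Ringoid S} [HasDerivedCategory.{w} (Pre R)]

open DerivedCategory Pretriangulated

theorem IsThickWithSums.prop_of_isColimit {Q : ObjectProperty (Minus (Pre R))}
    (hQ : IsThickWithSums.{u} Q) {J : Type u} {F : J → Minus (Pre R)} {Z : Minus (Pre R)}
    {ι : ∀ j, F j ⟶ Z} (h : IsColimit (Cofan.mk Z ι)) (hF : ∀ j, Q (F j)) : Q Z :=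
  have := hQ.sums J
  ObjectProperty.colimitsOfShape_le (P := Q) (J := Discrete J) _
    ⟨{ diag := _, ι := _, isColimit := h, prop_diag_obj := fun j => hF j.as }⟩

theorem IsThickWithProducts.prop_of_isLimit {Q : ObjectProperty (Minus (Pre R))}
    (hQ : IsThickWithProducts.{u} Q) {J : Type u} {F : J → Minus (Pre R)} {Z : Minus (Pre R)}
    {π : ∀ j, Z ⟶ F j} (h : IsLimit (Fan.mk Z π)) (hF : ∀ j, Q (F j)) : Q Z :=
  have := hQ.products J
  ObjectProperty.limitsOfShape_le (P := Q) (J := Discrete J) _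
    ⟨{ diag := _, π := _, isLimit := h, prop_diag_obj := fun j => hF j.as }⟩

/-- A thick subcategory with direct sums contains the limits of the sequences of its objects which
are eventually constant on cohomology. -/
theorem IsThickWithSums.prop_of_telescope {Q : ObjectProperty (Minus (Pre R))}
    (hQ : IsThickWithSums.{u} Q) {B : Minus (Pre R)} {F : ℕ → Minus (Pre R)}
    (f : ∀ k, F k ⟶ F (k + 1)) (b : ∀ k, F k ⟶ B) (hb : ∀ k, f k ≫ b (k + 1) = b k)
    (n : ℤ) (hn : ∀ k, (F k).obj.IsLE n) (hF : ∀ k, Q (F k))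
    (hK : ∀ m, ∃ K, ∀ k ≥ K, IsIso ((homologyFunctor (Pre R) m).map (b k).hom)) : Q B := by
  -- The index set is lifted because closure under sums is only assumed for families indexed in
  -- `Type u`.
  obtain ⟨Z, ι', ⟨hZ⟩, -, hgen⟩ := exists_coproduct (J := ULift.{u} ℕ) (fun k => F k.down) n
    fun k => hn _
  have hQZ : Q Z := hQ.prop_of_isColimit hZ fun k => hF _
  let ι (k : ℕ) : F k ⟶ Z := ι' ⟨k⟩
  have hdesc {Y : Minus (Pre R)} (g : ∀ k, F k ⟶ Y) : ∃ h : Z ⟶ Y, ∀ k, ι k ≫ h = g k :=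
    ⟨Cofan.IsColimit.desc hZ fun k => g k.down,
      fun k => Cofan.IsColimit.fac hZ (fun k => g k.down) ⟨k⟩⟩
  have hext {Y : Minus (Pre R)} (g h : Z ⟶ Y) (H : ∀ k, ι k ≫ g = ι k ≫ h) : g = h :=
    Cofan.IsColimit.hom_ext hZ _ _ fun k => H k.down
  have hgen' (m : ℤ) (X : Sm S) (x : (cohSections R m X).obj Z) :
      x ∈ ⨆ k, ((cohSections R m X).map (ι k)).hom.range := by
    have := mem_iSup_sections (fun k => (homologyFunctor (Pre R) m).map (ι' k).hom) (hgen m) X x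
    rw [← Equiv.ulift.{u}.symm.iSup_comp] at this
    exact this
  obtain ⟨φ, hφ⟩ := hdesc fun k => ι k - f k ≫ ι (k + 1)
  obtain ⟨β, hβ⟩ := hdesc b
  have hφβ : φ ≫ β = 0 := hext _ _ fun k => by
    rw [← Category.assoc, hφ, Preadditive.sub_comp, Category.assoc, hβ, hβ, hb, sub_self, comp_zero]
  obtain ⟨G, g, δ, ht⟩ := distinguished_cocone_triangle φ
  obtain ⟨γ, hγ⟩ : ∃ γ : G ⟶ B, β = g ≫ γ := Triangle.yoneda_exact₂ _ ht β hφβ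
  have hinj (m : ℤ) (X : Sm S) : Function.Injective ((cohSections R m X).map φ) :=
    telescope_sum_injective (cohSections R m X) hdesc hext hφ (hgen' m X)
  -- Since `1 - shift` is injective on cohomology in all degrees, the cohomology of its cone `G` is
  -- the cokernel of `1 - shift`, which the telescope computation identifies with the cohomology of
  -- `B`.
  have : IsIso γ := isIso_of_cohSections γ fun m X => by
    obtain ⟨K, hK⟩ := hK m
    obtain ⟨h1, h2⟩ := telescope_sum_exact (cohSections R m X) hφ hβ hφβ (hgen' m X) K
      fun k hk => bijective_cohSections (b k) m (hK k hk) X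
    have h3 (x : (cohSections R m X).obj Z) : (cohSections R m X).map γ
        ((cohSections R m X).map g x) = (cohSections R m X).map β x := by
      rw [← ConcreteCategory.comp_apply, ← Functor.map_comp, hγ]
    refine ⟨(injective_iff_map_eq_zero _).2 fun x hx => ?_, fun y => ?_⟩
    · obtain ⟨x, rfl⟩ := coh_surjective ht m X (hinj (m + 1) X) x
      obtain ⟨z, rfl⟩ := h2 x ((h3 x).symm.trans hx)
      change (cohSections R m X).map g ((cohSections R m X).map φ z) = 0
      rw [← ConcreteCategory.comp_apply, ← Functor.map_comp]
      have : φ ≫ g = 0 := comp_distTriang_mor_zero₁₂ _ ht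
      rw [this, Functor.map_zero]
      rfl
    · obtain ⟨x, rfl⟩ := h1 y
      exact ⟨_, h3 x⟩
  exact hQ.of_iso (asIso γ) (hQ.ext₃ ht hQZ hQZ)

/-- `B` is the fibre of `1 - shift` on the product of the `G k`. Eventual constancy in each degree
makes `1 - shift` surjective on cohomology, so no `lim¹` term appears. -/
theorem IsThickWithProducts.prop_of_telescope {Q : ObjectProperty (Minus (Pre R))}
    (hQ : IsThickWithProducts.{u} Q) {B : Minus (Pre R)} {G : ℕ → Minus (Pre R)}
    (g : ∀ k, G (k + 1) ⟶ G k) (a : ∀ k, B ⟶ G k) (ha : ∀ k, a (k + 1) ≫ g k = a k)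
    (n : ℤ) (hn : ∀ k, (G k).obj.IsLE n) (hG : ∀ k, Q (G k))
    (hK : ∀ m, ∃ K, ∀ k ≥ K, IsIso ((homologyFunctor (Pre R) m).map (a k).hom)) : Q B := by
  obtain ⟨Z, π', ⟨hZ⟩, -, hlim⟩ := exists_product (J := ULift.{u} ℕ) (fun k => G k.down) n
    fun k => hn _
  have hQZ : Q Z := hQ.prop_of_isLimit hZ fun k => hG _
  let π (k : ℕ) : Z ⟶ G k := π' ⟨k⟩
  have hlift {Y : Minus (Pre R)} (g : ∀ k, Y ⟶ G k) : ∃ h : Y ⟶ Z, ∀ k, h ≫ π k = g k :=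
    ⟨Fan.IsLimit.lift hZ fun k => g k.down,
      fun k => Fan.IsLimit.fac hZ (fun k => g k.down) ⟨k⟩⟩
  have hext {Y : Minus (Pre R)} (g h : Y ⟶ Z) (H : ∀ k, g ≫ π k = h ≫ π k) : g = h :=
    Fan.IsLimit.hom_ext hZ _ _ fun k => H k.down
  have hl (m : ℤ) (X : Sm S) := isLimitFanMkObjOfIsLimit (ev R X) _ _ (hlim m).some
  have hinj (m : ℤ) (X : Sm S) (x y : (cohSections R m X).obj Z) (h : ∀ k,
      (cohSections R m X).map (π k) x = (cohSections R m X).map (π k) y) : x = y :=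
    Concrete.isLimit_ext _ (hl m X) x y fun k => h k.as.down
  have hsurj (m : ℤ) (X : Sm S) (v : ∀ k, (cohSections R m X).obj (G k)) :
      ∃ x : (cohSections R m X).obj Z, ∀ k, (cohSections R m X).map (π k) x = v k := by
    -- A family of elements is a family of maps from `ℤ`, to which the universal property of the
    -- product applies.
    let q (k : ULift.{u} ℕ) : AddCommGrpCat.of (ULift.{u} ℤ) ⟶ (cohSections R m X).obj (G k.down) :=
      AddCommGrpCat.ofHom ((zmultiplesHom _ (v k.down)).comp AddEquiv.ulift.toAddMonoidHom)
    let one : AddCommGrpCat.of (ULift.{u} ℤ) := ULift.up (1 : ℤ)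
    let p : _ ⟶ (cohSections R m X).obj Z := Fan.IsLimit.lift (hl m X) q
    refine ⟨p one, fun k => ?_⟩
    have h1 := congrArg (fun f => AddCommGrpCat.Hom.hom f one)
      (Fan.IsLimit.fac (hl m X) q ⟨k⟩)
    exact h1.trans (one_zsmul (v k))
  obtain ⟨φ, hφ⟩ := hlift fun k => π k - π (k + 1) ≫ g k
  obtain ⟨α, hα⟩ := hlift a
  have hαφ : α ≫ φ = 0 := hext _ _ fun k => by
    rw [Category.assoc, hφ, Preadditive.comp_sub, ← Category.assoc, hα, hα, ha, sub_self, zero_comp]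
  obtain ⟨F, i, δ, ht⟩ := distinguished_cocone_triangle₁ φ
  obtain ⟨γ, hγ⟩ : ∃ γ : B ⟶ F, α = γ ≫ i := Triangle.coyoneda_exact₂ _ ht α hαφ
  have hs (m : ℤ) (X : Sm S) : Function.Surjective ((cohSections R m X).map φ) := by
    obtain ⟨K, hK⟩ := hK m
    exact telescope_prod_surjective (cohSections R m X) ha hφ (hinj m X) (hsurj m X) K
      fun k hk => bijective_cohSections (a k) m (hK k hk) X
  have : IsIso γ := isIso_of_cohSections γ fun m X => by
    obtain ⟨K, hK⟩ := hK m
    obtain ⟨h1, h2⟩ := telescope_prod_exact (cohSections R m X) ha hφ hα (hinj m X) K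
      fun k hk => bijective_cohSections (a k) m (hK k hk) X
    have h3 (x : (cohSections R m X).obj B) : (cohSections R m X).map i
        ((cohSections R m X).map γ x) = (cohSections R m X).map α x := by
      rw [← ConcreteCategory.comp_apply, ← Functor.map_comp, hγ]
    have h4 : Function.Injective ((cohSections R m X).map i) := by
      have := coh_injective ht (m - 1) X (hs (m - 1) X)
      rw [sub_add_cancel] at this
      exact this
    refine ⟨fun x y hxy => h1 (by rw [← h3, ← h3, hxy]), fun y => ?_⟩
    obtain ⟨x, hx⟩ := h2 ((cohSections R m X).map i y) (by
      have : i ≫ φ = 0 := comp_distTriang_mor_zero₁₂ _ ht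
      rw [← ConcreteCategory.comp_apply, ← Functor.map_comp, this, Functor.map_zero]
      rfl)
    exact ⟨x, h4 ((h3 x).trans hx)⟩
  exact hQ.of_iso (asIso γ).symm (hQ.ext₁ ht hQZ hQZ)

theorem isLE_of_triangle₁ {t : Triangle (Minus (Pre R))} (ht : t ∈ distTriang _) (n : ℤ)
    (h₂ : t.obj₂.obj.IsLE n) (h₃ : t.obj₃.obj.IsLE n) : t.obj₁.obj.IsLE (n + 1) := by
  rw [isLE_iff]
  intro i hi
  obtain ⟨j, rfl⟩ : ∃ j, i = j + 1 := ⟨i - 1, by lia⟩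
  exact (HomologySequence.exact₁ _ (Minus.ι.map_distinguished t ht) j (j + 1) rfl).isZero_of_both_zeros
    ((isZero_of_isLE t.obj₃.obj n j (by lia)).eq_of_src _ _)
    ((isZero_of_isLE t.obj₂.obj n (j + 1) (by lia)).eq_of_tgt _ _)

theorem isLE_of_triangle₃ {t : Triangle (Minus (Pre R))} (ht : t ∈ distTriang _) (n : ℤ)
    (h₁ : t.obj₁.obj.IsLE n) (h₂ : t.obj₂.obj.IsLE n) : t.obj₃.obj.IsLE n := by
  rw [isLE_iff]
  intro i hi
  exact (HomologySequence.exact₃ _ (Minus.ι.map_distinguished t ht) i (i + 1) rfl).isZero_of_both_zeros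
    ((isZero_of_isLE t.obj₂.obj n i (by lia)).eq_of_src _ _)
    ((isZero_of_isLE t.obj₁.obj n (i + 1) (by lia)).eq_of_tgt _ _)

/-- Objects which can be peeled off from above by objects of a thick subcategory with direct sums
belong to it. -/
theorem IsThickWithSums.of_filtration {Q : ObjectProperty (Minus (Pre R))}
    (hQ : IsThickWithSums.{u} Q) (Pn : ℤ → ObjectProperty (Minus (Pre R)))
    (hLE : ∀ n B, Pn n B → B.obj.IsLE n)
    (hPn : ∀ n B, Pn n B → ∃ (P B' : Minus (Pre R)) (f : P ⟶ B) (g : B ⟶ B') (δ : B' ⟶ P⟦(1 : ℤ)⟧),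
      Triangle.mk f g δ ∈ distTriang _ ∧ Q P ∧ Pn (n - 1) B') (n : ℤ) : Pn n ≤ Q := by
  intro B hB
  have := hQ.isTriangulated
  let Stage (k : ℕ) := {X : Minus (Pre R) // Pn (n - k) X}
  have step (k : ℕ) (X : Stage k) : ∃ (Y : Stage (k + 1)) (r : X.1 ⟶ Y.1), Q.trW r := by
    obtain ⟨P, B', f, g, δ, ht, hP, hB'⟩ := hPn _ _ X.2
    refine ⟨⟨B', ?_⟩, g, ObjectProperty.trW.mk' Q ht hP⟩
    rwa [Nat.cast_succ, ← sub_sub]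
  choose nxt r hr using step
  let St (k : ℕ) : Stage k := Nat.rec ⟨B, by simpa using hB⟩ nxt k
  let c (k : ℕ) : B ⟶ (St k).1 := Nat.rec (motive := fun k => B ⟶ (St k).1) (𝟙 B)
    (fun k c => c ≫ r k (St k)) k
  -- `trW` consists of the morphisms with cone in `Q`. It is stable under composition, so the fibre
  -- `F k` of `B ⟶ St k` is in `Q`; these fibres form the telescope converging to `B`.
  have hc (k : ℕ) : Q.trW (c k) := by
    induction k with
    | zero => exact Q.trW.id_mem B
    | succ k hk => exact Q.trW.comp_mem _ _ hk (hr k (St k))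
  choose F b δ ht hF using fun k => (ObjectProperty.trW_iff' Q _).1 (hc k)
  have hf (k : ℕ) : ∃ f : F k ⟶ F (k + 1), b k = f ≫ b (k + 1) := by
    refine Triangle.coyoneda_exact₂ _ (ht (k + 1)) (b k) ?_
    change b k ≫ c k ≫ r k (St k) = 0
    have : b k ≫ c k = 0 := comp_distTriang_mor_zero₁₂ _ (ht k)
    rw [← Category.assoc, this, zero_comp]
  choose f hf using hf
  have hSt (k : ℕ) : (St k).1.obj.IsLE (n - k) := hLE _ _ (St k).2
  -- A fibre of objects bounded by `n` may have cohomology in degree `n + 1`. The map `F k ⟶ B` is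
  -- an isomorphism on `H^m` once `St k` has no cohomology in degrees `m - 1` and `m`, for which `k
  -- ≥ n - m + 3` is ample.
  refine hQ.prop_of_telescope f b (fun k => (hf k).symm) (n + 1)
    (fun k => isLE_of_triangle₁ (ht k) n (hLE n B hB) ?_) hF fun m => ⟨(n - m + 3).toNat, fun k hk => ?_⟩
  · rw [isLE_iff]
    exact fun i hi => isZero_of_isLE (St k).1.obj (n - k) i (by lia)
  · have ht' := Minus.ι.map_distinguished _ (ht k)
    have h1 : Mono ((homologyFunctor (Pre R) (m - 1 + 1)).map (b k).hom) :=
      (HomologySequence.mono_homologyMap_mor₁_iff _ ht' (m - 1) (m - 1 + 1) rfl).2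
        ((isZero_of_isLE (St k).1.obj (n - k) (m - 1) (by lia)).eq_of_src _ _)
    have h2 : Epi ((homologyFunctor (Pre R) m).map (b k).hom) :=
      (HomologySequence.epi_homologyMap_mor₁_iff _ ht' m).2
        ((isZero_of_isLE (St k).1.obj (n - k) m (by lia)).eq_of_tgt _ _)
    rw [sub_add_cancel] at h1
    exact isIso_of_mono_of_epi _

/-- Objects whose upper layers belong to a thick subcategory with products belong to it. -/
theorem IsThickWithProducts.of_filtration {Q : ObjectProperty (Minus (Pre R))}
    (hQ : IsThickWithProducts.{u} Q) (Pn : ℤ → ObjectProperty (Minus (Pre R)))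
    (hLE : ∀ n B, Pn n B → B.obj.IsLE n)
    (hPn : ∀ n B, Pn n B → ∃ (B' P : Minus (Pre R)) (f : B' ⟶ B) (g : B ⟶ P) (δ : P ⟶ B'⟦(1 : ℤ)⟧),
      Triangle.mk f g δ ∈ distTriang _ ∧ Q P ∧ Pn (n - 1) B') (n : ℤ) : Pn n ≤ Q := by
  intro B hB
  have := hQ.isTriangulated
  let Stage (k : ℕ) := {X : Minus (Pre R) // Pn (n - k) X}
  have step (k : ℕ) (X : Stage k) : ∃ (Y : Stage (k + 1)) (r : Y.1 ⟶ X.1), Q.trW r := by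
    obtain ⟨B', P, f, g, δ, ht, hP, hB'⟩ := hPn _ _ X.2
    refine ⟨⟨B', ?_⟩, f, ObjectProperty.trW.mk Q ht hP⟩
    rwa [Nat.cast_succ, ← sub_sub]
  choose nxt r hr using step
  let St (k : ℕ) : Stage k := Nat.rec ⟨B, by simpa using hB⟩ nxt k
  let c (k : ℕ) : (St k).1 ⟶ B := Nat.rec (motive := fun k => (St k).1 ⟶ B) (𝟙 B)
    (fun k c => r k (St k) ≫ c) k
  have hc (k : ℕ) : Q.trW (c k) := by
    induction k with
    | zero => exact Q.trW.id_mem B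
    | succ k hk => exact Q.trW.comp_mem _ _ (hr k (St k)) hk
  -- The cones `G k` of `St k ⟶ B` play the role of truncations of `B`, whose limit is `B`.
  choose G a δ ht hG using fun k => (ObjectProperty.trW_iff Q _).1 (hc k)
  have hg (k : ℕ) : ∃ g : G (k + 1) ⟶ G k, a k = a (k + 1) ≫ g := by
    refine Triangle.yoneda_exact₂ _ (ht (k + 1)) (a k) ?_
    change (r k (St k) ≫ c k) ≫ a k = 0
    have : c k ≫ a k = 0 := comp_distTriang_mor_zero₁₂ _ (ht k)
    rw [Category.assoc, this, comp_zero]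
  choose g hg using hg
  have hSt (k : ℕ) : (St k).1.obj.IsLE (n - k) := hLE _ _ (St k).2
  refine hQ.prop_of_telescope g a (fun k => (hg k).symm) n
    (fun k => isLE_of_triangle₃ (ht k) n ?_ (hLE n B hB)) hG fun m => ⟨(n - m + 3).toNat, fun k hk => ?_⟩
  · rw [isLE_iff]
    exact fun i hi => isZero_of_isLE (St k).1.obj (n - k) i (by lia)
  · have ht' := Minus.ι.map_distinguished _ (ht k)
    have h1 : Mono ((homologyFunctor (Pre R) m).map (a k).hom) :=
      (HomologySequence.mono_homologyMap_mor₂_iff _ ht' m).2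
        ((isZero_of_isLE (St k).1.obj (n - k) m (by lia)).eq_of_src _ _)
    have h2 : Epi ((homologyFunctor (Pre R) m).map (a k).hom) :=
      (HomologySequence.epi_homologyMap_mor₂_iff _ ht' m (m + 1) rfl).2
        ((isZero_of_isLE (St k).1.obj (n - k) (m + 1) (by lia)).eq_of_tgt _ _)
    exact isIso_of_mono_of_epi _

end

end A1Motives

/-! ### Objects in one degree and truncation triangles -/

namespace DerivedCategory

noncomputable section

variable {C : Type*} [Category* C] [Abelian C] [HasDerivedCategory.{w} C]

open Pretriangulated TStructure

variable (C) in
/-- An object of an abelian category as an object of `D⁻` in a given degree. -/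
def singleMinus (n : ℤ) : C ⥤ Minus C :=
  ObjectProperty.lift _ (singleFunctor C n) fun X =>
    ⟨n, (inferInstance : ((singleFunctor C n).obj X).IsLE n)⟩

instance (F : C) (n : ℤ) : ((singleMinus C n).obj F).obj.IsLE n :=
  (inferInstance : ((singleFunctor C n).obj F).IsLE n)

instance (F : C) (n : ℤ) : ((singleMinus C n).obj F).obj.IsGE n :=
  (inferInstance : ((singleFunctor C n).obj F).IsGE n)

/-- The shift of an object placed in one degree. -/
def singleMinusShift (F : C) (n : ℤ) :
    ((singleMinus C n).obj F)⟦n⟧ ≅ (singleMinus C 0).obj F :=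
  ObjectProperty.isoMk _ ((Minus.ι.commShiftIso n).app ((singleMinus C n).obj F) ≪≫
    ((singleFunctors C).shiftIso n 0 n (add_zero n)).app F)

theorem isGE_of_retract {X Y : DerivedCategory C} (r : Retract X Y) (n : ℤ) [Y.IsGE n] :
    X.IsGE n := by
  rw [isGE_iff]
  intro i hi
  have h := r.map (homologyFunctor C i)
  have h0 := isZero_of_isGE Y n i hi
  exact (IsZero.iff_id_eq_zero _).2 (h.retract.symm.trans
    ((h0.eq_of_tgt h.i 0 =≫ h.r).trans zero_comp))

/-- The homology of an object placed in one degree. -/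
def homologySingleMinus (F : C) (n : ℤ) :
    (homologyFunctor C n).obj ((singleMinus C n).obj F).obj ≅ F :=
  (singleFunctorCompHomologyFunctorIso C n).app F

/-- The truncation triangle of an object of `D^{≤ n}`. -/
theorem exists_triangle_single (B : Minus C) (n : ℤ) (hB : B.obj.IsLE n) :
    ∃ (B' : Minus C) (F : C) (f : B' ⟶ B) (g : B ⟶ (singleMinus C n).obj F)
      (δ : (singleMinus C n).obj F ⟶ B'⟦(1 : ℤ)⟧), Triangle.mk f g δ ∈ distTriang _ ∧
        B'.obj.IsLE (n - 1) ∧ IsIso ((homologyFunctor C n).map g.hom) := by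
  obtain ⟨X, Y, hX, hY, f, g, δ, ht⟩ := t.exists_triangle B.obj (n - 1) n (by lia)
  have : X.IsLE (n - 1) := ⟨hX⟩
  have : Y.IsGE n := ⟨hY⟩
  have : Y.IsLE n := by
    rw [isLE_iff]
    intro i hi
    exact (HomologySequence.exact₃ _ ht i (i + 1) rfl).isZero_of_both_zeros
      ((isZero_of_isLE B.obj n i (by lia)).eq_of_src _ _)
      ((isZero_of_isLE X (n - 1) (i + 1) (by lia)).eq_of_tgt _ _)
  obtain ⟨F, ⟨e⟩⟩ := exists_iso_singleFunctor_obj_of_isGE_of_isLE Y n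
  have hg : IsIso ((homologyFunctor C n).map g) := by
    have : Mono ((homologyFunctor C n).map g) :=
      (HomologySequence.mono_homologyMap_mor₂_iff _ ht n).2
        ((isZero_of_isLE X (n - 1) n (by lia)).eq_of_src _ _)
    have : Epi ((homologyFunctor C n).map g) :=
      (HomologySequence.epi_homologyMap_mor₂_iff _ ht n (n + 1) rfl).2
        ((isZero_of_isLE X (n - 1) (n + 1) (by lia)).eq_of_tgt _ _)
    exact isIso_of_mono_of_epi _
  let g' : B ⟶ (singleMinus C n).obj F := ObjectProperty.homMk (g ≫ e.hom)
  have hg' : IsIso ((homologyFunctor C n).map g'.hom) := by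
    change IsIso ((homologyFunctor C n).map (g ≫ e.hom))
    rw [Functor.map_comp]
    infer_instance
  -- The fibre is formed afresh inside `D⁻`, and its bound is read off the long exact sequence: `g'`
  -- is an isomorphism on `H^n`, and its target has no other cohomology.
  obtain ⟨B', f', δ', ht'⟩ := distinguished_cocone_triangle₁ g'
  refine ⟨B', F, f', g', δ', ht', ?_, hg'⟩
  rw [isLE_iff]
  intro i hi
  obtain ⟨j, rfl⟩ : ∃ j, i = j + 1 := ⟨i - 1, by lia⟩
  have ht'' := Minus.ι.map_distinguished _ ht'
  by_cases hj : n < j + 1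
  · by_cases hj' : n < j
    · exact (HomologySequence.exact₁ _ ht'' j (j + 1) rfl).isZero_of_both_zeros
        ((isZero_of_isLE ((singleMinus C n).obj F).obj n j hj').eq_of_src _ _)
        ((isZero_of_isLE B.obj n (j + 1) (by lia)).eq_of_tgt _ _)
    · obtain rfl : j = n := by lia
      have h1 : Epi ((homologyFunctor C j).map g'.hom) := inferInstance
      exact (HomologySequence.exact₁ _ ht'' j (j + 1) rfl).isZero_of_both_zeros
        ((HomologySequence.epi_homologyMap_mor₂_iff _ ht'' j (j + 1) rfl).1 h1)
        ((isZero_of_isLE B.obj j (j + 1) (by lia)).eq_of_tgt _ _)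
  · obtain rfl : j + 1 = n := by lia
    have h1 : Mono ((homologyFunctor C (j + 1)).map g'.hom) := inferInstance
    exact (HomologySequence.exact₁ _ ht'' j (j + 1) rfl).isZero_of_both_zeros
      ((isZero_of_isGE ((singleMinus C (j + 1)).obj F).obj (j + 1) j (by lia)).eq_of_src _ _)
      ((HomologySequence.mono_homologyMap_mor₂_iff _ ht'' (j + 1)).1 h1)

end

end DerivedCategory

/-! ### Generation of the invariant part -/

namespace A1Motives

noncomputable section

variable {S : Scheme.{u}} (R : Ringoid S) [HasDerivedCategory.{w} (Pre R)]

open DerivedCategory Pretriangulated TStructure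

theorem a1Inv_singleMinus (n : ℤ) {F : Pre R} (hF : IsHomotopyInvariant R F) :
    a1Inv R ((singleMinus (Pre R) n).obj F) := by
  refine (a1Inv_iff R _).2 fun m => ?_
  by_cases h : m = n
  · subst h
    exact (IsHomotopyInvariant R).prop_of_iso (homologySingleMinus F m).symm hF
  · refine (IsHomotopyInvariant R).prop_of_isZero ?_
    by_cases h' : m < n
    · exact isZero_of_isGE ((singleMinus (Pre R) n).obj F).obj n m h'
    · exact isZero_of_isLE ((singleMinus (Pre R) n).obj F).obj n m (by lia)

theorem presheavesIn_le_a1Inv : presheavesIn R (IsHomotopyInvariant R) ≤ a1Inv R := by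
  rintro A ⟨F, hF, ⟨e⟩⟩
  exact (a1Inv R).prop_of_iso
    (ObjectProperty.isoMk _ e.symm : (singleMinus (Pre R) 0).obj F ≅ A) (a1Inv_singleMinus R 0 hF)

variable {R} in
theorem IsThick.prop_singleMinus {Q : ObjectProperty (Minus (Pre R))} (hQ : IsThick Q)
    {P : ObjectProperty (Pre R)} (hP : presheavesIn R P ≤ Q) {F : Pre R} (hF : P F) (n : ℤ) :
    Q ((singleMinus (Pre R) n).obj F) :=
  hQ.of_shift n (hP _ ⟨F, hF, ⟨Minus.ι.mapIso (singleMinusShift F n)⟩⟩)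

/-- The piece split off by truncation is the top cohomology presheaf, homotopy invariant by
assumption; the rest is invariant by two out of three. -/
theorem exists_triangle_a1Inv (n : ℤ) (B : Minus (Pre R)) (hB : a1Inv R B) (hn : B.obj.IsLE n) :
    ∃ (B' : Minus (Pre R)) (F : Pre R) (f : B' ⟶ B) (g : B ⟶ (singleMinus (Pre R) n).obj F)
      (δ : (singleMinus (Pre R) n).obj F ⟶ B'⟦(1 : ℤ)⟧), Triangle.mk f g δ ∈ distTriang _ ∧
        IsHomotopyInvariant R F ∧ a1Inv R B' ∧ B'.obj.IsLE (n - 1) := by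
  obtain ⟨B', F, f, g, δ, ht, hB', hg⟩ := exists_triangle_single B n hn
  have hF : IsHomotopyInvariant R F := (IsHomotopyInvariant R).prop_of_iso
    (asIso ((homologyFunctor (Pre R) n).map g.hom) ≪≫ homologySingleMinus F n)
    ((a1Inv_iff R _).1 hB n)
  exact ⟨B', F, f, g, δ, ht, hF, (isThick_a1Inv R).ext₁ ht hB (a1Inv_singleMinus R n hF), hB'⟩

/-- Peeling off top cohomology keeps one in the invariant part, so every invariant object is a
homotopy limit of iterated extensions of shifted homotopy invariant presheaves. -/
theorem a1Inv_eq_thickProductClosure :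
    a1Inv R = thickProductClosure.{u} (presheavesIn R (IsHomotopyInvariant R)) := by
  refine le_antisymm (fun A hA Q hQ hP => ?_) fun A hA =>
    hA _ (isThickWithProducts_a1Inv R) (presheavesIn_le_a1Inv R)
  obtain ⟨n, hn⟩ := exists_isLE A
  refine hQ.of_filtration (fun n B => a1Inv R B ∧ B.obj.IsLE n) (fun _ _ h => h.2)
    (fun n B hB => ?_) n A ⟨hA, hn⟩
  obtain ⟨B', F, f, g, δ, ht, hF, h⟩ := exists_triangle_a1Inv R n B hB.1 hB.2
  exact ⟨B', _, f, g, δ, ht, hQ.prop_singleMinus hP hF n, h⟩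

theorem isThick_bounded : IsThick (t.bounded.inverseImage (Minus.ι (C := Pre R))) where
  isTriangulated := inferInstance
  isStableUnderRetracts := ⟨fun {X Y} r h => by
    obtain ⟨⟨a, ha⟩, b, hb⟩ := h
    have : Y.obj.IsGE a := ha
    have : Y.obj.IsLE b := hb
    exact ⟨⟨a, isGE_of_retract (r.map Minus.ι) a⟩, b,
      isLE_of_retract (r.map Minus.ι) b⟩⟩

/-- An invariant object with bounded cohomology is reached by finitely many truncation triangles:
induction on the length of the cohomological range, with no telescope needed. -/
theorem triangEnvelope_iff (A : Minus (Pre R)) :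
    (presheavesIn R (IsHomotopyInvariant R)).triangEnvelope A ↔
      a1Inv R A ∧ t.bounded A.obj := by
  constructor
  · intro hA
    have h1 := (isThick_a1Inv R)
    have h2 := (isThick_bounded R)
    have := h1.isTriangulated
    have := h1.isStableUnderRetracts
    have := h2.isTriangulated
    have := h2.isStableUnderRetracts
    refine ⟨(ObjectProperty.triangEnvelope_le_iff _).2 (presheavesIn_le_a1Inv R) _ hA,
      (ObjectProperty.triangEnvelope_le_iff (presheavesIn R (IsHomotopyInvariant R))
        (Q := t.bounded.inverseImage (Minus.ι (C := Pre R)))).2 ?_ _ hA⟩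
    rintro A ⟨F, hF, ⟨e⟩⟩
    refine t.bounded.prop_of_iso e.symm ⟨⟨0, ?_⟩, 0, ?_⟩
    · exact (inferInstance : ((singleFunctor (Pre R) 0).obj F).IsGE 0)
    · exact (inferInstance : ((singleFunctor (Pre R) 0).obj F).IsLE 0)
  · rintro ⟨hA, ⟨a, ha⟩, -⟩
    have hQ : IsThick (presheavesIn R (IsHomotopyInvariant R)).triangEnvelope :=
      have : (presheavesIn R (IsHomotopyInvariant R)).Nonempty :=
        ⟨_, _, (IsHomotopyInvariant R).prop_zero, ⟨Iso.refl ((singleMinus (Pre R) 0).obj _).obj⟩⟩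
      ⟨inferInstance, inferInstance⟩
    obtain ⟨n, hn⟩ := exists_isLE A
    -- `d` bounds the number of degrees from `a` to `n`; for `d = 0` the range is empty and the
    -- object is zero.
    obtain ⟨d, hd⟩ : ∃ d : ℕ, n ≤ a - 1 + d := ⟨(n - a + 1).toNat, by lia⟩
    induction d generalizing A n with
    | zero =>
      have hA0 : IsZero A := by
        have h (i : ℤ) : IsZero ((homologyFunctor (Pre R) i).obj A.obj) := by
          have : A.obj.IsGE a := ha
          by_cases hi : i < a
          · exact isZero_of_isGE A.obj a i hi
          · exact isZero_of_isLE A.obj n i (by lia)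
        have h0 : IsIso (0 : A.obj ⟶ A.obj) := (isIso_iff _ _).2 fun i =>
          (h i).isIso (h i) _
        have h1 : IsZero A.obj := (IsZero.iff_id_eq_zero _).2
          ((IsIso.hom_inv_id (0 : A.obj ⟶ A.obj)).symm.trans zero_comp)
        exact (IsZero.iff_id_eq_zero _).2 (Minus.ι.map_injective (h1.eq_of_src _ _))
      have := hQ.isTriangulated
      have := hQ.isClosedUnderIsomorphisms
      exact ObjectProperty.prop_of_isZero _ hA0
    | succ d hd' =>
      obtain ⟨B', F, f, g, δ, ht, hF, hB', hn'⟩ := exists_triangle_a1Inv R n A hA hn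
      by_cases hna : a ≤ n
      · refine hQ.ext₂ ht (hd' B' hB' ?_ (n - 1) hn' (by lia))
          (hQ.prop_singleMinus (ObjectProperty.le_triangEnvelope _) hF n)
        have : A.obj.IsGE a := ha
        have ht' := Minus.ι.map_distinguished _ ht
        have : B'.obj.IsGE a := by
          rw [isGE_iff]
          intro i hi
          obtain ⟨j, rfl⟩ : ∃ j, i = j + 1 := ⟨i - 1, by lia⟩
          exact (HomologySequence.exact₁ _ ht' j (j + 1) rfl).isZero_of_both_zeros
            ((isZero_of_isGE ((singleMinus _ n).obj F).obj n j (by lia)).eq_of_src _ _)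
            ((isZero_of_isGE A.obj a (j + 1) (by lia)).eq_of_tgt _ _)
        exact this
      · exact hd' A hA ha n hn (by lia)

end

end A1Motives

/-! ### Triangles in `D⁻` from short exact sequences -/

namespace DerivedCategory

variable {C : Type*} [Category* C] [Abelian C] [HasDerivedCategory.{w} C]

open Pretriangulated

/-- The triangle in `D⁻` attached to a short exact sequence of complexes. -/
theorem exists_triangle_of_shortExact_of_hom {T : ShortComplex (CochainComplex C ℤ)}
    (hT : T.ShortExact) {P B : Minus C} (e₁ : P.obj ≅ Q.obj T.X₁) (e₂ : B.obj ≅ Q.obj T.X₂)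
    (f : P ⟶ B) (hf : f.hom ≫ e₂.hom = e₁.hom ≫ Q.map T.f) :
    ∃ (B' : Minus C) (g : B ⟶ B') (δ : B' ⟶ P⟦(1 : ℤ)⟧),
      Triangle.mk f g δ ∈ distTriang _ ∧ Nonempty (B'.obj ≅ Q.obj T.X₃) := by
  obtain ⟨B', g, δ, h⟩ := distinguished_cocone_triangle f
  exact ⟨B', g, δ, h, ⟨Triangle.π₃.mapIso (isoTriangleOfIso₁₂ _ _
    (Minus.ι.map_distinguished _ h) (triangleOfSES_distinguished hT) e₁ e₂ hf)⟩⟩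

theorem exists_triangle_of_shortExact {T : ShortComplex (CochainComplex C ℤ)} (hT : T.ShortExact)
    {P B : Minus C} (e₁ : P.obj ≅ Q.obj T.X₁) (e₂ : B.obj ≅ Q.obj T.X₂) :
    ∃ (B' : Minus C) (f : P ⟶ B) (g : B ⟶ B') (δ : B' ⟶ P⟦(1 : ℤ)⟧),
      Triangle.mk f g δ ∈ distTriang _ ∧ Nonempty (B'.obj ≅ Q.obj T.X₃) :=
  ⟨_, _, (exists_triangle_of_shortExact_of_hom hT e₁ e₂
    (ObjectProperty.homMk (e₁.hom ≫ Q.map T.f ≫ e₂.inv)) (by simp)).choose_spec⟩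

end DerivedCategory

namespace A1Motives

noncomputable section

variable {S : Scheme.{u}} (R : Ringoid S)

/-! ### Contractible presheaves -/

instance : (IsContractiblePresheaf R).IsClosedUnderIsomorphisms where
  of_iso {F G} e := by
    rintro ⟨h, h0, h1⟩
    refine ⟨e.inv ≫ h ≫ (ihom R _).map e.hom, ?_, ?_⟩
    · rw [Category.assoc, Category.assoc, ihom_map_section, reassoc_of% h0, e.inv_hom_id]
    · rw [Category.assoc, Category.assoc, ihom_map_section, reassoc_of% h1, zero_comp, comp_zero]

variable {R}

theorem IsContractiblePresheaf.of_isZero {F : Pre R} (hF : IsZero F) :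
    IsContractiblePresheaf R F :=
  ⟨0, hF.eq_of_src _ _, hF.eq_of_src _ _⟩

variable [HasDerivedCategory.{w} (Pre R)]

open DerivedCategory Pretriangulated HomologicalComplex

theorem isContractibleObject_of_hom {A : Minus (Pre R)} {K : CochainComplex (Pre R) ℤ}
    (e : A.obj ≅ Q.obj K) (h : K ⟶ (ihomC R (affineLine S)).obj K)
    (h0 : h ≫ sectionC (affineLinePoint S 0) K = 𝟙 K)
    (h1 : h ≫ sectionC (affineLinePoint S 1) K = 0) : IsContractibleObject R A := by
  have key (a : Γ(S, ⊤)) (φ : K ⟶ K) (hφ : h ≫ sectionC (affineLinePoint S a) K = φ) :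
      (e.hom ≫ Q.map h ≫ (derivedIhomQ R K).inv ≫ (derivedIhom R).map e.inv) ≫
        (derivedSection R a).app A.obj = e.hom ≫ Q.map φ ≫ e.inv := by
    have h2 := (derivedSection R a).naturality e.inv
    rw [derivedSection_app_Q] at h2
    rw [Category.assoc, Category.assoc, Category.assoc]
    refine e.hom ≫= (Q.map h ≫= ((derivedIhomQ R K).inv ≫= h2)).trans ?_
    refine (Q.map h ≫= ((derivedIhomQ R K).inv ≫= Category.assoc _ _ _)).trans ?_
    refine (Q.map h ≫= Iso.inv_hom_id_assoc (derivedIhomQ R K) _).trans ?_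
    refine (Category.assoc _ _ _).symm.trans ?_
    exact congrArg (· ≫ e.inv) ((Q.map_comp _ _).symm.trans (congrArg Q.map hφ))
  refine ⟨_, (key 0 _ h0).trans ?_, (key 1 _ h1).trans ?_⟩
  · simp
  · simp

/-- The contraction of the presheaf is a morphism of one-term complexes, so its identities hold
before localization. -/
theorem isContractibleObject_single {F : Pre R} (hF : IsContractiblePresheaf R F) (n : ℤ)
    {A : Minus (Pre R)} (e : A.obj ≅ Q.obj ((single (Pre R) (.up ℤ) n).obj F)) :
    IsContractibleObject R A := by
  obtain ⟨h, h0, h1⟩ := (IsContractiblePresheaf R).prop_of_iso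
    (singleObjXSelf (.up ℤ) n F).symm hF
  let K := (single (Pre R) (.up ℤ) n).obj F
  obtain ⟨g, hg⟩ : ∃ g : K ⟶ (ihomC R (affineLine S)).obj K, g.f n = h :=
    ⟨mkHomFromSingle ((singleObjXSelf (.up ℤ) n F).inv ≫ h) fun k hk =>
      ((ihom R _).map_isZero (isZero_single_obj_X (.up ℤ) n F k
        (by have : n + 1 = k := hk; lia))).eq_of_tgt _ _,
      (mkHomFromSingle_f _ _).trans (Iso.hom_inv_id_assoc _ _)⟩
  refine isContractibleObject_of_hom e g ?_ ?_
  · exact from_single_hom_ext ((hg =≫ _).trans h0)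
  · exact from_single_hom_ext ((hg =≫ _).trans h1)

/-- Removing the top term of a bounded above complex. -/
theorem exists_shortExact_single {C : Type*} [Category* C] [Abelian C]
    (K : CochainComplex C ℤ) (n : ℤ) [K.IsStrictlyLE n] :
    ∃ (T : ShortComplex (CochainComplex C ℤ)) (_ : T.ShortExact),
      T.X₁ = (single C (.up ℤ) n).obj (K.X n) ∧ T.X₂ = K ∧ IsZero (T.X₃.X n) ∧
        ∀ i, i ≠ n → Nonempty (T.X₃.X i ≅ K.X i) := by
  have hz (i : ℤ) (hi : n < i) : IsZero (K.X i) := K.isZero_of_isStrictlyLE n i hi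
  -- Because `K` vanishes above degree `n`, its top term placed in degree `n` is a subcomplex.
  obtain ⟨f, hf⟩ : ∃ f : (single C (.up ℤ) n).obj (K.X n) ⟶ K,
      f.f n = (singleObjXSelf (.up ℤ) n (K.X n)).hom :=
    ⟨mkHomFromSingle (𝟙 _) fun k hk => (hz k (by have : n + 1 = k := hk; lia)).eq_of_tgt _ _,
      (mkHomFromSingle_f _ _).trans (Category.comp_id _)⟩
  have h1 (i : ℤ) (hi : i ≠ n) : IsZero (((single C (.up ℤ) n).obj (K.X n)).X i) :=
    isZero_single_obj_X _ _ _ _ hi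
  have hm (i : ℤ) : Mono (f.f i) := by
    by_cases hi : i = n
    · subst hi
      rw [hf]
      infer_instance
    · exact ⟨fun _ _ _ => (h1 i hi).eq_of_tgt _ _⟩
  have : Mono f := HomologicalComplex.mono_of_mono_f f hm
  refine ⟨ShortComplex.mk f (cokernel.π f) (cokernel.condition f),
    { exact := ShortComplex.exact_cokernel f
      mono_f := this
      epi_g := inferInstanceAs (Epi (cokernel.π f)) }, rfl, rfl, ?_, fun i hi => ⟨?_⟩⟩
  · refine IsZero.of_iso ?_ (PreservesCokernel.iso (eval C (.up ℤ) n) f)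
    have : Epi ((eval C (.up ℤ) n).map f) := by
      change Epi (f.f n)
      rw [hf]
      infer_instance
    exact isZero_cokernel_of_epi _
  · refine PreservesCokernel.iso (eval C (.up ℤ) i) f ≪≫ ?_
    exact cokernelIsoOfEq ((h1 i hi).eq_of_src _ 0) ≪≫ cokernelZeroIsoTarget

/-- The brutal filtration peels off one term at a time: each top term is a contractible object, and
the quotient is again a complex with contractible terms, one degree lower. -/
theorem a1Contr_of_contractible_terms {B : Minus (Pre R)} {K : CochainComplex (Pre R) ℤ}
    (e : B.obj ≅ Q.obj K) (n : ℤ) [K.IsStrictlyLE n]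
    (hK : ∀ i, IsContractiblePresheaf R (K.X i)) : a1Contr R B := by
  refine (isThickWithSums_a1Contr R).of_filtration (fun n B =>
    ∃ K : CochainComplex (Pre R) ℤ, K.IsStrictlyLE n ∧ (∀ i, IsContractiblePresheaf R (K.X i)) ∧
      Nonempty (B.obj ≅ Q.obj K)) ?_ ?_ n B ⟨K, inferInstance, hK, ⟨e⟩⟩
  · rintro n B ⟨K, hK, -, ⟨e⟩⟩
    exact isLE_of_retract (Retract.ofIso e) n
  · rintro n B ⟨K, hK, hc, ⟨e⟩⟩
    obtain ⟨T, hT, hT1, rfl, hz, hi⟩ := exists_shortExact_single K n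
    obtain ⟨e₁⟩ : Nonempty (((singleMinus (Pre R) n).obj (T.X₂.X n)).obj ≅ Q.obj T.X₁) := by
      rw [hT1]
      exact ⟨(singleFunctorIsoCompQ (Pre R) n).app _⟩
    obtain ⟨B', f, g, δ, ht, ⟨e₃⟩⟩ := exists_triangle_of_shortExact hT e₁ e
    refine ⟨_, B', f, g, δ, ht, le_thickSumClosure _ _
      (isContractibleObject_single (hc n) n (e₁ ≪≫ eqToIso (by rw [hT1]))),
      T.X₃, ?_, fun i => ?_, ⟨e₃⟩⟩
    · rw [CochainComplex.isStrictlyLE_iff]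
      intro i h
      by_cases h' : i = n
      · exact h' ▸ hz
      · exact (T.X₂.isZero_of_isStrictlyLE n i (by lia)).of_iso (hi i h').some
    · by_cases h' : i = n
      · exact .of_isZero (h' ▸ hz)
      · exact (IsContractiblePresheaf R).prop_of_iso (hi i h').some.symm (hc i)

end

end A1Motives

namespace A1Motives

noncomputable section

variable (S : Scheme.{u})

/-! ### Smallness of the category of smooth schemes -/

theorem exists_small_affine : ∃ (s : Type u) (o : s → Over S), ∀ Z : Over S, IsAffine Z.left →
    LocallyOfFiniteType Z.hom → ∃ x, Nonempty (Z ≅ o x) := by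
  let P : MorphismProperty Scheme.{u} := @LocallyOfFiniteType

  have : P.RespectsIso := (HasRingHomProperty.eq_affineLocally (P := P)) ▸
    affineLocally_respectsIso _ RingHom.finiteType_respectsIso
  have : EssentiallySmall.{u} (P.CostructuredArrow ⊤ Scheme.Spec S) :=
    essentiallySmall_costructuredArrow_Spec P le_rfl
  let e := equivSmallModel.{u} (P.CostructuredArrow ⊤ Scheme.Spec S)
  let F := MorphismProperty.CostructuredArrow.toOver P Scheme.Spec S ⋙
    MorphismProperty.Over.forget P ⊤ S
  refine ⟨_, fun x => F.obj (e.inverse.obj x), fun Z hZ hZ' => ?_⟩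
  -- An affine scheme is replaced by the spectrum of its global functions, which places it in an
  -- essentially small category.
  let W : P.CostructuredArrow ⊤ Scheme.Spec S :=
    MorphismProperty.CostructuredArrow.mk ⊤ (A := op Γ(Z.left, ⊤)) (Z.left.isoSpec.inv ≫ Z.hom)
      (P.comp_mem _ _ inferInstance hZ')
  refine ⟨e.functor.obj W, ⟨?_ ≪≫ F.mapIso (e.unitIso.app W)⟩⟩
  exact Over.isoMk Z.left.isoSpec (Iso.hom_inv_id_assoc _ _)

/-- The combinatorial data needed to glue finitely many schemes out of a given family. -/
structure GluingDatum {s : Type u} (o : s → Over S) : Type u where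
  /-- The number of charts. -/
  n : ℕ
  /-- The charts. -/
  U : Fin n → s
  /-- The intersections of the charts. -/
  V : Fin n → Fin n → s
  /-- The first inclusion. -/
  fst : ∀ i j, o (V i j) ⟶ o (U i)
  /-- The second inclusion. -/
  snd : ∀ i j, o (V i j) ⟶ o (U j)

variable {S}

/-- A scheme is glued from a datum. -/
structure IsGluing {s : Type u} {o : s → Over S} (d : GluingDatum S o) (X : Over S)
    (p : ∀ i, o (d.U i) ⟶ X) : Prop where
  isOpenImmersion : ∀ i, IsOpenImmersion (p i).left
  covers : ∀ x : X.left, ∃ i y, (p i).left y = x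
  isPullback : ∀ i j, IsPullback (d.fst i j).left (d.snd i j).left (p i).left (p j).left

namespace IsGluing

variable {s : Type u} {o : s → Over S} {d : GluingDatum S o} {X Y : Over S}
  {p : ∀ i, o (d.U i) ⟶ X} {q : ∀ i, o (d.U i) ⟶ Y}

/-- The open cover attached to a gluing. -/
def cover (h : IsGluing d X p) : X.left.OpenCover :=
  Scheme.Cover.mkOfCovers (Fin d.n) (fun i => (o (d.U i)).left) (fun i => (p i).left)
    h.covers h.isOpenImmersion

theorem hom_ext (h : IsGluing d X p) {Z : Over S} {f g : X ⟶ Z} (hfg : ∀ i, p i ≫ f = p i ≫ g) :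
    f = g := by
  ext1
  exact h.cover.hom_ext _ _ fun i => congrArg CommaMorphism.left (hfg i)

/-- The charts of `Y` agree on the overlaps of the charts of `X`, because both sets of overlaps are
given by the same data; so they glue. -/
theorem exists_hom (h : IsGluing d X p) (h' : IsGluing d Y q) :
    ∃ f : X ⟶ Y, ∀ i, p i ≫ f = q i := by
  have hq (i j : Fin d.n) : pullback.fst (p i).left (p j).left ≫ (q i).left =
      pullback.snd (p i).left (p j).left ≫ (q j).left := by
    rw [← (h.isPullback i j).isoPullback_inv_fst, ← (h.isPullback i j).isoPullback_inv_snd,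
      Category.assoc, Category.assoc, (h'.isPullback i j).w]
  have hf (i : Fin d.n) : (p i).left ≫ h.cover.glueMorphisms (fun i => (q i).left) hq =
    (q i).left := h.cover.ι_glueMorphisms (fun i => (q i).left) hq i
  refine ⟨Over.homMk (h.cover.glueMorphisms (fun i => (q i).left) hq) ?_, fun i => ?_⟩
  · refine h.cover.hom_ext _ _ fun i => ?_
    exact (Category.assoc _ _ _).symm.trans
      ((hf i =≫ Y.hom).trans ((Over.w (q i)).trans (Over.w (p i)).symm))
  · ext1
    exact hf i

theorem nonempty_iso (h : IsGluing d X p) (h' : IsGluing d Y q) : Nonempty (X ≅ Y) := by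
  obtain ⟨f, hf⟩ := h.exists_hom h'
  obtain ⟨g, hg⟩ := h'.exists_hom h
  exact ⟨f, g, h.hom_ext fun i => by simp [reassoc_of% hf, hg],
    h'.hom_ext fun i => by simp [reassoc_of% hg, hf]⟩

end IsGluing

/-- Compactness gives a finite affine cover, and separatedness makes the overlaps affine, so charts
and overlaps all come from the given family. -/
theorem exists_isGluing {s : Type u} (o : s → Over S) (ho : ∀ Z : Over S, IsAffine Z.left →
    LocallyOfFiniteType Z.hom → ∃ x, Nonempty (Z ≅ o x)) (X : Over S) [CompactSpace X.left]
    [X.left.IsSeparated] [LocallyOfFiniteType X.hom] :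
    ∃ (d : GluingDatum S o) (p : ∀ i, o (d.U i) ⟶ X), IsGluing d X p := by
  let 𝒰 := X.left.affineCover.finiteSubcover
  have hA (i : 𝒰.I₀) : IsAffine (𝒰.X i) :=
    inferInstanceAs (IsAffine (X.left.affineCover.X _))
  obtain ⟨n, ⟨e⟩⟩ := Finite.exists_equiv_fin 𝒰.I₀
  let u (i : Fin n) : Over S := Over.mk (𝒰.f (e.symm i) ≫ X.hom)
  have hu (i : Fin n) := ho (u i) (hA _) (inferInstanceAs (LocallyOfFiniteType (_ ≫ _)))
  choose U hU using hu
  let v (i j : Fin n) : Over S :=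
    Over.mk (pullback.fst (𝒰.f (e.symm i)) (𝒰.f (e.symm j)) ≫ (u i).hom)
  have hv (i j : Fin n) := ho (v i j) (by
    have : IsAffineHom (𝒰.f (e.symm j)) := .of_comp _ (terminal.from _)
    exact inferInstanceAs (IsAffine (pullback (𝒰.f (e.symm i)) (𝒰.f (e.symm j)))))
    (inferInstanceAs (LocallyOfFiniteType (_ ≫ _ ≫ _)))
  choose V hV using hv
  let eU (i : Fin n) : u i ≅ o (U i) := (hU i).some
  let eV (i j : Fin n) : v i j ≅ o (V i j) := (hV i j).some
  let a (i j : Fin n) : v i j ⟶ u i := Over.homMk (pullback.fst _ _) rfl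
  let b (i j : Fin n) : v i j ⟶ u j := Over.homMk (pullback.snd _ _)
    ((Category.assoc _ _ _).symm.trans
      ((pullback.condition.symm =≫ X.hom).trans (Category.assoc _ _ _)))
  let c (i : Fin n) : u i ⟶ X := Over.homMk (𝒰.f (e.symm i)) rfl
  have hab (i j : Fin n) : IsPullback (a i j).left (b i j).left (c i).left (c j).left :=
    IsPullback.of_hasPullback _ _
  refine ⟨⟨n, U, V, fun i j => (eV i j).inv ≫ a i j ≫ (eU i).hom,
    fun i j => (eV i j).inv ≫ b i j ≫ (eU j).hom⟩, fun i => (eU i).inv ≫ c i,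
    fun i => ?_, fun x => ?_, fun i j => ?_⟩
  · have : IsOpenImmersion (c i).left := inferInstanceAs (IsOpenImmersion (𝒰.f _))
    have : IsIso (eU i).inv.left := inferInstanceAs (IsIso ((Over.forget S).map (eU i).inv))
    exact inferInstanceAs (IsOpenImmersion ((eU i).inv.left ≫ (c i).left))
  · obtain ⟨i, y, hy⟩ := 𝒰.exists_eq x
    obtain ⟨i, rfl⟩ := e.symm.surjective i
    have h : (eU i).hom.left ≫ ((eU i).inv ≫ c i).left = 𝒰.f (e.symm i) :=
      congrArg CommaMorphism.left (Iso.hom_inv_id_assoc (eU i) (c i))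
    refine ⟨i, (eU i).hom.left y, Eq.trans ?_ hy⟩
    rw [← h]
    rfl
  · refine (hab i j).of_iso ((Over.forget S).mapIso (eV i j)) ((Over.forget S).mapIso (eU i))
      ((Over.forget S).mapIso (eU j)) (Iso.refl _) ?_ ?_ ?_ ?_
    all_goals simp

/-- A gluing datum determines the scheme up to isomorphism and lives in `Type u`. The hypotheses on
`S` make every smooth `S`-scheme of finite type compact and separated. -/
theorem exists_small_skeleton [IsNoetherian S] [S.IsSeparated] :
    ∃ (J : Type u) (X : J → Sm S), ∀ Y : Sm S, ∃ j, Nonempty (Y ≅ X j) := by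
  obtain ⟨s, o, ho⟩ := exists_small_affine S
  refine ⟨{ d : GluingDatum S o // ∃ (X : Sm S) (p : _), IsGluing d X.obj p }, fun d => d.2.choose,
    fun Y => ?_⟩
  have := Y.property.1.1
  have := Y.property.1.2
  have := Y.property.2
  have : CompactSpace Y.obj.left := QuasiCompact.compactSpace_of_compactSpace Y.obj.hom
  have : Y.obj.left.IsSeparated := ⟨by
    rw [← terminal.comp_from Y.obj.hom]
    infer_instance⟩
  obtain ⟨d, p, h⟩ := exists_isGluing o ho Y.obj
  refine ⟨⟨d, Y, p, h⟩, ?_⟩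
  obtain ⟨e⟩ := h.nonempty_iso (Exists.choose_spec (Exists.choose_spec
    (p := fun X : Sm S => ∃ p, IsGluing d X.obj p) ⟨Y, p, h⟩))
  exact ⟨ObjectProperty.isoMk _ e⟩

end

end A1Motives

/-! ### Lifting maps from projectives to the top cohomology -/

namespace DerivedCategory

variable {C : Type*} [Category* C] [Abelian C]

open HomologicalComplex in
-- Projectivity lifts `φ` to cycles, and a map to the top term of a complex is a map from the
-- one-term complex.
theorem exists_single_lift_homology (K : CochainComplex C ℤ) (n : ℤ) [K.IsStrictlyLE n]
    (P : C) [Projective P] (φ : P ⟶ K.homology n) :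
    ∃ f : (single C (.up ℤ) n).obj P ⟶ K,
      (singleObjHomologySelfIso (.up ℤ) n P).inv ≫ homologyMap f n = φ := by
  let ψ := Projective.factorThru φ (K.homologyπ n)
  have hψ : ψ ≫ K.homologyπ n = φ := Projective.factorThru_comp _ _
  obtain ⟨f, hf⟩ : ∃ f : (single C (.up ℤ) n).obj P ⟶ K,
      f.f n = (singleObjXSelf (.up ℤ) n P).hom ≫ ψ ≫ K.iCycles n :=
    ⟨mkHomFromSingle (ψ ≫ K.iCycles n) fun k hk => (K.isZero_of_isStrictlyLE n k
      (by have : n + 1 = k := hk; lia)).eq_of_tgt _ _, mkHomFromSingle_f _ _⟩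
  refine ⟨f, ?_⟩
  rw [← cancel_epi (singleObjCyclesSelfIso (.up ℤ) n P).hom,
    singleObjHomologySelfIso_hom_singleObjHomologySelfIso_inv_assoc, homologyπ_naturality, ← hψ,
    ← Category.assoc]
  refine congrArg (· ≫ K.homologyπ n) ?_
  rw [← cancel_mono (K.iCycles n), cyclesMap_i, hf]
  simp [singleObjCyclesSelfIso]

variable [HasDerivedCategory.{w} C]

theorem exists_singleMinus_lift (B : Minus C) (n : ℤ) (hB : B.obj.IsLE n) (P : C) [Projective P]
    (φ : P ⟶ (homologyFunctor C n).obj B.obj) :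
    ∃ (f : (singleMinus C n).obj P ⟶ B)
      (e : P ≅ (homologyFunctor C n).obj ((singleMinus C n).obj P).obj),
      e.hom ≫ (homologyFunctor C n).map f.hom = φ := by
  obtain ⟨K, hK, ⟨b⟩⟩ := exists_iso_mk B n hB
  let b' : B.obj ≅ Q.obj K := Minus.ι.mapIso b
  obtain ⟨f, hf⟩ := exists_single_lift_homology K n P
    (φ ≫ (homologyFunctor C n).map b'.hom ≫ (homologyQ K n).hom)
  let s : ((singleMinus C n).obj P).obj ≅
    Q.obj ((HomologicalComplex.single C (.up ℤ) n).obj P) := (singleFunctorIsoCompQ C n).app P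
  refine ⟨ObjectProperty.homMk (s.hom ≫ Q.map f ≫ b'.inv),
    (HomologicalComplex.singleObjHomologySelfIso (.up ℤ) n P).symm ≪≫ (homologyQ _ n).symm ≪≫
      (homologyFunctor C n).mapIso s.symm, ?_⟩
  change (_ ≫ _ ≫ (homologyFunctor C n).map s.inv) ≫
    (homologyFunctor C n).map (s.hom ≫ Q.map f ≫ b'.inv) = φ
  have h : (homologyFunctor C n).map (Q.map f) = (homologyQ _ n).hom ≫
      HomologicalComplex.homologyMap f n ≫ (homologyQ K n).inv := by
    rw [← Category.assoc, ← homologyQ_hom_naturality, Category.assoc, Iso.hom_inv_id,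
      Category.comp_id]
  rw [Functor.map_comp, Functor.map_comp, Category.assoc, Category.assoc,
    ← Functor.map_comp_assoc, s.inv_hom_id, CategoryTheory.Functor.map_id, Category.id_comp, h]
  simp only [Iso.symm_hom, Category.assoc, Iso.inv_hom_id_assoc]
  rw [reassoc_of% hf, Iso.hom_inv_id_assoc, ← Functor.map_comp, b'.hom_inv_id,
    CategoryTheory.Functor.map_id, Category.comp_id]

end DerivedCategory

namespace A1Motives

noncomputable section

variable {S : Scheme.{u}} {R : Ringoid S}

/-! ### Representable presheaves -/

/-- The universal section of `ℤ_tr(X)` over `X`. -/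
def graphSection {X Y : Sm S} (f : Y ⟶ X) : (ev R Y).obj ((Ztr R).obj ⟨X⟩) := R.graph f

theorem res_graphSection {X Y Z : Sm S} (f : Y ⟶ X) (g : Z ⟶ Y) :
    res ((Ztr R).obj ⟨X⟩) g (graphSection f) = graphSection (g ≫ f) :=
  (R.graph_comp g f).symm

theorem ev_map_Ztr {X Y Z : Sm S} (f : Y ⟶ X) (g : X ⟶ Z) :
    (ev R Y).map ((Ztr R).map ((graphFunctor R).map (X := X) (Y := Z) g)) (graphSection f) =
      graphSection (f ≫ g) :=
  (R.graph_comp f g).symm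

theorem map_res {F G : Pre R} (φ : F ⟶ G) {X Y : Sm S} (f : X ⟶ Y) (y : (ev R Y).obj F) :
    (ev R X).map φ (res F f y) = res G f ((ev R Y).map φ y) :=
  ConcreteCategory.congr_hom (φ.hom.naturality _) y

theorem Ztr_hom_ext {X : Sm S} {F : Pre R} {φ ψ : (Ztr R).obj ⟨X⟩ ⟶ F}
    (h : (ev R X).map φ (graphSection (𝟙 X)) = (ev R X).map ψ (graphSection (𝟙 X))) : φ = ψ := by
  refine pre_hom_ext fun Y => ?_
  ext (a : R.Hom Y X)
  -- Yoneda: a correspondence `a` is the restriction along itself of the universal section.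
  have key (χ : (Ztr R).obj ⟨X⟩ ⟶ F) : (ev R Y).map χ a =
      F.obj.map (Quiver.Hom.op (X := (⟨Y⟩ : Cor R)) (Y := ⟨X⟩) a)
        ((ev R X).map χ (graphSection (𝟙 X))) := by
    refine Eq.trans ?_ (ConcreteCategory.congr_hom
      (χ.hom.naturality (Quiver.Hom.op (X := (⟨Y⟩ : Cor R)) (Y := ⟨X⟩) a)) (graphSection (𝟙 X)))
    exact congrArg ((ev R Y).map χ) (R.comp_graph_id a).symm
  rw [key, key, h]

/-- Sections over `X` are morphisms from `ℤ_tr(X)`. -/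
theorem exists_Ztr_hom {X : Sm S} {F : Pre R} (x : (ev R X).obj F) :
    ∃ φ : (Ztr R).obj ⟨X⟩ ⟶ F, (ev R X).map φ (graphSection (𝟙 X)) = x := by
  have hF : F.obj.Additive := F.property
  have h0 (Y) : F.obj.map (0 : op ⟨X⟩ ⟶ Y) x = 0 := by rw [Functor.map_zero]; rfl
  have h1 (Y) (a b : (op ⟨X⟩ : (Cor R)ᵒᵖ) ⟶ Y) : F.obj.map (a + b) x = F.obj.map a x + F.obj.map b x := by
    rw [Functor.map_add]; rfl
  refine ⟨ObjectProperty.homMk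
    { app Y := AddCommGrpCat.ofHom
        { toFun (a : Y.unop ⟶ (⟨X⟩ : Cor R)) := F.obj.map a.op x
          map_zero' := h0 Y
          map_add' a b := h1 Y a.op b.op }
      naturality Y Z f := by
        ext (a : Y.unop ⟶ (⟨X⟩ : Cor R))
        exact ConcreteCategory.congr_hom (F.obj.map_comp a.op f) x }, ?_⟩
  exact ConcreteCategory.congr_hom (F.obj.map_id (op ⟨X⟩)) x

/-- Maps out are sections over `X`, and epimorphisms of presheaves are surjective on sections. -/
instance (X : Sm S) : Projective ((Ztr R).obj ⟨X⟩) where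
  factors {E G} f e _ := by
    obtain ⟨x, hx⟩ := sections_surjective e X ((ev R X).map f (graphSection (𝟙 X)))
    obtain ⟨φ, hφ⟩ := exists_Ztr_hom x
    refine ⟨φ, Ztr_hom_ext ?_⟩
    rw [Functor.map_comp, ConcreteCategory.comp_apply, hφ, hx]

/-! ### The generators `ℤ_tr(X × 𝔸¹) / ℤ_tr(X)` -/

/-- The zero section of `X × 𝔸¹`. -/
def zeroSection (X : Sm S) : X ⟶ X ⊗ affineLine S :=
  lift (𝟙 X) (toUnit X ≫ affineLinePoint S 0)

/-- The presentation of `contrGen`. -/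
def contrGenπ (X : Sm S) : (Ztr R).obj ⟨X ⊗ affineLine S⟩ ⟶ contrGen R X :=
  cokernel.π ((Ztr R).map ((corSection R (affineLinePoint S 0)).app ⟨X⟩))

instance (X : Sm S) : Epi (contrGenπ (R := R) X) :=
  coequalizer.π_epi

/-- The inclusion of `ℤ_tr(X)` by the zero section. -/
def zeroSectionZtr (X : Sm S) : (Ztr R).obj ⟨X⟩ ⟶ (Ztr R).obj ⟨X ⊗ affineLine S⟩ :=
  (Ztr R).map ((graphFunctor R).map (X := X) (Y := X ⊗ affineLine S) (zeroSection X))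

theorem corSection_zero (X : Sm S) :
    (Ztr R).map ((corSection R (affineLinePoint S 0)).app ⟨X⟩) = zeroSectionZtr X :=
  congrArg (Ztr R).map (corSection_app R _ ⟨X⟩)

theorem zeroSectionZtr_contrGenπ (X : Sm S) :
    zeroSectionZtr X ≫ contrGenπ (R := R) X = 0 :=
  (corSection_zero X).symm =≫ _ |>.trans (cokernel.condition _)

theorem exists_contrGen_desc {X : Sm S} {F : Pre R} (φ : (Ztr R).obj ⟨X ⊗ affineLine S⟩ ⟶ F)
    (h : zeroSectionZtr X ≫ φ = 0) : ∃ ψ : contrGen R X ⟶ F, contrGenπ X ≫ ψ = φ :=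
  ⟨cokernel.desc _ φ ((corSection_zero X =≫ _).trans h), cokernel.π_desc _ _ _⟩

theorem exists_contrGen_hom {X : Sm S} {F : Pre R} (y : (ev R (X ⊗ affineLine S)).obj F)
    (h : res F (zeroSection X) y = 0) : ∃ ψ : contrGen R X ⟶ F,
      (ev R _).map (contrGenπ X ≫ ψ) (graphSection (𝟙 (X ⊗ affineLine S))) = y := by
  obtain ⟨φ, hφ⟩ := exists_Ztr_hom y
  obtain ⟨ψ, hψ⟩ := exists_contrGen_desc φ (Ztr_hom_ext (by
    rw [Functor.map_comp, ConcreteCategory.comp_apply, Functor.map_zero]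
    refine (congrArg ((ev R X).map φ) ((ev_map_Ztr (𝟙 X) (zeroSection X)).trans
      ((congrArg graphSection ((Category.id_comp _).trans (Category.comp_id _).symm)).trans
        (res_graphSection (𝟙 _) (zeroSection X)).symm))).trans ?_
    rw [map_res, hφ, h]
    rfl))
  exact ⟨ψ, hψ ▸ hφ⟩

instance (X : Sm S) : Projective (contrGen R X) where
  factors {E G} f e _ := by
    obtain ⟨r, hr⟩ : ∃ r : (Ztr R).obj ⟨X ⊗ affineLine S⟩ ⟶ (Ztr R).obj ⟨X⟩,
        zeroSectionZtr X ≫ r = 𝟙 _ :=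
      ⟨(Ztr R).map ((graphFunctor R).map (X := X ⊗ affineLine S) (Y := X) (fst _ _)),
        ((Ztr R).map_comp _ _).symm.trans ((congrArg (Ztr R).map
          (((graphFunctor R).map_comp _ _).symm.trans ((congrArg _ (lift_fst _ _)).trans
            ((graphFunctor R).map_id X)))).trans ((Ztr R).map_id _))⟩
    let g := Projective.factorThru (contrGenπ X ≫ f) e
    have hg : g ≫ e = contrGenπ X ≫ f := Projective.factorThru_comp _ _
    -- The zero section is split by the projection. Subtracting the part of the lift carried by
    -- `ℤ_tr(X)` makes it vanish there without changing its image in `G`.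
    obtain ⟨ψ, hψ⟩ := exists_contrGen_desc (g - r ≫ zeroSectionZtr X ≫ g) (by
      rw [Preadditive.comp_sub, reassoc_of% hr, sub_self])
    refine ⟨ψ, ?_⟩
    rw [← cancel_epi (contrGenπ X), reassoc_of% hψ, Preadditive.sub_comp, Category.assoc,
      Category.assoc, hg, reassoc_of% (zeroSectionZtr_contrGenπ (R := R) X), zero_comp, comp_zero,
      sub_zero]

/-- The section of `contrGen` given by a morphism to `X × 𝔸¹`. -/
def contrGenSection {X Y : Sm S} (f : Y ⟶ X ⊗ affineLine S) : (ev R Y).obj (contrGen R X) :=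
  (ev R Y).map (contrGenπ X) (graphSection f)

theorem res_contrGenSection {X Y Z : Sm S} (f : Y ⟶ X ⊗ affineLine S) (g : Z ⟶ Y) :
    res (contrGen R X) g (contrGenSection f) = contrGenSection (g ≫ f) :=
  (map_res _ _ _).symm.trans (congrArg _ (res_graphSection f g))

theorem contrGenSection_zeroSection {X Y : Sm S} (f : Y ⟶ X) :
    contrGenSection (R := R) (f ≫ zeroSection X) = 0 := by
  refine (congrArg ((ev R Y).map (contrGenπ X)) (ev_map_Ztr f (zeroSection X)).symm).trans ?_
  exact (ConcreteCategory.congr_hom ((ev R Y).map_comp (zeroSectionZtr X) (contrGenπ X))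
    (graphSection f)).symm.trans
      (by rw [zeroSectionZtr_contrGenπ, Functor.map_zero]; rfl)

theorem contrGen_hom_ext {X : Sm S} {F : Pre R} {φ ψ : contrGen R X ⟶ F}
    (h : (ev R _).map φ (contrGenSection (𝟙 (X ⊗ affineLine S))) =
      (ev R _).map ψ (contrGenSection (𝟙 (X ⊗ affineLine S)))) : φ = ψ := by
  rw [← cancel_epi (contrGenπ X)]
  exact Ztr_hom_ext h

/-- The contraction is `(x, t, s) ↦ (x, t (1 - s))`: it preserves the zero section, is the identity
at `s = 0`, and at `s = 1` lands in the zero section, which is zero in the quotient. -/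
theorem isContractiblePresheaf_contrGen (X : Sm S) :
    IsContractiblePresheaf R (contrGen R X) := by
  let c : (X ⊗ affineLine S) ⊗ affineLine S ⟶ X ⊗ affineLine S := (α_ X (affineLine S) (affineLine S)).hom ≫ X ◁ lineContract S
  have hc {Y : Sm S} (f : Y ⟶ (X ⊗ affineLine S) ⊗ affineLine S) : f ≫ c =
      lift (f ≫ fst _ _ ≫ fst _ _) (lift (f ≫ fst _ _ ≫ snd _ _) (f ≫ snd _ _) ≫
        lineContract S) := by
    have h : f ≫ (α_ X (affineLine S) (affineLine S)).hom ≫ snd _ _ = lift (f ≫ fst _ _ ≫ snd _ _) (f ≫ snd _ _) := by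
      ext1 <;> simp
    ext1
    · rw [lift_fst]
      simp [c]
    · simp only [c, Category.assoc, whiskerLeft_snd, lift_snd]
      rw [reassoc_of% h]
  obtain ⟨h, hh⟩ := exists_contrGen_hom (F := (ihom R (affineLine S)).obj (contrGen R X))
    (contrGenSection c : (ev R ((X ⊗ affineLine S) ⊗ affineLine S)).obj (contrGen R X)) (by
      rw [res_ihom]
      refine (res_contrGenSection c _).trans ((congrArg contrGenSection ?_).trans
        (contrGenSection_zeroSection (fst X (affineLine S))))
      rw [hc]
      ext1
      · simp [zeroSection]
      · refine toLine_ext ?_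
        rw [lift_snd, globMap_lineContract]
        simp [zeroSection])
  have hs (x : 𝟙_ (Sm S) ⟶ affineLine S) : (ev R _).map (h ≫ (ihomSection R x).app (contrGen R X))
      (contrGenSection (𝟙 (X ⊗ affineLine S))) = contrGenSection (lift (𝟙 _) (toUnit _ ≫ x) ≫ c) := by
    rw [Functor.map_comp, ConcreteCategory.comp_apply, ev_map_ihomSection]
    exact (congrArg (fun z : (ev R ((X ⊗ affineLine S) ⊗ affineLine S)).obj (contrGen R X) =>
      res (contrGen R X) (lift (𝟙 _) (toUnit _ ≫ x)) z) hh).trans (res_contrGenSection _ _)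
  refine ⟨h, contrGen_hom_ext ((hs _).trans ?_), contrGen_hom_ext ((hs _).trans ?_)⟩
  · rw [CategoryTheory.Functor.map_id]
    refine congrArg contrGenSection ?_
    rw [hc]
    ext1
    · simp
    · refine toLine_ext ?_
      rw [lift_snd, globMap_lineContract]
      simp
  · rw [Functor.map_zero]
    refine (congrArg contrGenSection ?_).trans (contrGenSection_zeroSection (fst X (affineLine S)))
    rw [hc]
    ext1
    · simp [zeroSection]
    · refine toLine_ext ?_
      rw [lift_snd, globMap_lineContract]
      simp [zeroSection]

end

end A1Motives

/-! ### Generation of the contractible part -/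

namespace A1Motives

noncomputable section

variable {S : Scheme.{u}} (R : Ringoid S)

/-- A presheaf without nonzero homotopy invariant quotients is generated by the images of the
presheaves `contrGen R X`. -/
theorem exists_contrGen_section {H : Pre R}
    (hH : ∀ (G : Pre R) (f : H ⟶ G), IsHomotopyInvariant R G → f = 0)
    {J : Type u} {X : J → Sm S} (hX : ∀ Y : Sm S, ∃ j, Nonempty (Y ≅ X j)) (Y : Sm S)
    (z : (ev R Y).obj H) : ∃ (j : J) (y : (ev R (X j ⊗ affineLine S)).obj H),
      res H (zeroSection (X j)) y = 0 ∧ ∀ ψ : contrGen R (X j) ⟶ H,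
        (ev R _).map (contrGenπ (X j) ≫ ψ) (graphSection (𝟙 (X j ⊗ affineLine S))) = y →
          z ∈ Set.range ((ev R Y).map ψ) := by
  obtain ⟨j, ⟨e⟩⟩ := hX Y
  -- The cokernel of `s₀ - s₁` is a homotopy invariant quotient of `H`, hence zero.
  have he : Epi ((ihomSection R (affineLinePoint S 0)).app H -
      (ihomSection R (affineLinePoint S 1)).app H) :=
    Preadditive.epi_of_cokernel_zero (hH _ _ (isHomotopyInvariant_cokernel H))
  obtain ⟨t, ht'⟩ : ∃ t : (ev R (X j ⊗ affineLine S)).obj H,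
      res H (zeroSection (X j)) t -
        res H (lift (𝟙 _) (toUnit (X j) ≫ affineLinePoint S 1)) t = res H e.inv z := by
    obtain ⟨t, ht⟩ := sections_surjective ((ihomSection R (affineLinePoint S 0)).app H -
      (ihomSection R (affineLinePoint S 1)).app H) (X j) (res H e.inv z)
    refine ⟨t, ?_⟩
    rw [zeroSection, ← ev_map_ihomSection, ← ev_map_ihomSection]
    exact ht
  let t0 := res H (zeroSection (X j)) t
  -- Correcting by the pullback of `t|₀` makes the section vanish on the zero section, while its
  -- restriction to the section `1` is still `t|₀ - t|₁`, the given `z` transported along `e`.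
  refine ⟨j, res H (fst _ _) t0 - t, ?_, fun ψ hψ => ?_⟩
  · rw [map_sub, ← ConcreteCategory.comp_apply, ← res_comp]
    have : zeroSection (X j) ≫ fst _ _ = 𝟙 _ := lift_fst _ _
    rw [this, res_id]
    exact sub_self _
  have key : (ev R (X j)).map ψ
      (contrGenSection (lift (𝟙 (X j)) (toUnit _ ≫ affineLinePoint S 1))) = res H e.inv z := by
    have h1 : contrGenSection (R := R) (lift (𝟙 (X j)) (toUnit _ ≫ affineLinePoint S 1)) =
        res _ (lift (𝟙 (X j)) (toUnit _ ≫ affineLinePoint S 1)) (contrGenSection (𝟙 _)) := by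
      rw [res_contrGenSection, Category.comp_id]
    rw [h1, map_res]
    refine (congrArg _ hψ).trans ?_
    rw [map_sub, ← ConcreteCategory.comp_apply, ← res_comp, lift_fst, res_id]
    exact ht'
  refine ⟨res _ e.hom (contrGenSection (lift (𝟙 (X j)) (toUnit _ ≫ affineLinePoint S 1))), ?_⟩
  rw [map_res, key, ← ConcreteCategory.comp_apply, ← res_comp, e.hom_inv_id, res_id]
  rfl

variable [HasDerivedCategory.{w} (Pre R)]

open DerivedCategory Pretriangulated

/-- A map from the top cohomology to `G` is induced by a morphism from `B`, through its truncation,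
to `G` in degree `n`, which is an invariant object. -/
theorem eq_zero_of_leftOrthogonal {B : Minus (Pre R)} (hB : (a1Inv R).leftOrthogonal B) (n : ℤ)
    (hn : B.obj.IsLE n) (G : Pre R) (f : (homologyFunctor _ n).obj B.obj ⟶ G)
    (hG : IsHomotopyInvariant R G) : f = 0 := by
  obtain ⟨-, F, -, g, -, -, -, hg⟩ := exists_triangle_single B n hn
  let k : F ⟶ G := (homologySingleMinus F n).inv ≫ inv ((homologyFunctor _ n).map g.hom) ≫ f
  have h := hB (g ≫ (singleMinus _ n).map k) (a1Inv_singleMinus R n hG)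
  have h1 : (homologyFunctor _ n).map ((singleMinus _ n).map k).hom =
      (homologySingleMinus F n).hom ≫ k ≫ (homologySingleMinus G n).inv := by
    rw [← Category.assoc, Iso.eq_comp_inv]
    exact (singleFunctorCompHomologyFunctorIso (Pre R) n).hom.naturality k
  have h2 : (homologyFunctor _ n).map (g ≫ (singleMinus _ n).map k).hom = 0 := by
    rw [h]
    exact Functor.map_zero _ _ _
  rw [ObjectProperty.FullSubcategory.comp_hom, Functor.map_comp, h1] at h2
  simp only [k, Category.assoc, Iso.hom_inv_id_assoc, IsIso.hom_inv_id_assoc] at h2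
  rw [← cancel_mono (homologySingleMinus G n).inv, h2, zero_comp]

theorem presheavesIn_contrGen_le_a1Contr :
    (presheavesIn R fun F => ∃ X : Sm S, Nonempty (F ≅ contrGen R X)) ≤ a1Contr R := by
  rintro A ⟨F, ⟨X, ⟨e⟩⟩, ⟨e'⟩⟩
  exact le_thickSumClosure _ _ (isContractibleObject_single
    ((IsContractiblePresheaf R).prop_of_iso e.symm (isContractiblePresheaf_contrGen X)) 0
    (e' ≪≫ (singleFunctorIsoCompQ (Pre R) 0).app F))

/-- The top cohomology of `B` is covered by a sum of generators which lifts to a morphism from that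
sum, placed in degree `n`, to `B`. Its cone has cohomology only below degree `n` and stays in
`a1Contr`, so the procedure iterates. -/
theorem a1Contr_eq_thickSumClosure [IsNoetherian S] [S.IsSeparated] :
    a1Contr R = thickSumClosure.{u}
      (presheavesIn R fun F => ∃ X : Sm S, Nonempty (F ≅ contrGen R X)) := by
  refine le_antisymm (fun A hA Q hQ hP => ?_)
    (thickSumClosure_le (isThickWithSums_a1Contr R) (presheavesIn_contrGen_le_a1Contr R))
  obtain ⟨n, hn⟩ := exists_isLE A
  refine hQ.of_filtration (fun n B => a1Contr R B ∧ B.obj.IsLE n) (fun _ _ h => h.2)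
    (fun n B hB => ?_) n A ⟨hA, hn⟩
  obtain ⟨hB, hn⟩ := hB
  obtain ⟨J, X, hX⟩ := exists_small_skeleton (S := S)
  let H := (homologyFunctor (Pre R) n).obj B.obj
  -- All maps from all generators at once; the small skeleton keeps the index type in `Type u`.
  let I : Type u := Σ j : J,
    { y : (ev R (X j ⊗ affineLine S)).obj H // res H (zeroSection (X j)) y = 0 }
  choose ψ hψ using fun i : I => exists_contrGen_hom i.2.1 i.2.2
  choose f e hf using fun i : I => exists_singleMinus_lift B n hn _ (ψ i)
  obtain ⟨P, ι, ⟨hι⟩, hPn, -⟩ := exists_coproduct (fun i : I =>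
    (singleMinus (Pre R) n).obj (contrGen R (X i.1))) n fun i => inferInstance
  have hP' (Q' : ObjectProperty (Minus (Pre R))) (hQ' : IsThickWithSums.{u} Q')
      (h : (presheavesIn R fun F => ∃ X : Sm S, Nonempty (F ≅ contrGen R X)) ≤ Q') : Q' P :=
    hQ'.prop_of_isColimit hι fun i => hQ'.prop_singleMinus h ⟨_, ⟨Iso.refl _⟩⟩ n
  let g : P ⟶ B := Cofan.IsColimit.desc hι f
  have hg (i : I) : ι i ≫ g = f i := Cofan.IsColimit.fac hι f i
  obtain ⟨B', a, δ, ht⟩ := distinguished_cocone_triangle g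
  refine ⟨P, B', g, a, δ, ht, hP' Q hQ hP, (isThickWithSums_a1Contr R).ext₃ ht
    (hP' _ (isThickWithSums_a1Contr R) (presheavesIn_contrGen_le_a1Contr R)) hB, ?_⟩
  have hepi : Epi ((homologyFunctor (Pre R) n).map g.hom) := by
    refine epi_of_sections _ fun Y z => ?_
    obtain ⟨j, x, hx, h⟩ := exists_contrGen_section R
      (eq_zero_of_leftOrthogonal R (a1Contr_le_leftOrthogonal R _ hB) n hn) hX Y z
    let i : I := ⟨j, x, hx⟩
    obtain ⟨y, hy⟩ := h (ψ i) (hψ i)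
    refine ⟨(ev R Y).map ((e i).hom ≫ (homologyFunctor (Pre R) n).map (ι i).hom) y, ?_⟩
    rw [← ConcreteCategory.comp_apply, ← Functor.map_comp, Category.assoc, ← Functor.map_comp,
      ← ObjectProperty.FullSubcategory.comp_hom, hg, hf]
    exact hy
  have ht' := Minus.ι.map_distinguished _ ht
  have hB' : B'.obj.IsLE n := isLE_of_triangle₃ ht n hPn hn
  rw [isLE_iff]
  intro i hi
  by_cases hi' : i = n
  · subst hi'
    refine (HomologySequence.exact₃ _ ht' i (i + 1) rfl).isZero_of_both_zeros
      ((HomologySequence.epi_homologyMap_mor₁_iff _ ht' i).1 hepi)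
      ((isZero_of_isLE P.obj i (i + 1) (by lia)).eq_of_tgt _ _)
  · exact isZero_of_isLE B'.obj n i (by lia)

end

end A1Motives

/-! ### Total complexes of chain complexes of cochain complexes -/

namespace ChainComplex

noncomputable section

open ComplexShape HomologicalComplex

variable {C : Type*} [Category* C] [Abelian C]
  [∀ L : HomologicalComplex₂ C (up ℤ) (up ℤ), L.HasTotal (up ℤ)]

variable (A B : ChainComplex (CochainComplex C ℤ) ℕ)

/-- The total cochain complex of a chain complex of cochain complexes. -/
abbrev tot : CochainComplex C ℤ :=
  HomologicalComplex₂.total (A.extend embeddingDownNat) (up ℤ)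

theorem embeddingDownNat_f (i : ℕ) : embeddingDownNat.f i = -(i : ℤ) := rfl

/-- The inclusion of a summand of the total complex. -/
def ιTot (i : ℕ) (j n : ℤ) (h : n + i = j) : (A.X i).X j ⟶ (tot A).X n :=
  (A.extendXIso embeddingDownNat (embeddingDownNat_f i)).inv.f j ≫
    HomologicalComplex₂.ιTotal (A.extend embeddingDownNat) (up ℤ) (-(i : ℤ)) j n
      (by change -(i : ℤ) + j = n; lia)

variable {A B}

/-- The map induced on the total complexes. -/
abbrev totMap (f : A ⟶ B) : tot A ⟶ tot B :=
  HomologicalComplex₂.total.map (extendMap f embeddingDownNat) (up ℤ)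

theorem extendXIso_hom_ιTot (i : ℕ) (j n : ℤ) (h : n + i = j) (h') :
    (A.extendXIso embeddingDownNat (embeddingDownNat_f i)).hom.f j ≫ ιTot A i j n h =
      HomologicalComplex₂.ιTotal (A.extend embeddingDownNat) (up ℤ) (-(i : ℤ)) j n h' := by
  rw [ιTot, ← Category.assoc, ← comp_f, Iso.hom_inv_id, id_f, Category.id_comp]

theorem tot_hom_ext {n : ℤ} {Z : C} {f g : (tot A).X n ⟶ Z}
    (h : ∀ (i : ℕ) (j : ℤ) (h : n + i = j), ιTot A i j n h ≫ f = ιTot A i j n h ≫ g) : f = g := by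
  refine HomologicalComplex₂.total.hom_ext (up ℤ) fun p q hpq => ?_
  by_cases hp : ∃ i : ℕ, -(i : ℤ) = p
  · obtain ⟨i, rfl⟩ := hp
    have hq : n + i = q := by
      have : -(i : ℤ) + q = n := hpq
      lia
    rw [← extendXIso_hom_ιTot i q n hq, Category.assoc, Category.assoc, h]
  · exact ((eval C (up ℤ) q).map_isZero (A.isZero_extend_X embeddingDownNat p
      fun i hi => hp ⟨i, hi⟩)).eq_of_src _ _

open Classical in
/-- Morphisms from the terms of the total complex. -/
def totDesc {n : ℤ} {Z : C} (φ : ∀ (i : ℕ) (j : ℤ), n + i = j → ((A.X i).X j ⟶ Z)) :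
    (tot A).X n ⟶ Z :=
  HomologicalComplex₂.totalDesc (A.extend embeddingDownNat) fun p q hpq =>
    -- The row indexed by `i` sits in horizontal degree `-i`; in positive horizontal degrees the
    -- extended bicomplex is zero, so the value there is immaterial.
    if hp : ∃ i : ℕ, -(i : ℤ) = p then
      (A.extendXIso embeddingDownNat hp.choose_spec).hom.f q ≫ φ hp.choose q (by
        have h1 : p + q = n := hpq
        have := hp.choose_spec
        lia)
    else 0

@[simp]
theorem ι_totDesc {n : ℤ} {Z : C} (φ : ∀ (i : ℕ) (j : ℤ), n + i = j → ((A.X i).X j ⟶ Z))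
    (i : ℕ) (j : ℤ) (h : n + i = j) : ιTot A i j n h ≫ totDesc φ = φ i j h := by
  have key (i' : ℕ) (h' : -(i' : ℤ) = -(i : ℤ)) (h'' : n + i' = j) :
      (A.extendXIso embeddingDownNat (embeddingDownNat_f i)).inv.f j ≫
        (A.extendXIso embeddingDownNat (i := i') h').hom.f j ≫ φ i' j h'' = φ i j h := by
    obtain rfl : i' = i := by lia
    rw [← Category.assoc, ← comp_f, Iso.inv_hom_id, id_f, Category.id_comp]
  have hp : ∃ i' : ℕ, -(i' : ℤ) = -(i : ℤ) := ⟨i, rfl⟩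
  rw [ιTot, totDesc, Category.assoc, HomologicalComplex₂.ι_totalDesc, dif_pos hp]
  exact key _ _ _

theorem ιTot_map (f : A ⟶ B) (i : ℕ) (j n : ℤ) (h : n + i = j) :
    ιTot A i j n h ≫ (totMap f).f n = (f.f i).f j ≫ ιTot B i j n h := by
  have h1 := extendMap_f f embeddingDownNat (embeddingDownNat_f i)
  rw [ιTot, Category.assoc, HomologicalComplex₂.ιTotal_map, h1, comp_f, comp_f, Category.assoc,
    Category.assoc, ← Category.assoc, ← comp_f, Iso.inv_hom_id, id_f, Category.id_comp]
  rfl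

/-- The sign of the vertical differential of the total complex. -/
def totSign (i : ℕ) : ℤˣ := (-(i : ℤ)).negOnePow

@[simp]
theorem totSign_zero : totSign 0 = 1 := rfl

theorem totSign_succ (i : ℕ) : totSign (i + 1) = - totSign i := by
  rw [totSign, totSign, Int.negOnePow_neg, Int.negOnePow_neg, Nat.cast_succ, Int.negOnePow_succ]

theorem ιTot_D₂ (i : ℕ) (j n n' j' : ℤ) (h : n + i = j) (hn : n + 1 = n') (hj : j + 1 = j') :
    ιTot A i j n h ≫ HomologicalComplex₂.D₂ (A.extend embeddingDownNat) (up ℤ) n n' =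
      totSign i • (A.X i).d j j' ≫ ιTot A i j' n' (by lia) := by
  rw [ιTot, Category.assoc, HomologicalComplex₂.ι_D₂,
    HomologicalComplex₂.d₂_eq (A.extend embeddingDownNat) (up ℤ) (-(i : ℤ)) (i₂' := j') hj n'
      (by change -(i : ℤ) + j' = n'; lia), Linear.comp_units_smul, ← Category.assoc,
    Hom.comm, Category.assoc]
  rfl

theorem ιTot_zero_D₁ (j n n' : ℤ) (h : n + (0 : ℕ) = j) :
    ιTot A 0 j n h ≫ HomologicalComplex₂.D₁ (A.extend embeddingDownNat) (up ℤ) n n' = 0 := by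
  have hz : (A.extend embeddingDownNat).d (-(0 : ℕ)) 1 = 0 :=
    (A.isZero_extend_X embeddingDownNat 1
      fun i (hi : -(i : ℤ) = 1) => by lia).eq_of_tgt _ _
  rw [ιTot, Category.assoc, HomologicalComplex₂.ι_D₁,
    HomologicalComplex₂.d₁_eq' (A.extend embeddingDownNat) (up ℤ) (i₁' := 1) (by simp) j n', hz]
  simp

theorem ιTot_succ_D₁ (i : ℕ) (j n n' : ℤ) (h : n + (i + 1 : ℕ) = j) (hn : n + 1 = n') :
    ιTot A (i + 1) j n h ≫ HomologicalComplex₂.D₁ (A.extend embeddingDownNat) (up ℤ) n n' =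
      (A.d (i + 1) i).f j ≫ ιTot A i j n' (by push_cast at h; lia) := by
  rw [ιTot, Category.assoc, HomologicalComplex₂.ι_D₁,
    HomologicalComplex₂.d₁_eq (A.extend embeddingDownNat) (up ℤ) (i₁' := -(i : ℤ))
      (by change -((i + 1 : ℕ) : ℤ) + 1 = _; push_cast; lia) j n'
      (by change -(i : ℤ) + j = n'; push_cast at h; lia),
    A.extend_d_eq embeddingDownNat (embeddingDownNat_f (i + 1)) (embeddingDownNat_f i)]
  rw [comp_f, comp_f, Linear.comp_units_smul, Category.assoc, ← Category.assoc, ← comp_f,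
    Iso.inv_hom_id, id_f, Category.id_comp, Category.assoc]
  exact one_smul _ _

theorem ιTot_zero_d (j n n' j' : ℤ) (h : n + (0 : ℕ) = j) (hn : n + 1 = n') (hj : j + 1 = j') :
    ιTot A 0 j n h ≫ (tot A).d n n' = (A.X 0).d j j' ≫ ιTot A 0 j' n' (by lia) := by
  rw [HomologicalComplex₂.total_d, Preadditive.comp_add, ιTot_zero_D₁, zero_add,
    ιTot_D₂ 0 j n n' j' h hn hj, totSign_zero, one_smul]

theorem ιTot_succ_d (i : ℕ) (j n n' j' : ℤ) (h : n + (i + 1 : ℕ) = j) (hn : n + 1 = n')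
    (hj : j + 1 = j') :
    ιTot A (i + 1) j n h ≫ (tot A).d n n' =
      (A.d (i + 1) i).f j ≫ ιTot A i j n' (by push_cast at h; lia) +
        totSign (i + 1) • (A.X (i + 1)).d j j' ≫ ιTot A (i + 1) j' n' (by lia) := by
  rw [HomologicalComplex₂.total_d, Preadditive.comp_add, ιTot_succ_D₁ i j n n' h hn,
    ιTot_D₂ (i + 1) j n n' j' h hn hj]

end

end ChainComplex

/-! ### Homotopies and constant complexes -/

namespace ChainComplex

noncomputable section

open ComplexShape HomologicalComplex

variable {C : Type*} [Category* C] [Abelian C]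
  [∀ L : HomologicalComplex₂ C (up ℤ) (up ℤ), L.HasTotal (up ℤ)]

variable {A B : ChainComplex (CochainComplex C ℤ) ℕ}

/-- The components of the homotopy induced on total complexes. -/
def totHomotopyHom (h : ∀ i, A.X i ⟶ B.X (i + 1)) (m n : ℤ) (hmn : n + 1 = m) :
    (tot A).X m ⟶ (tot B).X n :=
  totDesc fun i j hj => (h i).f j ≫ ιTot B (i + 1) j n (by push_cast; lia)

@[simp]
theorem ι_totHomotopyHom (h : ∀ i, A.X i ⟶ B.X (i + 1)) (m n : ℤ) (hmn : n + 1 = m) (i : ℕ)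
    (j : ℤ) (hj : m + i = j) :
    ιTot A i j m hj ≫ totHomotopyHom h m n hmn =
      (h i).f j ≫ ιTot B (i + 1) j n (by push_cast; lia) :=
  ι_totDesc _ _ _ _

/-- A homotopy between maps of chain complexes of cochain complexes induces a homotopy between the
maps of total complexes. -/
def totHomotopy {f g : A ⟶ B} (h : Homotopy f g) : Homotopy (totMap f) (totMap g) where
  hom m n := if hmn : n + 1 = m then totHomotopyHom (fun i => h.hom i (i + 1)) m n hmn else 0
  zero m n hmn := dif_neg hmn
  comm n := by
    rw [dNext_eq _ (show (up ℤ).Rel n (n + 1) from rfl),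
      prevD_eq _ (show (up ℤ).Rel (n - 1) n by simp), dif_pos rfl, dif_pos (by lia)]
    refine tot_hom_ext fun i j hj => ?_
    have hn : n - 1 + 1 = n := by lia
    rw [Preadditive.comp_add, Preadditive.comp_add, ιTot_map, ιTot_map,
      ← Category.assoc _ (totHomotopyHom _ n (n - 1) hn), ι_totHomotopyHom, Category.assoc,
      ιTot_succ_d i j (n - 1) n (j + 1) (by push_cast; lia) hn rfl, Preadditive.comp_add]
    have hc := congrArg (fun φ => φ.f j) (h.comm i)
    rw [Homotopy.prevD_chainComplex] at hc
    -- The terms combining the homotopy with vertical differentials cancel, since consecutive rows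
    -- carry opposite signs; the horizontal ones give the original homotopy relation.
    cases i with
    | zero =>
      rw [Homotopy.dNext_zero_chainComplex, zero_add] at hc
      rw [hc, ← Category.assoc (ιTot A 0 j n hj),
        ιTot_zero_d j n (n + 1) (j + 1) hj rfl rfl, Category.assoc, ι_totHomotopyHom]
      simp [totSign_succ]
    | succ i =>
      rw [Homotopy.dNext_succ_chainComplex] at hc
      rw [hc, ← Category.assoc (ιTot A (i + 1) j n hj),
        ιTot_succ_d i j n (n + 1) (j + 1) hj rfl rfl, Preadditive.add_comp, Category.assoc,
        ι_totHomotopyHom, Linear.units_smul_comp, Category.assoc, ι_totHomotopyHom,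
        Linear.comp_units_smul, totSign_succ (i + 1)]
      simp only [add_f_apply, comp_f, Preadditive.add_comp, Category.assoc, Units.neg_smul,
        Hom.comm_assoc]
      abel

/-! ### The constant part of the total complex -/

/-- The inclusion of the zeroth row. -/
def totIncl {K : CochainComplex C ℤ} (f : K ⟶ A.X 0) : K ⟶ tot A where
  f n := f.f n ≫ ιTot A 0 n n (by simp)
  comm' n n' hn := by
    replace hn : n + 1 = n' := hn
    rw [Category.assoc, ιTot_zero_d n n n' n' (by simp) hn hn, Hom.comm_assoc]

/-- The projection of a term of the total complex to the zeroth row. -/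
def totProjHom (n : ℤ) : (tot A).X n ⟶ (A.X 0).X n :=
  totDesc fun i j hj => match i with
    | 0 => ((A.X 0).XIsoOfEq (show j = n by simpa using hj.symm)).hom
    | _ + 1 => 0

theorem ιTot_zero_totProjHom (n : ℤ) (h : n + (0 : ℕ) = n) :
    ιTot A 0 n n h ≫ totProjHom n = 𝟙 _ :=
  ι_totDesc _ _ _ _

theorem ιTot_succ_totProjHom (n : ℤ) (i : ℕ) (j : ℤ) (h : n + (i + 1 : ℕ) = j) :
    ιTot A (i + 1) j n h ≫ totProjHom n = 0 :=
  ι_totDesc _ _ _ _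

/-- The map from the total complex given by a map from the zeroth row. -/
def totProj {K : CochainComplex C ℤ} (f : A.X 0 ⟶ K) (hf : A.d 1 0 ≫ f = 0) : tot A ⟶ K where
  f n := totProjHom n ≫ f.f n
  comm' n n' hn := by
    replace hn : n + 1 = n' := hn
    refine tot_hom_ext fun i j hj => ?_
    match i with
    | 0 =>
      obtain rfl : j = n := by simpa using hj.symm
      rw [← Category.assoc, ← Category.assoc, ← Category.assoc, ← Category.assoc,
        ιTot_zero_totProjHom, ιTot_zero_d j j n' n' (by simp) hn hn,
        Category.assoc ((A.X 0).d j n'), ιTot_zero_totProjHom]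
      simp
    -- This row alone uses `hf`: its horizontal differential lands in row zero.
    | 1 =>
      rw [← Category.assoc, ← Category.assoc, ← Category.assoc, ← Category.assoc,
        ιTot_succ_totProjHom, ιTot_succ_d 0 j n n' (j + 1) hj hn rfl, Preadditive.add_comp,
        Linear.units_smul_comp, Category.assoc, Category.assoc ((A.X _).d _ _), ιTot_succ_totProjHom,
        Category.assoc]
      obtain rfl : j = n' := by
        have : n + 1 = j := hj
        lia
      rw [ιTot_zero_totProjHom]
      have := congrArg (fun φ => φ.f j) hf
      simp only [comp_f, zero_f] at this
      simp [this]
    | i + 2 =>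
      rw [← Category.assoc, ← Category.assoc, ← Category.assoc, ← Category.assoc,
        ιTot_succ_totProjHom, ιTot_succ_d (i + 1) j n n' (j + 1) hj hn rfl, Preadditive.add_comp,
        Linear.units_smul_comp, Category.assoc, Category.assoc ((A.X _).d _ _), ιTot_succ_totProjHom,
        Category.assoc, ιTot_succ_totProjHom]
      simp

theorem totIncl_totProj {K L : CochainComplex C ℤ} (f : K ⟶ A.X 0) (g : A.X 0 ⟶ L)
    (hg : A.d 1 0 ≫ g = 0) : totIncl f ≫ totProj g hg = f ≫ g := by
  ext n
  change (f.f n ≫ ιTot A 0 n n _) ≫ totProjHom n ≫ g.f n = f.f n ≫ g.f n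
  rw [Category.assoc, ← Category.assoc (ιTot A 0 n n _), ιTot_zero_totProjHom, Category.id_comp]

theorem totIncl_map {K : CochainComplex C ℤ} (f : K ⟶ A.X 0) (g : A ⟶ B) :
    totIncl f ≫ totMap g = totIncl (f ≫ g.f 0) := by
  ext n
  change (f.f n ≫ ιTot A 0 n n _) ≫ (totMap g).f n = (f.f n ≫ (g.f 0).f n) ≫ ιTot B 0 n n _
  rw [Category.assoc, ιTot_map, Category.assoc]

/-- The total complex of a complex concentrated in degree zero. -/
theorem isIso_totIncl {K : CochainComplex C ℤ} (f : K ⟶ A.X 0) [hf : IsIso f]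
    (hA : ∀ i, IsZero (A.X (i + 1))) : IsIso (totIncl f) := by
  have hd : A.d 1 0 ≫ inv f = 0 := (hA 0).eq_of_src _ _
  refine ⟨totProj (inv f) hd, by rw [totIncl_totProj, IsIso.hom_inv_id], ?_⟩
  ext n : 1
  refine tot_hom_ext fun i j hj => ?_
  match i with
  | 0 =>
    obtain rfl : j = n := by simpa using hj.symm
    change ιTot A 0 j j hj ≫ (totProjHom j ≫ (inv f).f j) ≫ f.f j ≫ ιTot A 0 j j _ = _ ≫ 𝟙 _
    rw [Category.assoc, ← Category.assoc (ιTot A 0 j j hj), ιTot_zero_totProjHom, Category.id_comp,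
      ← Category.assoc, ← comp_f, IsIso.inv_hom_id, id_f, Category.id_comp, Category.comp_id]
  | i + 1 => exact ((eval C (up ℤ) j).map_isZero (hA i)).eq_of_src _ _

/-- The alternating face map complex of a constant simplicial object. -/
abbrev constComplex (K : CochainComplex C ℤ) : ChainComplex (CochainComplex C ℤ) ℕ :=
  (AlgebraicTopology.alternatingFaceMapComplex _).obj ((SimplicialObject.const _).obj K)

theorem quasiIso_totMap (e : HomotopyEquiv A B) : QuasiIso (totMap e.hom) := by
  let e' : HomotopyEquiv (tot A) (tot B) :=
    { hom := totMap e.hom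
      inv := totMap e.inv
      homotopyHomInvId := (Homotopy.ofEq (by
        refine (HomologicalComplex₂.total.map_comp _ _ _).symm.trans ?_
        exact congrArg (fun φ => HomologicalComplex₂.total.map φ (up ℤ))
          (extendMap_comp e.hom e.inv embeddingDownNat).symm)).trans
        ((totHomotopy e.homotopyHomInvId).trans (Homotopy.ofEq (by
          refine (congrArg (fun φ => HomologicalComplex₂.total.map φ (up ℤ))
            (extendMap_id A embeddingDownNat)).trans ?_
          exact HomologicalComplex₂.total.map_id _ _)))
      homotopyInvHomId := (Homotopy.ofEq (by
        refine (HomologicalComplex₂.total.map_comp _ _ _).symm.trans ?_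
        exact congrArg (fun φ => HomologicalComplex₂.total.map φ (up ℤ))
          (extendMap_comp e.inv e.hom embeddingDownNat).symm)).trans
        ((totHomotopy e.homotopyInvHomId).trans (Homotopy.ofEq (by
          refine (congrArg (fun φ => HomologicalComplex₂.total.map φ (up ℤ))
            (extendMap_id B embeddingDownNat)).trans ?_
          exact HomologicalComplex₂.total.map_id _ _))) }
  exact e'.quasiIso_hom

/-- A complex is quasi-isomorphic to the total complex of the constant complex. -/
theorem quasiIso_totIncl (K : CochainComplex C ℤ) :
    QuasiIso (totIncl (A := constComplex K) (𝟙 K)) := by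
  -- A constant simplicial object has an extra degeneracy, so its alternating complex is homotopy
  -- equivalent to `K` in degree zero, and the total complex sees this equivalence.
  let e := (SimplicialObject.Augmented.ExtraDegeneracy.const K).homotopyEquiv
  let e' : HomotopyEquiv (constComplex K) ((ChainComplex.single₀ _).obj K) := e
  have := quasiIso_totMap e'
  have h0 : e'.hom.f 0 = 𝟙 K := by
    simp [e', e, SimplicialObject.Augmented.ExtraDegeneracy.homotopyEquiv]
  have h : IsIso (totIncl (A := constComplex K) (𝟙 K) ≫ totMap e'.hom) := by
    rw [totIncl_map, h0]
    have : IsIso (𝟙 K ≫ 𝟙 K) := by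
      rw [Category.comp_id]
      infer_instance
    exact isIso_totIncl (A := (ChainComplex.single₀ _).obj K) (hf := this) (𝟙 K ≫ 𝟙 K) fun i =>
      isZero_single_obj_X _ _ _ _ (by simp)
  exact quasiIso_of_comp_right _ (totMap e'.hom)

end

end ChainComplex

/-! ### Additive functors and total complexes -/

namespace ChainComplex

noncomputable section

open ComplexShape HomologicalComplex

variable {C : Type*} [Category* C] [Abelian C]
  [∀ L : HomologicalComplex₂ C (up ℤ) (up ℤ), L.HasTotal (up ℤ)]

variable (A : ChainComplex (CochainComplex C ℤ) ℕ)

/-- The terms of the total complex are coproducts. -/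
abbrev totCofan (n : ℤ) : Cofan fun i : ℕ => (A.X i).X (n + i) :=
  Cofan.mk ((tot A).X n) fun i => ιTot A i (n + i) n rfl

/-- The terms of the total complex are coproducts. -/
def isColimitTotCofan (n : ℤ) : IsColimit (totCofan A n) :=
  Cofan.IsColimit.mk _ (fun s => totDesc fun i j hj => eqToHom (by rw [hj]) ≫ s.inj i)
    (fun s i => (ι_totDesc _ _ _ rfl).trans (Category.id_comp (X := (A.X i).X (n + i)) _))
    (fun s m hm => tot_hom_ext fun i j hj => by
      subst hj
      exact (hm i).trans ((ι_totDesc _ _ _ rfl).trans (Category.id_comp (X := (A.X i).X (n + i)) _)).symm)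

variable {A}
variable (F : C ⥤ C) [F.Additive]

/-- The termwise application of an additive functor. -/
abbrev mapTerms (A : ChainComplex (CochainComplex C ℤ) ℕ) :
    ChainComplex (CochainComplex C ℤ) ℕ :=
  ((F.mapHomologicalComplex (up ℤ)).mapHomologicalComplex _).obj A

theorem map_ιTot_d (i : ℕ) (j n n' j' : ℤ) (h : n + (i + 1 : ℕ) = j) (hn : n + 1 = n')
    (hj : j + 1 = j') :
    F.map (ιTot A (i + 1) j n h) ≫ F.map ((tot A).d n n') =
      F.map ((A.d (i + 1) i).f j) ≫ F.map (ιTot A i j n' (by push_cast at h; lia)) +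
        totSign (i + 1) • F.map ((A.X (i + 1)).d j j') ≫
          F.map (ιTot A (i + 1) j' n' (by lia)) := by
  rw [← F.map_comp, ιTot_succ_d i j n n' j' h hn hj, F.map_add, F.map_comp]
  congr 1
  exact (F.map_units_smul _ _).trans (by rw [F.map_comp])

/-- The components of `totComparison`. -/
def totComparisonHom (n : ℤ) : (tot (mapTerms F A)).X n ⟶ F.obj ((tot A).X n) :=
  totDesc (A := mapTerms F A) fun i j hj =>
    show F.obj ((A.X i).X j) ⟶ F.obj ((tot A).X n) from F.map (ιTot A i j n hj)

theorem ιTot_totComparisonHom (i : ℕ) (j n : ℤ) (h : n + i = j) :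
    ιTot (mapTerms F A) i j n h ≫ totComparisonHom F n =
      (show F.obj ((A.X i).X j) ⟶ F.obj ((tot A).X n) from F.map (ιTot A i j n h)) :=
  ι_totDesc (A := mapTerms F A) _ _ _ _

/-- The comparison between the total complex of the image by an additive functor and the image of
the total complex. -/
def totComparison : tot (mapTerms F A) ⟶ (F.mapHomologicalComplex (up ℤ)).obj (tot A) where
  f n := totComparisonHom F n
  comm' n n' hn := by
    replace hn : n + 1 = n' := hn
    refine tot_hom_ext fun i j hj => ?_
    change ιTot (mapTerms F A) i j n hj ≫ totComparisonHom F n ≫ F.map ((tot A).d n n') =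
      ιTot (mapTerms F A) i j n hj ≫
        ((tot (mapTerms F A)).d n n' ≫ totComparisonHom F n' : _ ⟶ F.obj ((tot A).X n'))
    rw [← Category.assoc, ← Category.assoc, ιTot_totComparisonHom]
    match i with
    | 0 =>
      rw [ιTot_zero_d j n n' (j + 1) hj hn rfl, Category.assoc, ιTot_totComparisonHom]
      refine (F.map_comp _ _).symm.trans (Eq.trans ?_ (F.map_comp _ _))
      rw [ιTot_zero_d j n n' (j + 1) hj hn rfl]
    | i + 1 =>
      rw [ιTot_succ_d i j n n' (j + 1) hj hn rfl, Preadditive.add_comp, Linear.units_smul_comp,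
        Category.assoc, Category.assoc, ιTot_totComparisonHom, ιTot_totComparisonHom]
      exact map_ιTot_d F i j n n' (j + 1) hj hn rfl

/-- Each term of the total complex is a countable coproduct of terms of the rows, which `F`
preserves. -/
instance [PreservesColimitsOfShape (Discrete ℕ) F] : IsIso (totComparison (A := A) F) := by
  have (n : ℤ) : IsIso ((totComparison (A := A) F).f n) := by
    let e := (isColimitTotCofan (mapTerms F A) n).coconePointUniqueUpToIso
      (isColimitCofanMkObjOfIsColimit F _ _ (isColimitTotCofan A n))
    have h : (totComparison (A := A) F).f n = e.hom := by
      refine tot_hom_ext fun i j hj => ?_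
      subst hj
      exact (ιTot_totComparisonHom F i _ n rfl).trans
        ((isColimitTotCofan (mapTerms F A) n).comp_coconePointUniqueUpToIso_hom
          (isColimitCofanMkObjOfIsColimit F _ _ (isColimitTotCofan A n)) ⟨i⟩).symm
    rw [h]
    exact Iso.isIso_hom e
  exact Hom.isIso_of_components _

/-- The comparison is compatible with natural transformations to the identity. -/
theorem totComparison_comp (τ : F ⟶ 𝟭 C) (f : mapTerms F A ⟶ A) (g)
    (hf : ∀ i j, (f.f i).f j = τ.app ((A.X i).X j)) (hg : ∀ n, g.f n = τ.app ((tot A).X n)) :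
    totComparison F ≫ g = totMap f := by
  ext n : 1
  refine tot_hom_ext fun i j hj => ?_
  rw [ιTot_map, hf]
  change ιTot (mapTerms F A) i j n hj ≫ totComparisonHom F n ≫ g.f n = _
  rw [hg, ← Category.assoc, ιTot_totComparisonHom]
  exact τ.naturality _

end

end ChainComplex

namespace A1Motives

noncomputable section

variable {S : Scheme.{u}} (R : Ringoid S)

/-! ### The prism decomposition -/

/-- `- × U × V` is the product with `U × V`. -/
def corAssocIso (U V : Sm S) : corTensor R U ⋙ corTensor R V ≅ corTensor R (U ⊗ V) :=
  NatIso.ofComponents (fun X => (graphFunctor R).mapIso (α_ X.toSm U V))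
    (fun a => R.tensor_assoc a U V)

/-- The morphism `F(- × U × W) ⟶ F(- × V)` given by a morphism `V ⟶ U × W`. -/
def ihomPrism {U V W : Sm S} (g : V ⟶ U ⊗ W) : ihom R W ⋙ ihom R U ⟶ ihom R V where
  app F := ObjectProperty.homMk
    (Functor.whiskerRight (NatTrans.op (corTensorMap R g ≫ (corAssocIso R U W).inv)) F.obj)
  naturality F G φ := by
    ext : 1
    exact Functor.whiskerLeft_comp_whiskerRight
      (NatTrans.op (corTensorMap R g ≫ (corAssocIso R U W).inv)) φ.hom

variable {R}

theorem ev_map_ihomPrism {U V W : Sm S} (g : V ⟶ U ⊗ W) (F : Pre R) (X : Sm S) :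
    (ev R X).map ((ihomPrism R g).app F) = res F (X ◁ g ≫ (α_ X U W).inv) :=
  congrArg (fun a => F.obj.map (Quiver.Hom.op a)) ((graphFunctor R).map_comp _ _).symm

theorem ihomPrism_comp_map {U V V' W : Sm S} (g : V ⟶ U ⊗ W) (f : V' ⟶ V) (F : Pre R) :
    (ihomPrism R g).app F ≫ (ihomMap R f).app F = (ihomPrism R (f ≫ g)).app F :=
  pre_hom_ext fun X => by
    rw [Functor.map_comp, ev_map_ihomMap, ev_map_ihomPrism, ev_map_ihomPrism]
    refine (res_comp F _ _).symm.trans (congrArg (res F) ?_)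
    rw [whiskerLeft_comp, Category.assoc]

theorem map_comp_ihomPrism {U V W W' : Sm S} (g : V ⟶ U ⊗ W) (f : W ⟶ W') (F : Pre R) :
    (ihom R U).map ((ihomMap R f).app F) ≫ (ihomPrism R g).app F =
      (ihomPrism R (g ≫ U ◁ f)).app F :=
  pre_hom_ext fun X => by
    rw [Functor.map_comp, ev_map_ihomPrism, ev_map_ihomPrism]
    refine (res_comp F _ ((X ⊗ U) ◁ f)).symm.trans (congrArg (res F) ?_)
    simp

theorem ihomPrism_section {U W : Sm S} (x : 𝟙_ (Sm S) ⟶ U) (F : Pre R) :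
    (ihomPrism R (lift (toUnit W ≫ x) (𝟙 W))).app F =
      (ihomSection R x).app ((ihom R W).obj F) :=
  pre_hom_ext fun X => by
    rw [ev_map_ihomSection, ev_map_ihomPrism, res_ihom]
    refine congrArg (res F) ?_
    rw [← cancel_mono (α_ X U W).hom, Category.assoc, Iso.inv_hom_id, Category.comp_id]
    ext <;> simp

/-- The morphism `K(- × U × W) ⟶ K(- × V)` given by a morphism `V ⟶ U × W`. -/
def prismC {U V W : Sm S} (g : V ⟶ U ⊗ W) (K : CochainComplex (Pre R) ℤ) :
    (ihomC R U).obj ((ihomC R W).obj K) ⟶ (ihomC R V).obj K where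
  f n := (ihomPrism R g).app (K.X n)
  comm' m n _ := ((ihomPrism R g).naturality (K.d m n)).symm

/-- The morphism `K(- × V) ⟶ K(- × U)` given by a morphism `U ⟶ V`. -/
abbrev ihomMapC {U V : Sm S} (g : U ⟶ V) (K : CochainComplex (Pre R) ℤ) :
    (ihomC R V).obj K ⟶ (ihomC R U).obj K :=
  (NatTrans.mapHomologicalComplex (ihomMap R g) _).app K

theorem prismC_comp_map {U V V' W : Sm S} (g : V ⟶ U ⊗ W) (f : V' ⟶ V)
    (K : CochainComplex (Pre R) ℤ) : prismC g K ≫ ihomMapC f K = prismC (f ≫ g) K := by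
  ext n : 1
  exact ihomPrism_comp_map g f (K.X n)

theorem map_comp_prismC {U V W W' : Sm S} (g : V ⟶ U ⊗ W) (f : W ⟶ W')
    (K : CochainComplex (Pre R) ℤ) :
    (ihomC R U).map (ihomMapC f K) ≫ prismC g K = prismC (g ≫ U ◁ f) K := by
  ext n : 1
  exact map_comp_ihomPrism g f (K.X n)

theorem prismC_section {U W : Sm S} (x : 𝟙_ (Sm S) ⟶ U) (K : CochainComplex (Pre R) ℤ) :
    prismC (lift (toUnit W ≫ x) (𝟙 W)) K = sectionC x ((ihomC R W).obj K) := by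
  ext n : 1
  exact ihomPrism_section x (K.X n)

open SimplexCategory Simplicial

variable (S) in
/-- The identification of the algebraic `1`-simplex with the affine line. -/
def simplexToLine : (simplex S).obj ⦋1⦌ ⟶ affineLine S :=
  toLine (vertexCoord (n := ⦋1⦌) 1)

/-- The underlying map of simplices is constant at the vertex `1`, so the coordinate pulls back to
the sum of all barycentric coordinates. -/
theorem simplex_map_toMk₁_zero (n : ℕ) :
    (simplex S).map (toMk₁ (n := n) 0) ≫ simplexToLine S = toUnit _ ≫ affineLinePoint S 1 := by
  refine toLine_ext ?_
  rw [globMap_comp, simplexToLine, globMap_toLine, globMap_simplex_map, globMap_comp_point_one,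
    ← sum_vertexCoord]
  refine congrArg (fun s => Finset.sum s _) ?_
  rw [Finset.filter_eq_self]
  exact fun i _ => toMk₁_of_le_castSucc _ _ (Fin.zero_le _)

theorem simplex_map_toMk₁_last (n : ℕ) :
    (simplex S).map (toMk₁ (Fin.last (n + 1))) ≫ simplexToLine S =
      toUnit _ ≫ affineLinePoint S 0 := by
  refine toLine_ext ?_
  rw [globMap_comp, simplexToLine, globMap_toLine, globMap_simplex_map, globMap_comp_point_zero]
  rw [Finset.filter_eq_empty_iff.2, Finset.sum_empty]
  intro i _ h
  exact zero_ne_one ((toMk₁_of_castSucc_lt (Fin.last (n + 1)) i (Fin.castSucc_lt_last i)).symm.trans h)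

/-- The pieces of the prism decomposition, as morphisms `Δ^m ⟶ 𝔸¹ × Δ^n`. -/
def prismMap {m n : SimplexCategory} (τ : m ⟶ ⦋1⦌) (σ : m ⟶ n) :
    (simplex S).obj m ⟶ affineLine S ⊗ (simplex S).obj n :=
  lift ((simplex S).map τ ≫ simplexToLine S) ((simplex S).map σ)

theorem map_comp_prismMap {l m n : SimplexCategory} (θ : l ⟶ m) (τ : m ⟶ ⦋1⦌) (σ : m ⟶ n) :
    (simplex S).map θ ≫ prismMap τ σ = prismMap (θ ≫ τ) (θ ≫ σ) := by
  rw [prismMap, comp_lift, ← Category.assoc, ← Functor.map_comp, ← Functor.map_comp, prismMap]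

theorem prismMap_comp {m n n' : SimplexCategory} (τ : m ⟶ ⦋1⦌) (σ : m ⟶ n) (θ : n ⟶ n') :
    prismMap τ σ ≫ affineLine S ◁ (simplex S).map θ = prismMap τ (σ ≫ θ) := by
  rw [prismMap, lift_whiskerLeft, ← Functor.map_comp, prismMap]

/-- The simplicial complex `n ↦ K(- × 𝔸¹ × Δ^n)`. -/
abbrev singLine (K : CochainComplex (Pre R) ℤ) : SimplicialObject (CochainComplex (Pre R) ℤ) :=
  ((SimplicialObject.whiskering _ _).obj (ihomC R (affineLine S))).obj (singObj R K)

/-- The morphism of simplicial complexes given by a section of the affine line. -/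
def singSection (x : 𝟙_ (Sm S) ⟶ affineLine S) (K : CochainComplex (Pre R) ℤ) :
    singLine K ⟶ singObj R K where
  app n := sectionC x _
  naturality _ _ _ := sectionC_naturality x _

/-- The map of simplicial complexes given by a piece of the prism decomposition. -/
def prismHom {m n : SimplexCategory} (τ : m ⟶ ⦋1⦌) (σ : m ⟶ n) (K : CochainComplex (Pre R) ℤ) :
    (singLine K).obj (op n) ⟶ (singObj R K).obj (op m) :=
  prismC (prismMap τ σ) K

theorem prismHom_comp {l m n : SimplexCategory} (τ : m ⟶ ⦋1⦌) (σ : m ⟶ n) (θ : l ⟶ m)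
    (K : CochainComplex (Pre R) ℤ) :
    prismHom τ σ K ≫ (singObj R K).map θ.op = prismHom (θ ≫ τ) (θ ≫ σ) K :=
  (prismC_comp_map _ _ _).trans (congrArg (prismC · K) (map_comp_prismMap θ τ σ))

theorem comp_prismHom {m n n' : SimplexCategory} (τ : m ⟶ ⦋1⦌) (σ : m ⟶ n) (θ : n ⟶ n')
    (K : CochainComplex (Pre R) ℤ) :
    (singLine K).map θ.op ≫ prismHom τ σ K = prismHom τ (σ ≫ θ) K :=
  (map_comp_prismC _ _ _).trans (congrArg (prismC · K) (prismMap_comp τ σ θ))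

theorem prismHom_section {n : SimplexCategory} (τ : n ⟶ ⦋1⦌) (x : 𝟙_ (Sm S) ⟶ affineLine S)
    (h : (simplex S).map τ ≫ simplexToLine S = toUnit _ ≫ x) (K : CochainComplex (Pre R) ℤ) :
    prismHom τ (𝟙 n) K = (singSection x K).app (op n) := by
  refine Eq.trans (congrArg (prismC · K) ?_) (prismC_section x K)
  rw [prismMap, h, CategoryTheory.Functor.map_id]

/-- The prism homotopy. -/
def prismHomotopy (K : CochainComplex (Pre R) ℤ) :
    SimplicialObject.Homotopy (singSection (affineLinePoint S 0) K)
      (singSection (affineLinePoint S 1) K) where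
  -- The `i`-th prism is the simplex of `𝔸¹ × Δⁿ` repeating the vertex `i` of `Δⁿ` and passing from
  -- `0` to `1` between the two copies. As both components come from monotone maps, every identity
  -- below is one in the simplex category.
  h i := prismHom (toMk₁ i.succ.castSucc) (σ i) K
  h_zero_comp_δ_zero n := by
    refine (prismHom_comp _ _ (δ 0) K).trans (Eq.trans ?_
      (prismHom_section (toMk₁ 0) _ (simplex_map_toMk₁_zero n) K))
    rw [δ_comp_toMk₁_of_lt _ _ (by simp)]
    congr 1
  h_last_comp_δ_last n := by
    refine (prismHom_comp _ _ (δ (Fin.last (n + 1))) K).trans (Eq.trans ?_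
      (prismHom_section (toMk₁ (Fin.last _)) _ (simplex_map_toMk₁_last n) K))
    rw [δ_comp_toMk₁_of_le _ _ (by simp)]
    congr 1
    exact δ_comp_σ_succ (i := Fin.last n)
  h_succ_comp_δ_castSucc_of_lt i j hij := by
    refine (prismHom_comp _ _ _ K).trans (Eq.trans ?_ (comp_prismHom _ _ _ K).symm)
    congr 1
    · refine (δ_comp_toMk₁_of_lt _ _ ?_).trans (congrArg toMk₁ (Fin.ext (by simp)))
      simp only [Fin.le_def, Fin.lt_def, Fin.val_castSucc, Fin.val_succ] at hij ⊢
      lia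
    · exact δ_comp_σ_of_le hij
  h_succ_comp_δ_castSucc_succ j := by
    refine (prismHom_comp _ _ _ K).trans (Eq.trans ?_ (prismHom_comp _ _ _ K).symm)
    congr 1
    · refine (δ_comp_toMk₁_of_lt _ _ ?_).trans (Eq.trans (congrArg toMk₁ (Fin.ext (by simp)))
        (δ_comp_toMk₁_of_le _ _ ?_).symm)
      all_goals simp [Fin.lt_def]
    · exact (δ_comp_σ_self (i := j.succ)).trans (δ_comp_σ_succ (i := j.castSucc)).symm
  h_castSucc_comp_δ_succ_of_lt i j hji := by
    refine (prismHom_comp _ _ _ K).trans (Eq.trans ?_ (comp_prismHom _ _ _ K).symm)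
    congr 1
    · refine (δ_comp_toMk₁_of_le _ _ ?_).trans (congrArg toMk₁ (Fin.ext (by simp)))
      simp only [Fin.le_def, Fin.lt_def, Fin.val_castSucc, Fin.val_succ] at hji ⊢
      lia
    · exact δ_comp_σ_of_gt hji
  h_comp_σ_castSucc_of_le i j hij := by
    refine (prismHom_comp _ _ _ K).trans (Eq.trans ?_ (comp_prismHom _ _ _ K).symm)
    congr 1
    · refine (σ_comp_toMk₁_of_lt _ _ ?_).trans (congrArg toMk₁ (Fin.ext (by simp)))
      simp only [Fin.le_def, Fin.lt_def, Fin.val_castSucc, Fin.val_succ] at hij ⊢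
      lia
    · exact σ_comp_σ hij
  h_comp_σ_succ_of_lt i j hji := by
    refine (prismHom_comp _ _ _ K).trans (Eq.trans ?_ (comp_prismHom _ _ _ K).symm)
    congr 1
    · refine (σ_comp_toMk₁_of_le _ _ ?_).trans (congrArg toMk₁ (Fin.ext (by simp)))
      simp only [Fin.le_def, Fin.val_castSucc, Fin.val_succ] at hji ⊢
      lia
    · exact (σ_comp_σ hji).symm

end

end A1Motives

/-! ### Homotopy invariance of the Suslin complex -/

namespace A1Motives

noncomputable section

variable {S : Scheme.{u}} {R : Ringoid S}

open AlgebraicTopology ChainComplex HomologicalComplex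

/-- The chain complex of complexes `K(- × Δ^i)`. -/
abbrev singComplex (K : CochainComplex (Pre R) ℤ) : ChainComplex (CochainComplex (Pre R) ℤ) ℕ :=
  (alternatingFaceMapComplex _).obj (singObj R K)

theorem suslin_obj (K : CochainComplex (Pre R) ℤ) : (suslin R).obj K = tot (singComplex K) := rfl

/-- The termwise application of an additive functor commutes with the alternating face map
complex. -/
def mapTermsHom {C : Type*} [Category* C] [Abelian C] (F : C ⥤ C) [F.Additive]
    (X : SimplicialObject (CochainComplex C ℤ)) :
    mapTerms F ((alternatingFaceMapComplex _).obj X) ⟶ (alternatingFaceMapComplex _).obj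
      (((SimplicialObject.whiskering _ _).obj (F.mapHomologicalComplex (.up ℤ))).obj X) where
  f i := 𝟙 ((F.mapHomologicalComplex (.up ℤ)).obj (X.obj (op ⟨i⟩)))
  comm' i j hij := by
    obtain rfl : j + 1 = i := hij
    refine (Category.id_comp _).trans (Eq.trans ?_ (Category.comp_id _).symm)
    refine (alternatingFaceMapComplex_obj_d _ _).trans (Eq.trans ?_
      (congrArg (F.mapHomologicalComplex (.up ℤ)).map (alternatingFaceMapComplex_obj_d X j)).symm)
    rw [AlternatingFaceMapComplex.objD, AlternatingFaceMapComplex.objD, Functor.map_sum]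
    refine Finset.sum_congr rfl fun k _ => ?_
    rw [Functor.map_zsmul]
    rfl

/-- The map of chain complexes given by a section of the affine line. -/
def singComplexSection (x : 𝟙_ (Sm S) ⟶ affineLine S) (K : CochainComplex (Pre R) ℤ) :
    mapTerms (ihom R (affineLine S)) (singComplex K) ⟶ singComplex K :=
  mapTermsHom (ihom R (affineLine S)) (singObj R K) ≫
    (alternatingFaceMapComplex _).map (singSection x K)

theorem singComplexSection_f (x : 𝟙_ (Sm S) ⟶ affineLine S) (K : CochainComplex (Pre R) ℤ)
    (i : ℕ) : (singComplexSection x K).f i = sectionC x _ :=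
  Category.id_comp _

theorem totComparison_sectionC (x : 𝟙_ (Sm S) ⟶ affineLine S) (K : CochainComplex (Pre R) ℤ) :
    totComparison (A := singComplex K) (ihom R (affineLine S)) ≫ sectionC x (tot (singComplex K)) =
      totMap (singComplexSection x K) :=
  totComparison_comp (ihom R (affineLine S)) (ihomSection R x) (singComplexSection x K)
    (sectionC x (tot (singComplex K)))
    (fun i j => congrArg (fun φ => φ.f j) (singComplexSection_f x K i)) fun _ => rfl

/-- The homology presheaves of the Suslin complex are homotopy invariant. -/
theorem isHomotopyInvariant_homology_suslin (K : CochainComplex (Pre R) ℤ) (n : ℤ) :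
    IsHomotopyInvariant R (((suslin R).obj K).homology n) := by
  rw [suslin_obj]
  refine isHomotopyInvariant_homology_of_section_eq _ _ ?_
  -- Evaluation on `𝔸¹` commutes with the totalization, so the two sections become total maps of
  -- simplicial ones, which the prism homotopy identifies on homology.
  rw [← cancel_epi (homologyMap (totComparison (A := singComplex K) (ihom R (affineLine S))) n),
    ← homologyMap_comp, ← homologyMap_comp, totComparison_sectionC, totComparison_sectionC]
  exact (totHomotopy ((prismHomotopy K).toChainHomotopy.compLeft _)).homologyMap_eq n

end

end A1Motives

namespace A1Motives

noncomputable section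

variable {S : Scheme.{u}}

/-! ### The contraction of the simplices -/

theorem sum_pi_single_zero {A : Type*} [CommRing A] (n : ℕ) :
    ∑ i, (Pi.single 0 1 : Fin (n + 1) → A) i = 1 :=
  Finset.sum_pi_single' _ _ _ |>.trans (if_pos (Finset.mem_univ _))

variable (S) in
/-- The zeroth vertex of a simplex. -/
def simplexVertex (n : SimplexCategory) : 𝟙_ (Sm S) ⟶ (simplex S).obj n :=
  toSimplex (Pi.single 0 1) (sum_pi_single_zero n.len)

variable (S) in
/-- The contraction `(t, x) ↦ (1 - t) x + t e₀` of a simplex. -/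
def simplexContract (n : SimplexCategory) :
    affineLine S ⊗ (simplex S).obj n ⟶ (simplex S).obj n :=
  toSimplex (fun i => (1 - globMap (fst _ _) (lineCoord S)) * globMap (snd _ _) (vertexCoord i) +
    globMap (fst _ _) (lineCoord S) * (Pi.single 0 1 : Fin (n.len + 1) → _) i) (by
      rw [Finset.sum_add_distrib, ← Finset.mul_sum, ← Finset.mul_sum, sum_pi_single_zero,
        ← map_sum, sum_vertexCoord, map_one]
      ring)

theorem lift_zero_simplexContract (n : SimplexCategory) :
    lift (toUnit _ ≫ affineLinePoint S 0) (𝟙 _) ≫ simplexContract S n = 𝟙 _ := by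
  refine toSimplex_ext fun i => ?_
  rw [globMap_comp, simplexContract, globMap_toSimplex, map_add, map_mul, map_mul, map_sub, map_one,
    ← globMap_comp, ← globMap_comp, lift_fst, lift_snd, globMap_comp_point_zero]
  simp

theorem lift_one_simplexContract (n : SimplexCategory) :
    lift (toUnit _ ≫ affineLinePoint S 1) (𝟙 _) ≫ simplexContract S n =
      toUnit _ ≫ simplexVertex S n := by
  refine toSimplex_ext fun i => ?_
  rw [globMap_comp, simplexContract, globMap_toSimplex, map_add, map_mul, map_mul, map_sub, map_one,
    ← globMap_comp, ← globMap_comp, lift_fst, lift_snd, globMap_comp_point_one, globMap_comp,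
    simplexVertex, globMap_toSimplex]
  by_cases hi : i = 0
  · subst hi
    simp
  · simp [Pi.single_eq_of_ne hi]

variable {R : Ringoid S}

theorem ihomProj_ihomMap {U V : Sm S} (g : U ⟶ V) (F : Pre R) :
    (ihomProj R V).app F ≫ (ihomMap R g).app F = (ihomProj R U).app F :=
  pre_hom_ext fun X => by
    rw [Functor.map_comp, ev_map_ihomProj, ev_map_ihomProj, ev_map_ihomMap]
    refine (res_comp F _ _).symm.trans (congrArg (res F) ?_)
    simp

/-- Sections pulled back from the base are unaffected by `H`; this lets a contraction descend to the
quotient by the constant part. -/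
theorem ihomProj_ihomAct {U V W : Sm S} (H : U ⊗ V ⟶ W) (F : Pre R) :
    (ihomProj R W).app F ≫ (ihomAct R H).app F =
      (ihomProj R U).app F ≫ (ihom R U).map ((ihomProj R V).app F) :=
  pre_hom_ext fun X => by
    rw [Functor.map_comp, Functor.map_comp, ev_map_ihomProj, ev_map_ihomAct, ev_map_ihomProj]
    refine (res_comp F _ _).symm.trans (Eq.trans (congrArg (res F) ?_)
      ((res_comp F (fst (X ⊗ U) V) (fst X U)).trans
        (congrArg (_ ≫ ·) (ev_map_ihomProj V F (X ⊗ U)).symm)))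
    simp

theorem ihomMap_toUnit_comp {U V : Sm S} (x : 𝟙_ (Sm S) ⟶ V) (F : Pre R) :
    (ihomMap R (toUnit U ≫ x)).app F = (ihomSection R x).app F ≫ (ihomProj R U).app F :=
  pre_hom_ext fun X => by
    rw [Functor.map_comp, ev_map_ihomProj, ev_map_ihomSection, ev_map_ihomMap]
    refine Eq.trans (congrArg (res F) ?_) (res_comp F _ _)
    ext1 <;> simp

end

end A1Motives

/-! ### The quotient of the Suslin complex by its constant part -/

namespace A1Motives

noncomputable section

variable {S : Scheme.{u}} {R : Ringoid S}

open AlgebraicTopology ChainComplex HomologicalComplex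

/-- The inclusion of the constant simplicial complex given by the projections. -/
def constToSing (K : CochainComplex (Pre R) ℤ) :
    (SimplicialObject.const _).obj K ⟶ singObj R K where
  app n := projC _ K
  naturality m n θ := by
    refine (Category.id_comp _).trans ?_
    ext j : 1
    exact (ihomProj_ihomMap ((simplex S).map θ.unop) (K.X j)).symm

/-- The inclusion of the constant complex. -/
abbrev constToSingComplex (K : CochainComplex (Pre R) ℤ) : constComplex K ⟶ singComplex K :=
  (alternatingFaceMapComplex _).map (constToSing K)

/-- The canonical map from a complex to its Suslin complex. -/
def toSuslin (K : CochainComplex (Pre R) ℤ) : K ⟶ (suslin R).obj K :=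
  totIncl (A := singComplex K) (projC _ K)

/-- Replaces the canonical map by a quasi-isomorphism followed by a monomorphism, so that its cone
can be computed as a cokernel. -/
theorem toSuslin_eq (K : CochainComplex (Pre R) ℤ) :
    toSuslin K = totIncl (A := constComplex K) (𝟙 K) ≫ totMap (constToSingComplex K) := by
  rw [totIncl_map]
  exact congrArg totIncl (Category.id_comp _).symm

theorem toSuslin_naturality {K L : CochainComplex (Pre R) ℤ} (f : K ⟶ L) :
    toSuslin K ≫ (suslin R).map f = f ≫ toSuslin L := by
  refine (totIncl_map _ ((alternatingFaceMapComplex _).map ((sing R).map f))).trans ?_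
  ext n : 1
  refine Eq.trans ?_ (Category.assoc _ _ _)
  refine congrArg (· ≫ ιTot (singComplex L) 0 n n (by simp)) ?_
  exact ((ihomProj R _).naturality (f.f n)).symm

/-- The section of the inclusion of the constant complex in each degree. -/
def suslinRetraction (K : CochainComplex (Pre R) ℤ) (n : ℤ) :
    (tot (singComplex K)).X n ⟶ (tot (constComplex K)).X n :=
  totDesc fun i j hj => (sectionC (simplexVertex S ⟨i⟩) K).f j ≫ ιTot (constComplex K) i j n hj

/-- Evaluation at the zeroth vertices splits the inclusion in each degree. No compatibility with the
differentials is claimed, and a termwise splitting suffices for the monomorphism. -/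
theorem totMap_suslinRetraction (K : CochainComplex (Pre R) ℤ) (n : ℤ) :
    (totMap (constToSingComplex K)).f n ≫ suslinRetraction K n = 𝟙 _ := by
  refine tot_hom_ext fun i j hj => ?_
  rw [← Category.assoc, ιTot_map, Category.assoc, suslinRetraction, ι_totDesc, Category.comp_id]
  refine (Category.assoc _ _ _).symm.trans ?_
  exact (congrArg (fun φ => HomologicalComplex.Hom.f φ j ≫ ιTot (constComplex K) i j n hj)
    (projC_sectionC (simplexVertex S ⟨i⟩) K)).trans (Category.id_comp _)

instance (K : CochainComplex (Pre R) ℤ) : Mono (totMap (constToSingComplex K)) := by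
  have (n : ℤ) : Mono ((totMap (constToSingComplex K)).f n) :=
    mono_of_mono_fac (totMap_suslinRetraction K n)
  exact mono_of_mono_f _ fun n => this n

/-- The quotient of the Suslin complex by the constant complex. -/
abbrev suslinQuotient (K : CochainComplex (Pre R) ℤ) : CochainComplex (Pre R) ℤ :=
  cokernel (totMap (constToSingComplex K))

/-- The short exact sequence of the Suslin complex. -/
abbrev suslinSequence (K : CochainComplex (Pre R) ℤ) :
    ShortComplex (CochainComplex (Pre R) ℤ) :=
  .mk (totMap (constToSingComplex K)) (cokernel.π _) (cokernel.condition _)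

theorem suslinSequence_shortExact (K : CochainComplex (Pre R) ℤ) :
    (suslinSequence K).ShortExact where
  exact := ShortComplex.exact_cokernel _
  mono_f := inferInstanceAs (Mono (totMap (constToSingComplex K)))
  epi_g := inferInstanceAs (Epi (cokernel.π _))

/-- The projection to the quotient in each degree. -/
abbrev suslinQuotientπ (K : CochainComplex (Pre R) ℤ) (n : ℤ) :
    (tot (singComplex K)).X n ⟶ (suslinQuotient K).X n :=
  (cokernel.π (totMap (constToSingComplex K))).f n

theorem shortExact_suslinSequence_eval (K : CochainComplex (Pre R) ℤ) (n : ℤ) :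
    ((suslinSequence K).map (eval _ _ n)).ShortExact :=
  (suslinSequence_shortExact K).map_of_exact (eval _ _ n)

instance (K : CochainComplex (Pre R) ℤ) (n : ℤ) : Epi (suslinQuotientπ K n) :=
  (shortExact_suslinSequence_eval K n).epi_g

theorem proj_ιTot_suslinQuotientπ (K : CochainComplex (Pre R) ℤ) (i : ℕ) (j n : ℤ)
    (h : n + i = j) :
    (projC ((simplex S).obj ⟨i⟩) K).f j ≫ ιTot (singComplex K) i j n h ≫ suslinQuotientπ K n =
      0 := by
  have h1 : (totMap (constToSingComplex K)).f n ≫ suslinQuotientπ K n = 0 :=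
    ((suslinSequence K).map (eval _ _ n)).zero
  have h2 := ιTot (constComplex K) i j n h ≫= h1
  rw [← Category.assoc, ιTot_map, comp_zero, Category.assoc] at h2
  exact h2

/-- The contraction of the Suslin complex, with values in the quotient. -/
def suslinContract (K : CochainComplex (Pre R) ℤ) (n : ℤ) :
    (tot (singComplex K)).X n ⟶ (ihom R (affineLine S)).obj ((suslinQuotient K).X n) :=
  totDesc fun i j hj =>
    show (ihom R ((simplex S).obj ⟨i⟩)).obj (K.X j) ⟶ _ from
    (ihomAct R (simplexContract S ⟨i⟩)).app (K.X j) ≫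
      (ihom R (affineLine S)).map (ιTot (singComplex K) i j n hj ≫ suslinQuotientπ K n)

theorem ι_suslinContract (K : CochainComplex (Pre R) ℤ) (i : ℕ) (j n : ℤ) (h : n + i = j) :
    ιTot (singComplex K) i j n h ≫ suslinContract K n =
      (show (ihom R ((simplex S).obj ⟨i⟩)).obj (K.X j) ⟶ _ from
      (ihomAct R (simplexContract S ⟨i⟩)).app (K.X j) ≫
      (ihom R (affineLine S)).map (ιTot (singComplex K) i j n h ≫ suslinQuotientπ K n)) :=
  ι_totDesc _ _ _ _

/-- The contraction sends constants to constants, which die in the quotient; hence it factors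
through the quotient. -/
theorem totMap_suslinContract (K : CochainComplex (Pre R) ℤ) (n : ℤ) :
    (totMap (constToSingComplex K)).f n ≫ suslinContract K n = 0 := by
  refine tot_hom_ext fun i j hj => ?_
  rw [← Category.assoc, ιTot_map, Category.assoc, ι_suslinContract, comp_zero]
  change (ihomProj R ((simplex S).obj ⟨i⟩)).app (K.X j) ≫
    (ihomAct R (simplexContract S ⟨i⟩)).app (K.X j) ≫ _ = 0
  rw [← Category.assoc, ihomProj_ihomAct, Category.assoc]
  refine (_ ≫= ((ihom R (affineLine S)).map_comp _ _).symm).trans ?_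
  have h := proj_ιTot_suslinQuotientπ K i j n hj
  refine (_ ≫= congrArg (ihom R (affineLine S)).map h).trans ?_
  rw [Functor.map_zero, comp_zero]

/-- The terms of the quotient of the Suslin complex are contractible. -/
theorem isContractiblePresheaf_suslinQuotient (K : CochainComplex (Pre R) ℤ) (n : ℤ) :
    IsContractiblePresheaf R ((suslinQuotient K).X n) := by
  have he := shortExact_suslinSequence_eval K n
  have hepi := he.epi_g
  obtain ⟨h, hh⟩ : ∃ h : (suslinQuotient K).X n ⟶
      (ihom R (affineLine S)).obj ((suslinQuotient K).X n),
      suslinQuotientπ K n ≫ h = suslinContract K n :=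
    ⟨he.exact.desc (suslinContract K n) (totMap_suslinContract K n), he.exact.g_desc _ _⟩
  -- On each summand, evaluating `h` at `x` is restriction along the contraction at time `x`. At `0`
  -- this is the identity; at `1` it is constant at a vertex, factors through the constants, and
  -- vanishes in the quotient.
  have key (x : 𝟙_ (Sm S) ⟶ affineLine S) (i : ℕ) (j : ℤ) (hj : n + i = j) :
      ιTot (singComplex K) i j n hj ≫ suslinQuotientπ K n ≫ h ≫
        (ihomSection R x).app ((suslinQuotient K).X n) =
      (show (ihom R ((simplex S).obj ⟨i⟩)).obj (K.X j) ⟶ _ from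
        (ihomMap R (lift (toUnit _ ≫ x) (𝟙 _) ≫ simplexContract S ⟨i⟩)).app (K.X j) ≫
          ιTot (singComplex K) i j n hj ≫ suslinQuotientπ K n) := by
    rw [← Category.assoc (suslinQuotientπ K n), hh, ← Category.assoc, ι_suslinContract]
    refine (Category.assoc _ _ _).trans ?_
    rw [ihom_map_section, ← ihomAct_section]
    exact (Category.assoc _ _ _).symm
  refine ⟨h, ?_, ?_⟩
  · rw [← cancel_epi (suslinQuotientπ K n)]
    refine tot_hom_ext fun i j hj => (key _ i j hj).trans ?_
    rw [lift_zero_simplexContract, ihomMap_id, Category.comp_id]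
    exact Category.id_comp _
  · rw [← cancel_epi (suslinQuotientπ K n)]
    refine tot_hom_ext fun i j hj => (key _ i j hj).trans ?_
    rw [lift_one_simplexContract, ihomMap_toUnit_comp, comp_zero, comp_zero]
    refine (Category.assoc _ _ _).trans ?_
    refine (_ ≫= proj_ιTot_suslinQuotientπ K i j n hj).trans comp_zero

theorem isStrictlyLE_tot {C : Type*} [Category* C] [Abelian C]
    [∀ L : HomologicalComplex₂ C (.up ℤ) (.up ℤ), L.HasTotal (.up ℤ)]
    (A : ChainComplex (CochainComplex C ℤ) ℕ) (n : ℤ) (hA : ∀ i, (A.X i).IsStrictlyLE n) :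
    (tot A).IsStrictlyLE n := by
  rw [CochainComplex.isStrictlyLE_iff]
  intro m hm
  rw [IsZero.iff_id_eq_zero]
  refine tot_hom_ext fun i j hj => ?_
  have := hA i
  exact ((A.X i).isZero_of_isStrictlyLE n j (by lia)).eq_of_src _ _

instance (K : CochainComplex (Pre R) ℤ) (n : ℤ) [K.IsStrictlyLE n] :
    ((suslin R).obj K).IsStrictlyLE n :=
  isStrictlyLE_tot (singComplex K) n fun i => by
    rw [CochainComplex.isStrictlyLE_iff]
    exact fun m hm => (ihom R _).map_isZero (K.isZero_of_isStrictlyLE n m hm)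

instance (K : CochainComplex (Pre R) ℤ) (n : ℤ) [K.IsStrictlyLE n] :
    (suslinQuotient K).IsStrictlyLE n := by
  rw [CochainComplex.isStrictlyLE_iff]
  intro m hm
  rw [IsZero.iff_id_eq_zero, ← cancel_epi (suslinQuotientπ K m)]
  exact (((suslin R).obj K).isZero_of_isStrictlyLE n m hm).eq_of_src _ _

end

end A1Motives

/-! ### Transport of distinguished triangles along isomorphisms -/

namespace CategoryTheory.Pretriangulated

variable {T : Type*} [Category* T] [HasZeroObject T] [HasShift T ℤ] [Preadditive T]
  [∀ n : ℤ, (shiftFunctor T n).Additive] [Pretriangulated T]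

theorem distinguished_mk_of_iso {t : Triangle T} (ht : t ∈ distTriang T) {X Y Z : T}
    (a : X ≅ t.obj₁) (b : Y ≅ t.obj₂) (c : Z ≅ t.obj₃) :
    Triangle.mk (a.hom ≫ t.mor₁ ≫ b.inv) (b.hom ≫ t.mor₂ ≫ c.inv)
      (c.hom ≫ t.mor₃ ≫ a.inv⟦(1 : ℤ)⟧') ∈ distTriang T :=
  isomorphic_distinguished _ ht _ (Triangle.isoMk _ _ a b c
    (show (a.hom ≫ t.mor₁ ≫ b.inv) ≫ b.hom = a.hom ≫ t.mor₁ by simp)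
    (show (b.hom ≫ t.mor₂ ≫ c.inv) ≫ c.hom = b.hom ≫ t.mor₂ by simp)
    (show (c.hom ≫ t.mor₃ ≫ a.inv⟦(1 : ℤ)⟧') ≫ a.hom⟦(1 : ℤ)⟧' = c.hom ≫ t.mor₃ by
      simp [← Functor.map_comp]))

theorem distinguished_mk_of_iso₃ {X Y Z Z' : T} {f : X ⟶ Y} {g : Y ⟶ Z} {h : Z ⟶ X⟦(1 : ℤ)⟧}
    (ht : Triangle.mk f g h ∈ distTriang T) (c : Z ≅ Z') :
    Triangle.mk f (g ≫ c.hom) (c.inv ≫ h) ∈ distTriang T := by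
  have h' := distinguished_mk_of_iso ht (Iso.refl X) (Iso.refl Y) c.symm
  change Triangle.mk (𝟙 X ≫ f ≫ 𝟙 Y) (𝟙 Y ≫ g ≫ c.hom) (c.inv ≫ h ≫ (𝟙 X)⟦(1 : ℤ)⟧') ∈ _ at h'
  simpa using h'

end CategoryTheory.Pretriangulated

/-! ### The Suslin triangle and its consequences -/

namespace A1Motives

noncomputable section

variable {S : Scheme.{u}} (R : Ringoid S)

open AlgebraicTopology ChainComplex HomologicalComplex

/-- The Suslin complex, on bounded above complexes. -/
def suslinBounded : (boundedAbove R).FullSubcategory ⥤ (boundedAbove R).FullSubcategory :=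
  (boundedAbove R).lift ((boundedAbove R).ι ⋙ suslin R) fun K => by
    obtain ⟨n, hn⟩ := K.property
    exact ⟨n, (inferInstance : ((suslin R).obj K.obj).IsStrictlyLE n)⟩

/-- The canonical map to the Suslin complex, on bounded above complexes. -/
def toSuslinBounded : 𝟭 _ ⟶ suslinBounded R where
  app K := ObjectProperty.homMk (toSuslin K.obj)
  naturality K L f := by
    ext : 1
    exact (toSuslin_naturality f.hom).symm

variable [HasDerivedCategory.{w} (Pre R)]

open DerivedCategory Pretriangulated

theorem a1Inv_suslinBounded (K : (boundedAbove R).FullSubcategory) :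
    a1Inv R ((Qminus R).obj ((suslinBounded R).obj K)) :=
  (isIso_derivedProj_Q_iff R ((suslin R).obj K.obj)).2
    fun n => isHomotopyInvariant_homology_suslin K.obj n

/-- The Suslin complex, as a functor to the invariant objects. -/
def suslinInv : (boundedAbove R).FullSubcategory ⥤ (a1Inv R).FullSubcategory :=
  (a1Inv R).lift (suslinBounded R ⋙ Qminus R) (a1Inv_suslinBounded R)

/-- The canonical map to the Suslin complex in `D⁻`. -/
def toSuslinInv : Qminus R ⟶ suslinInv R ⋙ (a1Inv R).ι :=
  Functor.whiskerRight (toSuslinBounded R) (Qminus R)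

/-- The triangle attached to the Suslin complex. -/
theorem exists_suslin_triangle (K : (boundedAbove R).FullSubcategory) :
    ∃ (L : (boundedAbove R).FullSubcategory)
      (g : (Qminus R).obj ((suslinBounded R).obj K) ⟶ (Qminus R).obj L)
      (δ : (Qminus R).obj L ⟶ ((Qminus R).obj K)⟦(1 : ℤ)⟧),
      (∀ n, IsContractiblePresheaf R (L.obj.X n)) ∧
        Triangle.mk ((Qminus R).map ((toSuslinBounded R).app K)) g δ ∈ distTriang _ := by
  obtain ⟨n, hn⟩ := K.property
  have := quasiIso_totIncl K.obj
  have hi : IsIso (Q.map (totIncl (A := constComplex K.obj) (𝟙 K.obj))) :=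
    (isIso_Q_map_iff_quasiIso _ _).2 this
  obtain ⟨B, g, δ, ht, ⟨e⟩⟩ := exists_triangle_of_shortExact_of_hom
    (suslinSequence_shortExact K.obj) (P := (Qminus R).obj K)
    (B := (Qminus R).obj ((suslinBounded R).obj K))
    (@asIso _ _ _ _ (Q.map (totIncl (A := constComplex K.obj) (𝟙 K.obj))) hi) (Iso.refl _)
    ((Qminus R).map ((toSuslinBounded R).app K)) (by
      refine (Category.comp_id _).trans ?_
      exact (congrArg Q.map (toSuslin_eq K.obj)).trans (Q.map_comp _ _))
  let L : (boundedAbove R).FullSubcategory :=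
    ⟨suslinQuotient K.obj, n, (inferInstance : (suslinQuotient K.obj).IsStrictlyLE n)⟩
  let e' : B ≅ (Qminus R).obj L := ObjectProperty.isoMk _ e
  exact ⟨L, _, _, isContractiblePresheaf_suslinQuotient K.obj, distinguished_mk_of_iso₃ ht e'⟩

variable {R}

theorem a1Contr_Qminus {L : (boundedAbove R).FullSubcategory}
    (hL : ∀ n, IsContractiblePresheaf R (L.obj.X n)) : a1Contr R ((Qminus R).obj L) := by
  obtain ⟨n, hn⟩ := L.property
  exact a1Contr_of_contractible_terms (K := L.obj) (Iso.refl _) n hL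

theorem exists_iso_Qminus (B : Minus (Pre R)) :
    ∃ K : (boundedAbove R).FullSubcategory, Nonempty (B ≅ (Qminus R).obj K) := by
  obtain ⟨n, hn⟩ := exists_isLE B
  obtain ⟨K, hK, ⟨e⟩⟩ := exists_iso_mk B n hn
  exact ⟨⟨K, n, hK⟩, ⟨e⟩⟩

theorem eq_zero_of_a1Contr {B A : Minus (Pre R)} (f : B ⟶ A) (hB : a1Contr R B)
    (hA : a1Inv R A) : f = 0 :=
  a1Contr_le_leftOrthogonal R B hB f hA

variable (R) in
theorem isSemiorthogonalDecomposition :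
    IsSemiorthogonalDecomposition (a1Inv R) (a1Contr R) where
  thick_left := isThick_a1Inv R
  thick_right := (isThickWithSums_a1Contr R).toIsThick
  hom_eq_zero := eq_zero_of_a1Contr
  exists_triangle X := by
    obtain ⟨K, ⟨e⟩⟩ := exists_iso_Qminus X
    obtain ⟨L, g, δ, hL, ht⟩ := exists_suslin_triangle R K
    -- Rotating backwards puts the shifted contractible part first: `L⟦-1⟧ ⟶ K ⟶ C^*(K)`.
    have ht' := inv_rot_of_distTriang _ ht
    exact ⟨_, (Qminus R).obj ((suslinBounded R).obj K), _, _, _,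
      (isThickWithSums_a1Contr R).toIsThick.shift (a1Contr_Qminus hL) (-1),
      a1Inv_suslinBounded R K, distinguished_mk_of_iso ht' (Iso.refl _) e (Iso.refl _)⟩

theorem a1Contr_iff (B : Minus (Pre R)) :
    a1Contr R B ↔ ∃ K : (boundedAbove R).FullSubcategory,
      (∀ n : ℤ, IsContractiblePresheaf R (K.obj.X n)) ∧ Nonempty (B ≅ (Qminus R).obj K) := by
  have hT := (isThickWithSums_a1Contr R).toIsThick
  refine ⟨fun hB => ?_, ?_⟩
  · obtain ⟨K, ⟨e⟩⟩ := exists_iso_Qminus B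
    obtain ⟨L, g, δ, hL, ht⟩ := exists_suslin_triangle R K
    have hK : a1Contr R ((Qminus R).obj K) := hT.of_iso e hB
    have hG : a1Contr R ((Qminus R).obj ((suslinBounded R).obj K)) :=
      hT.ext₂ ht hK (a1Contr_Qminus hL)
    -- The Suslin complex now lies in both parts of the decomposition, so its identity vanishes, and
    -- `K` is isomorphic to the shift of `L`.
    have hz : IsZero ((Qminus R).obj ((suslinBounded R).obj K)) := by
      rw [IsZero.iff_id_eq_zero]
      exact eq_zero_of_a1Contr _ hG (a1Inv_suslinBounded R K)
    obtain ⟨e'⟩ : Nonempty (((Qminus R).obj L)⟦(-1 : ℤ)⟧ ≅ (Qminus R).obj K) :=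
      have hi := (Triangle.isZero₃_iff_isIso₁ _ (inv_rot_of_distTriang _ ht)).1 hz
      ⟨@asIso _ _ _ _ _ hi⟩
    obtain ⟨n, hn⟩ := L.property
    -- Shifting by `-1` moves terms up one degree, so they stay contractible and the bound becomes
    -- `n + 1`.
    refine ⟨⟨L.obj⟦(-1 : ℤ)⟧, n + 1, L.obj.isStrictlyLE_shift n (-1) (n + 1) (by lia)⟩,
      fun m => hL (m + -1), ⟨e ≪≫ e'.symm ≪≫ ObjectProperty.isoMk _ ?_⟩⟩
    exact (Minus.ι.commShiftIso (-1 : ℤ)).app _ ≪≫ ((Q.commShiftIso (-1 : ℤ)).app L.obj).symm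
  · rintro ⟨K, hK, ⟨e⟩⟩
    exact hT.of_iso e.symm (a1Contr_Qminus hK)

/-- The universal property of the Suslin complex. -/
theorem toSuslinInv_bijective (K : (boundedAbove R).FullSubcategory)
    (A : (a1Inv R).FullSubcategory) :
    Function.Bijective fun u : (suslinInv R).obj K ⟶ A => (toSuslinInv R).app K ≫ u.hom := by
  obtain ⟨L, g, δ, hL, ht⟩ := exists_suslin_triangle R K
  have hT := (isThickWithSums_a1Contr R).toIsThick
  constructor
  · intro a b hab
    ext : 1
    rw [← sub_eq_zero]
    -- The difference factors through `L`, which has no nonzero morphism to `A`. For surjectivity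
    -- the obstruction is likewise a morphism from `L⟦-1⟧` to `A`.
    obtain ⟨c, hc⟩ := Triangle.yoneda_exact₂ _ ht (a.hom - b.hom)
      ((Preadditive.comp_sub _ _ _).trans (sub_eq_zero.2 hab))
    rw [hc, eq_zero_of_a1Contr c (a1Contr_Qminus hL) A.property]
    exact comp_zero
  · intro f
    obtain ⟨c, hc⟩ := Triangle.yoneda_exact₂ _ (inv_rot_of_distTriang _ ht) f
      (eq_zero_of_a1Contr _ (hT.shift (a1Contr_Qminus hL) (-1)) A.property)
    exact ⟨ObjectProperty.homMk c, hc.symm⟩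

end

end A1Motives

/-! ### The left adjoint -/

namespace A1Motives

noncomputable section

variable {S : Scheme.{u}} (R : Ringoid S) [HasDerivedCategory.{w} (Pre R)]

open DerivedCategory

/-- A bounded above complex representing an object of `D⁻`. -/
def representative (X : Minus (Pre R)) : (boundedAbove R).FullSubcategory :=
  (exists_iso_Qminus X).choose

/-- An object of `D⁻` is isomorphic to the image of its representative. -/
def representativeIso (X : Minus (Pre R)) : X ≅ (Qminus R).obj (representative R X) :=
  (exists_iso_Qminus X).choose_spec.some

/-- The bijections defining the reflection to the invariant objects. -/
def suslinEquiv (X : Minus (Pre R)) (A : (a1Inv R).FullSubcategory) :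
    ((suslinInv R).obj (representative R X) ⟶ A) ≃ (X ⟶ (a1Inv R).ι.obj A) :=
  (Equiv.ofBijective _ (toSuslinInv_bijective (representative R X) A)).trans
    ((representativeIso R X).symm.homFromEquiv)

theorem suslinEquiv_comp (X : Minus (Pre R)) (A B : (a1Inv R).FullSubcategory) (g : A ⟶ B)
    (u : (suslinInv R).obj (representative R X) ⟶ A) :
    suslinEquiv R X B (u ≫ g) = suslinEquiv R X A u ≫ (a1Inv R).ι.map g := by
  change (representativeIso R X).hom ≫ (toSuslinInv R).app _ ≫ u.hom ≫ g.hom =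
    ((representativeIso R X).hom ≫ (toSuslinInv R).app _ ≫ u.hom) ≫ g.hom
  simp only [Category.assoc]

/-- The reflection to the invariant objects. -/
abbrev reflection : Minus (Pre R) ⥤ (a1Inv R).FullSubcategory :=
  Adjunction.leftAdjointOfEquiv (suslinEquiv R) (suslinEquiv_comp R)

/-- The reflection is left adjoint to the inclusion of the invariant objects. -/
def reflectionAdjunction : reflection R ⊣ (a1Inv R).ι :=
  Adjunction.adjunctionOfEquivLeft (suslinEquiv R) (suslinEquiv_comp R)

/-- The comparison of a reflection with the Suslin complex. -/
def reflectionToSuslin {L : Minus (Pre R) ⥤ (a1Inv R).FullSubcategory} (adj : L ⊣ (a1Inv R).ι) :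
    Qminus R ⋙ L ⟶ suslinInv R where
  app K := (adj.homEquiv _ _).symm ((toSuslinInv R).app K)
  naturality K K' f := by
    rw [Functor.comp_map, ← adj.homEquiv_naturality_left_symm,
      ← adj.homEquiv_naturality_right_symm, (toSuslinInv R).naturality]
    rfl

/-- By Yoneda: maps from either side to an invariant object are the maps from `K` to it, through the
adjunction on one side and `toSuslinInv_bijective` on the other. -/
instance {L : Minus (Pre R) ⥤ (a1Inv R).FullSubcategory} (adj : L ⊣ (a1Inv R).ι) :
    IsIso (reflectionToSuslin R adj) := by
  have (K : (boundedAbove R).FullSubcategory) : IsIso ((reflectionToSuslin R adj).app K) := by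
    rw [isIso_iff_coyoneda_map_bijective]
    intro A
    have h := ((adj.homEquiv ((Qminus R).obj K) A).symm.bijective.comp
      (toSuslinInv_bijective K A))
    refine (congrArg Function.Bijective (funext fun u => ?_)).mp h
    exact adj.homEquiv_naturality_right_symm ((toSuslinInv R).app K) u
  exact NatIso.isIso_of_isIso_app _

/-- A reflection to the invariant objects is given by the Suslin complex. -/
def reflectionIsoSuslin {L : Minus (Pre R) ⥤ (a1Inv R).FullSubcategory} (adj : L ⊣ (a1Inv R).ι) :
    Qminus R ⋙ L ⋙ (a1Inv R).ι ⋙ Minus.ι ≅ (boundedAbove R).ι ⋙ suslin R ⋙ Q :=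
  Functor.isoWhiskerRight (asIso (reflectionToSuslin R adj)) ((a1Inv R).ι ⋙ Minus.ι)

end

end A1Motives

theorem mainTheorem3 (S : Scheme.{u}) [IsNoetherian S] [S.IsSeparated]
    (R : A1Motives.Ringoid S) [HasDerivedCategory.{w} (A1Motives.Pre R)] :
    -- 1) the `𝔸¹`-invariant objects
    (A1Motives.IsThickWithSums.{u} (A1Motives.a1Inv R) ∧
      A1Motives.IsThickWithProducts.{u} (A1Motives.a1Inv R) ∧
      (∀ A : DerivedCategory.Minus (A1Motives.Pre R), A1Motives.a1Inv R A ↔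
        ∀ n : ℤ, A1Motives.IsHomotopyInvariant R
          ((DerivedCategory.homologyFunctor (A1Motives.Pre R) n).obj A.obj)) ∧
      A1Motives.a1Inv R = A1Motives.thickProductClosure.{u}
        (A1Motives.presheavesIn R (A1Motives.IsHomotopyInvariant R)) ∧
      (∀ A : DerivedCategory.Minus (A1Motives.Pre R),
        (A1Motives.presheavesIn R (A1Motives.IsHomotopyInvariant R)).triangEnvelope A ↔
          A1Motives.a1Inv R A ∧ DerivedCategory.TStructure.t.bounded A.obj)) ∧
    -- 2) the `𝔸¹`-contractible part
    ((∀ B : DerivedCategory.Minus (A1Motives.Pre R), A1Motives.a1Contr R B ↔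
        ∃ K : (A1Motives.boundedAbove R).FullSubcategory,
          (∀ n : ℤ, A1Motives.IsContractiblePresheaf R (K.obj.X n)) ∧
            Nonempty (B ≅ (A1Motives.Qminus R).obj K)) ∧
      A1Motives.a1Contr R = A1Motives.thickSumClosure.{u}
        (A1Motives.presheavesIn R fun F =>
          ∃ X : A1Motives.Sm S, Nonempty (F ≅ A1Motives.contrGen R X))) ∧
    -- 3) the decomposition, and the reflection given by the Suslin complex
    (A1Motives.IsSemiorthogonalDecomposition (A1Motives.a1Inv R) (A1Motives.a1Contr R) ∧
      ∃ L : DerivedCategory.Minus (A1Motives.Pre R) ⥤ (A1Motives.a1Inv R).FullSubcategory,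
        Nonempty (L ⊣ (A1Motives.a1Inv R).ι) ∧
          Nonempty (A1Motives.Qminus R ⋙ L ⋙ (A1Motives.a1Inv R).ι ⋙ DerivedCategory.Minus.ι ≅
            (A1Motives.boundedAbove R).ι ⋙ A1Motives.suslin R ⋙ DerivedCategory.Q)) :=
  ⟨⟨A1Motives.isThickWithSums_a1Inv R, A1Motives.isThickWithProducts_a1Inv R,
      A1Motives.a1Inv_iff R, A1Motives.a1Inv_eq_thickProductClosure R,
      A1Motives.triangEnvelope_iff R⟩,
    ⟨A1Motives.a1Contr_iff, A1Motives.a1Contr_eq_thickSumClosure R⟩,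
    A1Motives.isSemiorthogonalDecomposition R, A1Motives.reflection R,
    ⟨A1Motives.reflectionAdjunction R⟩,
    ⟨A1Motives.reflectionIsoSuslin R (A1Motives.reflectionAdjunction R)⟩⟩
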